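/- All Turing machines below are deterministic and have a read-only input tape, finitely many work tapes and a write-only output tape; the space used on an input is the number of work tape cells visited. For $g:\mathbb N\to\mathbb R$, let $\mathrm{SPACE}_{\mathbb R}(g(n))$ be the set of all real numbers $x$ for which there are a Turing machine $M$ and a function $T:\mathbb N\to\mathbb N$ with $T(n)=\mathcal O(g(n))$ such that for every $n\in\mathbb N$, on input $0^n$, $M$ halts, outputs a base 2 representation of a dyadic number $d$ with $|d-x|\le 2^{-n}$, and uses space at most $T(n)$. For a function $f:\mathbb N\to\mathbb N$ that is strictly increasing on the positive integers, let \[ \mu_f=\sum_{k=1}^{\infty}\frac{1}{10^{f(k)}} . \] Theorem. (1) Let $f:\mathbb N\to\mathbb N$ be strictly increasing on the positive integers, and let $s:\mathbb N\to\mathbb N$ be a nondecreasing function such that some Turing machine computes $f$, with the argument and the value written in binary, using space at most $s(m)$ on arguments of binary length $m$. Then \[ \mu_f\in \mathrm{SPACE}_{\mathbb R}\bigl(\max\{\log f(n),\ \log n,\ s(\lfloor\log_2 n\rfloor)\}\bigr). \] (2) For every integer $d\ge 1$, the number $\sum_{k=1}^{\infty}10^{-k^d}$ is computable in logarithmic space,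 that is, it is in $\mathrm{SPACE}_{\mathbb R}(\log n)$. (3) Liouville's constant $\sum_{k=1}^{\infty}10^{-k!}$ is in $\mathrm{SPACE}_{\mathbb R}(n\log n)$. -/

import Mathlib

namespace RealSpace

/-- The possible moves of a tape head. -/
inductive Move
  | left
  | stay
  | right

/-- A deterministic multitape Turing machine with input alphabet `I` and output alphabet `O`.
It has a read-only two-way input tape, `tapes` read-write work tapes with the finite alphabet
`Work`, and a write-only output tape.  In state `q`, scanning the input symbol `a` (`none` is the
blank) and the work symbols `b`, it halts if `step q a b = none`.  Otherwise `step q a b` gives the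
new state, the move of the input head, the symbol written and the move made on each work tape,
and the symbol (if any) that is appended to the output. -/
structure Machine (I O : Type) where
  State : Type
  finite_state : Finite State
  Work : Type
  finite_work : Finite Work
  tapes : ℕ
  start : State
  blank : Work
  step : State → Option I → (Fin tapes → Work) →
    Option (State × Move × (Fin tapes → Work × Move) × Option O)

namespace Machine

variable {I O : Type}

/-- A configuration of `M`: the state, the position of the input head, the content and the head
position of each (one-way infinite) work tape, and what has been written on the output tape. -/
structure Cfg (M : Machine I O) where
  state : M.State
  inputPos : ℕ
  tape : Fin M.tapes → ℕ → M.Work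
  pos : Fin M.tapes → ℕ
  output : List O

/-- The input `w` is in the cells `1, …, |w|` of the input tape, between the blank cells `0` and
`|w| + 1`. -/
def inputSymbol (w : List I) : ℕ → Option I
  | 0 => none
  | p + 1 => w[p]?

/-- The input head never leaves the cells `0, …, |w| + 1`. -/
def moveInput (w : List I) (p : ℕ) : Move → ℕ
  | .left => p - 1
  | .stay => p
  | .right => min (p + 1) (w.length + 1)

/-- A move to the left from the first cell of a work tape has no effect. -/
def moveWork (p : ℕ) : Move → ℕ
  | .left => p - 1
  | .stay => p
  | .right => p + 1

/-- The initial configuration: the input head is on the first input cell (which is blank if the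
input is empty), and the work tapes and the output tape are blank. -/
def init (M : Machine I O) : M.Cfg where
  state := M.start
  inputPos := 1
  tape := fun _ _ => M.blank
  pos := fun _ => 0
  output := []

/-- One move of `M` on the input `w`; `none` if `M` halts. -/
def next (M : Machine I O) (w : List I) (c : M.Cfg) : Option M.Cfg :=
  (M.step c.state (inputSymbol w c.inputPos) (fun i => c.tape i (c.pos i))).map fun r =>
    { state := r.1
      inputPos := moveInput w c.inputPos r.2.1
      tape := fun i => Function.update (c.tape i) (c.pos i) (r.2.2.1 i).1
      pos := fun i => moveWork (c.pos i) (r.2.2.1 i).2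
      output := c.output ++ r.2.2.2.toList }

/-- On input `w` the machine `M` halts with `v` on the output tape. -/
def Outputs (M : Machine I O) (w : List I) (v : List O) : Prop :=
  ∃ c : M.Cfg, StateTransition.Reaches (M.next w) M.init c ∧ M.next w c = none ∧ c.output = v

/-- The number of work tape cells that `M` uses (visits) during its computation on input `w`.
The cells of the input tape and of the output tape are not counted. -/
noncomputable def space (M : Machine I O) (w : List I) : ℕ∞ :=
  {x : Fin M.tapes × ℕ |
    ∃ c : M.Cfg, StateTransition.Reaches (M.next w) M.init c ∧ c.pos x.1 = x.2}.encard

end Machine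

/-- The natural number with a given string of bits (most significant bit first). -/
def bitsVal (l : List Bool) : ℕ :=
  l.foldl (fun v b => 2 * v + b.toNat) 0

/-- The binary numeral of `n`, most significant bit first and without leading zeros; the numeral
of `0` is the string `0`. -/
def numeral (n : ℕ) : List Bool :=
  if n = 0 then [false] else n.bits.reverse

/-- `f` is computable, with numbers written in binary, by a Turing machine that uses at most `s m`
work tape cells on (numerals that are) inputs of length `m`. -/
def ComputableInSpace (f s : ℕ → ℕ) : Prop :=
  ∃ M : Machine Bool Bool, ∀ k : ℕ,
    M.Outputs (numeral k) (numeral (f k)) ∧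
    M.space (numeral k) ≤ (s (numeral k).length : ℕ∞)

/-- The symbols used to write dyadic numbers: a minus sign, the binary point, and the digits. -/
inductive Sym
  | minus
  | point
  | digit (b : Bool)

/-- The string `u` is a base 2 representation `± aₘ ⋯ a₀ . b₁ ⋯ bₙ` of the dyadic number `d`. -/
def Represents (u : List Sym) (d : ℝ) : Prop :=
  ∃ (neg : Bool) (a b : List Bool), a ≠ [] ∧
    u = (if neg then [Sym.minus] else []) ++ a.map Sym.digit ++ [Sym.point] ++ b.map Sym.digit ∧
    d = (if neg then -1 else 1) * ((bitsVal a : ℝ) + (bitsVal b : ℝ) / 2 ^ b.length)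

/-- The space complexity of the real number `x` is bounded by `T`: some Turing machine, on every
input `0ⁿ`, outputs a representation of a dyadic number `d` with `|d - x| ≤ 2⁻ⁿ` and uses at most
`T n` work tape cells.  (The input alphabet `Unit` has just one symbol.) -/
def SpaceBounded (x : ℝ) (T : ℕ → ℕ) : Prop :=
  ∃ M : Machine Unit Sym, ∀ n : ℕ,
    (∃ (u : List Sym) (d : ℝ), M.Outputs (List.replicate n ()) u ∧ Represents u d ∧
      |d - x| ≤ 1 / 2 ^ n) ∧
    M.space (List.replicate n ()) ≤ (T n : ℕ∞)

/-- The class of the real numbers whose space complexity is `O(g(n))`. -/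
def SPACE (g : ℕ → ℝ) : Set ℝ :=
  {x | ∃ T : ℕ → ℕ, SpaceBounded x T ∧ (fun n => (T n : ℝ)) =O[Filter.atTop] g}

/-- The number `∑_{k ≥ 1} 10^{-f(k)}`. -/
noncomputable def mu (f : ℕ → ℕ) : ℝ :=
  ∑' k : ℕ, 1 / (10 : ℝ) ^ f (k + 1)

/-- The series that defines `mu f` converges if `f` is strictly increasing on the positive
integers. -/
theorem summable_mu {f : ℕ → ℕ} (hf : StrictMonoOn f (Set.Ici 1)) :
    Summable fun k : ℕ => 1 / (10 : ℝ) ^ f (k + 1) := by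
  have hg : StrictMono fun k => f (k + 1) := fun a b hab =>
    hf (by simp) (by simp) (by omega)
  have h : Summable fun k : ℕ => (1 / 10 : ℝ) ^ k :=
    summable_geometric_of_lt_one (by norm_num) (by norm_num)
  refine (h.comp_injective hg.injective).congr fun k => ?_
  simp [Function.comp]

end RealSpace

/-!
The number `mu f` is approximated by a rational number whose binary digits can be computed with
natural numbers that are polynomially bounded in the precision `n`; a Turing machine that keeps
these numbers on its work tapes in binary needs only logarithmic space, apart from the calls of a
machine for `f`.

*The approximation.*  Put `K = n / 3 + 2`.  The terms of the series that exceed `10 ^ (-K)` add up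
to `A / 10 ^ K`, where `A = numer f K`, and the others are negligible.  The power of `10` in the
denominator is then exchanged for a squarefree number.  Primes `p = j + 20` of polynomial size are
distributed among `K` groups of `4 * K` primes at least (`le_rank_cand`, from Chebyshev's bound).
Let `P i` be the product of the group `i`, and `R i` the product of the residues of its elements
modulo `10`.  Then `P i - R i` is divisible by `10`, and `R i / P i` is tiny, so that
`N = (A / 2) * ∏ i, (P i - R i) / 10` is an integer for which `N / ∏ i, P i` is close to
`A / (2 * 10 ^ K)` (`target_div_le`, `le_target_div`).

*Its digits.*  By the Chinese remainder theorem, `N / ∏ i, P i` is modulo `1` the sum of fractions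
`c / p`, one for each prime (`sum_coef_modEq`), and `c` is the solution of a linear congruence
modulo `p`, both sides of which are products that can be evaluated modulo `p`.  These fractions
are rounded to polynomially many binary digits, each of which is given by a power of `2` modulo
`p`, and added column by column with a small carry (`total_div`, `digit_eq`).  Together with the
error bound `abs_total_mod_sub_mu_le` this gives the digits of a good dyadic approximation of
`mu f`.

*The machine.*  Structured programs with `inc`, `dec` and zero tests for registers are compiled to
Turing machines; one such program can moreover simulate a fixed machine on a word that it feeds to
it (`rMachine_spec`).  The functions computed by register programs with polynomially bounded
registers contain the basic arithmetical functions and are closed under bounded sums, products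
modulo small numbers, and primitive recursion with polynomially bounded values (`LS`); this
suffices for the digits (`LS.digit`).  Values of `f` are only needed for arguments `k ≤ K`, and
only up to `K`.  They are obtained by simulating the given machine for `f` on the numeral of `k`
and reading its output bit by bit (`LS.cap_call`), which takes space `s (Nat.log 2 n)`, because
the numeral of `k` is no longer than `Nat.log 2 n` as soon as `12 ≤ n`.  The values of `k ^ d` and
of `k !`, capped at `K`, are computed directly by register programs, so that both series are even
computable in logarithmic space, and `log n ≤ n * log n` gives the bound for Liouville's constant.
-/

namespace RealSpace

/-! ### Structured programs and their compilation to Turing machines -/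

/-- Structured programs over basic instructions from `A` and tests from `T`. -/
inductive Prog (A T : Type) : Type
  | skip
  | act (a : A)
  | seq (P Q : Prog A T)
  | ite (t : T) (P Q : Prog A T)
  | loop (t : T) (P : Prog A T)

/-- Big-step semantics.  `Run stp tst Inv P s s'` says that the program `P`, started in the state
`s`, terminates in the state `s'`, and that all states on the way satisfy `Inv`; here `stp` is the
effect of the instructions and `tst` the meaning of the tests. -/
inductive Run {A T S : Type} (stp : A → S → S → Prop) (tst : T → S → Prop) (Inv : S → Prop) :
    Prog A T → S → S → Prop
  | skip {s} : Inv s → Run stp tst Inv .skip s s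
  | act {a s s'} : stp a s s' → Inv s → Inv s' → Run stp tst Inv (.act a) s s'
  | seq {P Q s s' s''} : Run stp tst Inv P s s' → Run stp tst Inv Q s' s'' →
      Run stp tst Inv (.seq P Q) s s''
  | iteT {t P Q s s'} : tst t s → Run stp tst Inv P s s' → Run stp tst Inv (.ite t P Q) s s'
  | iteF {t P Q s s'} : ¬ tst t s → Run stp tst Inv Q s s' → Run stp tst Inv (.ite t P Q) s s'
  | loopT {t P s s' s''} : tst t s → Run stp tst Inv P s s' → Run stp tst Inv (.loop t P) s' s'' →
      Run stp tst Inv (.loop t P) s s''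
  | loopF {t P s} : ¬ tst t s → Inv s → Run stp tst Inv (.loop t P) s s

namespace Run

variable {A T S : Type} {stp : A → S → S → Prop} {tst : T → S → Prop} {Inv Inv' : S → Prop}
  {P : Prog A T} {s s' : S}

theorem inv_left (h : Run stp tst Inv P s s') : Inv s := by
  induction h with
  | skip h => exact h
  | act _ h _ => exact h
  | seq _ _ h _ => exact h
  | iteT _ _ h => exact h
  | iteF _ _ h => exact h
  | loopT _ _ _ h _ => exact h
  | loopF _ h => exact h

theorem inv_right (h : Run stp tst Inv P s s') : Inv s' := by
  induction h with
  | skip h => exact h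
  | act _ _ h => exact h
  | seq _ _ _ h => exact h
  | iteT _ _ h => exact h
  | iteF _ _ h => exact h
  | loopT _ _ _ _ h => exact h
  | loopF _ h => exact h

theorem mono (hI : ∀ s, Inv s → Inv' s) (h : Run stp tst Inv P s s') :
    Run stp tst Inv' P s s' := by
  induction h with
  | skip h => exact .skip (hI _ h)
  | act h h1 h2 => exact .act h (hI _ h1) (hI _ h2)
  | seq _ _ h1 h2 => exact .seq h1 h2
  | iteT h _ h1 => exact .iteT h h1
  | iteF h _ h1 => exact .iteF h h1
  | loopT h _ _ h1 h2 => exact .loopT h h1 h2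
  | loopF h h1 => exact .loopF h (hI _ h1)

/-- A loop whose body takes `x i` to `x (i + 1)` for `i < n`, and whose test fails first at
`x n`. -/
theorem loop_iterate {t : T} (x : ℕ → S) (n : ℕ) (ht : ∀ i < n, tst t (x i))
    (hP : ∀ i < n, Run stp tst Inv P (x i) (x (i + 1))) (hn : ¬ tst t (x n)) (hI : Inv (x n)) :
    Run stp tst Inv (.loop t P) (x 0) (x n) := by
  induction n generalizing x with
  | zero => exact .loopF hn hI
  | succ n ih =>
    exact .loopT (ht 0 (by omega)) (hP 0 (by omega))
      (ih (fun i => x (i + 1)) (fun i hi => ht _ (by omega)) (fun i hi => hP _ (by omega)) hn hI)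

end Run

/-! #### Programs for a multitape Turing machine -/

namespace TM

/-- An instruction of a Turing machine whose work tapes are indexed by `ι` and have the alphabet
`W`: the move of the input head, the symbol written and the move on each work tape, and the
symbol that is appended to the output (if any), as functions of the scanned symbols. -/
abbrev Instr (I O ι W : Type) :=
  Option I → (ι → W) → Move × (ι → W × Move) × Option O

/-- A test of a Turing machine: a property of the scanned symbols. -/
abbrev Test (I ι W : Type) := Option I → (ι → W) → Prop

/-- The part of the configuration of a Turing machine that does not depend on its control. -/
@[ext]
structure Store (O ι W : Type) where
  inputPos : ℕ
  tape : ι → ℕ → W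
  pos : ι → ℕ
  output : List O

variable {I O ι W : Type}

/-- The effect of an instruction on input `w`. -/
def apply (w : List I) (a : Instr I O ι W) (s : Store O ι W) : Store O ι W :=
  let r := a (Machine.inputSymbol w s.inputPos) (fun i => s.tape i (s.pos i))
  { inputPos := Machine.moveInput w s.inputPos r.1
    tape := fun i => Function.update (s.tape i) (s.pos i) (r.2.1 i).1
    pos := fun i => Machine.moveWork (s.pos i) (r.2.1 i).2
    output := s.output ++ r.2.2.toList }

/-- Big-step semantics of Turing machine programs on input `w`. -/
abbrev Runs (w : List I) (Inv : Store O ι W → Prop) :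
    Prog (Instr I O ι W) (Test I ι W) → Store O ι W → Store O ι W → Prop :=
  Run (fun a s s' => s' = apply w a s)
    (fun t s => t (Machine.inputSymbol w s.inputPos) (fun i => s.tape i (s.pos i))) Inv

/-- The instruction without effect. -/
def nop : Instr I O ι W := fun _ b => (.stay, fun i => (b i, .stay), none)

theorem apply_nop (w : List I) (s : Store O ι W) : apply w nop s = s := by
  simp [apply, nop, Machine.moveInput, Machine.moveWork]

end TM

namespace Prog

variable {A T : Type}

/-- The control points that are reached when the program `P` is executed, with the list `K` of
programs left to be executed afterwards. -/
def conts : Prog A T → List (Prog A T) → Set (List (Prog A T))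
  | skip, K => {skip :: K}
  | act a, K => {act a :: K}
  | seq P Q, K => {seq P Q :: K} ∪ (conts P (Q :: K) ∪ conts Q K)
  | ite t P Q, K => {ite t P Q :: K} ∪ (conts P K ∪ conts Q K)
  | loop t P, K => {loop t P :: K} ∪ conts P (loop t P :: K)

theorem finite_conts (P : Prog A T) (K : List (Prog A T)) : (P.conts K).Finite := by
  induction P generalizing K with
  | skip => exact Set.finite_singleton _
  | act a => exact Set.finite_singleton _
  | seq P Q hP hQ => exact (Set.finite_singleton _).union ((hP _).union (hQ _))
  | ite t P Q hP hQ => exact (Set.finite_singleton _).union ((hP _).union (hQ _))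
  | loop t P hP => exact (Set.finite_singleton _).union (hP _)

theorem cons_mem_conts (P : Prog A T) (K : List (Prog A T)) : P :: K ∈ P.conts K := by
  cases P <;> simp [conts]

end Prog

namespace TM

variable {I O ι W : Type}

open Classical in
/-- One step of the control: the instruction that is executed and the programs that are left. -/
noncomputable def ctl : List (Prog (Instr I O ι W) (Test I ι W)) → Option I → (ι → W) →
    Option (List (Prog (Instr I O ι W) (Test I ι W)) × Instr I O ι W)
  | [], _, _ => none
  | .skip :: K, _, _ => some (K, nop)
  | .act a :: K, _, _ => some (K, a)
  | .seq P Q :: K, _, _ => some (P :: Q :: K, nop)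
  | .ite t P Q :: K, x, b => some (if t x b then P :: K else Q :: K, nop)
  | .loop t P :: K, x, b => some (if t x b then P :: .loop t P :: K else K, nop)

open Classical in
/-- The Turing machine that executes a program.  Its states are the control points of the
program. -/
noncomputable def machine [Fintype ι] [Finite W] (blank : W)
    (P : Prog (Instr I O ι W) (Test I ι W)) : Machine I O where
  State := {K : List (Prog (Instr I O ι W) (Test I ι W)) // K ∈ insert [] (P.conts [])}
  finite_state := ((P.finite_conts []).insert []).to_subtype
  Work := W
  finite_work := inferInstance
  tapes := Fintype.card ι
  start := ⟨[P], Or.inr (P.cons_mem_conts [])⟩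
  blank := blank
  step := fun q x b =>
    (ctl q.1 x (fun i => b (Fintype.equivFin ι i))).bind fun r =>
      if h : r.1 ∈ insert [] (P.conts []) then
        let u := r.2 x (fun i => b (Fintype.equivFin ι i))
        some (⟨r.1, h⟩, u.1, fun i => u.2.1 ((Fintype.equivFin ι).symm i), u.2.2)
      else none

section

variable [Fintype ι] [Finite W] (blank : W) (P : Prog (Instr I O ι W) (Test I ι W))

/-- The configuration of `machine blank P` with a given control point and store. -/
noncomputable def cfg (K : List (Prog (Instr I O ι W) (Test I ι W)))
    (hK : K ∈ insert [] (P.conts [])) (s : Store O ι W) : (machine blank P).Cfg where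
  state := ⟨K, hK⟩
  inputPos := s.inputPos
  tape := fun i => s.tape ((Fintype.equivFin ι).symm i)
  pos := fun i => s.pos ((Fintype.equivFin ι).symm i)
  output := s.output

/-- The store of a machine that starts its computation. -/
def initStore : Store O ι W where
  inputPos := 1
  tape := fun _ _ => blank
  pos := fun _ => 0
  output := []

theorem next_cfg (w : List I) {K K' : List (Prog (Instr I O ι W) (Test I ι W))}
    (hK : K ∈ insert [] (P.conts [])) (hK' : K' ∈ insert [] (P.conts [])) (s : Store O ι W)
    (a : Instr I O ι W)
    (h : ctl K (Machine.inputSymbol w s.inputPos) (fun i => s.tape i (s.pos i)) = some (K', a)) :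
    (machine blank P).next w (cfg blank P K hK s) = some (cfg blank P K' hK' (apply w a s)) := by
  simp [Machine.next, machine, cfg, h, hK', apply]

end

end TM

namespace Machine

variable {I O : Type}

/-- All configurations of the computation that starts with `c` satisfy `Inv`, and the computation
halts in a configuration that satisfies `Q`. -/
inductive Good (M : Machine I O) (w : List I) (Inv Q : M.Cfg → Prop) : M.Cfg → Prop
  | halt {c} : M.next w c = none → Inv c → Q c → Good M w Inv Q c
  | step {c c'} : M.next w c = some c' → Inv c → Good M w Inv Q c' → Good M w Inv Q c

variable {M : Machine I O} {w : List I} {Inv Q : M.Cfg → Prop} {c c' : M.Cfg}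

theorem Good.inv (h : Good M w Inv Q c) (hc : StateTransition.Reaches (M.next w) c c') :
    Inv c' := by
  have key : Good M w Inv Q c' := by
    induction hc with
    | refl => exact h
    | tail _ h2 ih =>
      cases ih with
      | halt h3 _ _ => rw [h3] at h2; cases h2
      | step h3 _ h4 => rw [h3] at h2; cases h2; exact h4
  cases key with
  | halt _ h _ => exact h
  | step _ h _ => exact h

theorem Good.halts (h : Good M w Inv Q c) :
    ∃ c', StateTransition.Reaches (M.next w) c c' ∧ M.next w c' = none ∧ Q c' := by
  induction h with
  | halt h _ hQ => exact ⟨_, .refl, h, hQ⟩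
  | step h _ _ ih =>
    obtain ⟨c', h1, h2, h3⟩ := ih
    exact ⟨c', .head h h1, h2, h3⟩

end Machine

namespace TM

variable {I O ι W : Type} [Fintype ι] [Finite W] (blank : W)
  (P₀ : Prog (Instr I O ι W) (Test I ι W))

/-- A continuation-passing simulation: if the program `P` takes `s` to `s'`, and the machine halts
properly from the control point `K` and the store `s'`, then it does so from `P :: K` and `s`. -/
theorem good_of_run {w : List I} {InvS : Store O ι W → Prop}
    {Inv Q : (machine blank P₀).Cfg → Prop} (hI : ∀ K hK s, InvS s → Inv (cfg blank P₀ K hK s))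
    {P : Prog (Instr I O ι W) (Test I ι W)} {s s' : Store O ι W} (h : Runs w InvS P s s') :
    ∀ (K : List (Prog (Instr I O ι W) (Test I ι W))) (hP : P.conts K ⊆ P₀.conts [])
      (hK : K ∈ insert [] (P₀.conts [])),
      Machine.Good (machine blank P₀) w Inv Q (cfg blank P₀ K hK s') →
      Machine.Good (machine blank P₀) w Inv Q
        (cfg blank P₀ (P :: K) (Or.inr (hP (P.cons_mem_conts K))) s) := by
  induction h with
  | @skip s h =>
    intro K hP hK hg
    refine .step (next_cfg blank P₀ w _ hK s nop rfl) (hI _ _ _ h) ?_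
    rwa [apply_nop]
  | @act a s s' h h1 h2 =>
    intro K hP hK hg
    refine .step (next_cfg blank P₀ w _ hK s a rfl) (hI _ _ _ h1) ?_
    rwa [← h]
  | @seq P Q s s' s'' hr _ ih1 ih2 =>
    intro K hP hK hg
    have hQ : Q.conts K ⊆ P₀.conts [] := fun x hx => hP (Or.inr (Or.inr hx))
    have hP' : P.conts (Q :: K) ⊆ P₀.conts [] := fun x hx => hP (Or.inr (Or.inl hx))
    have hQK : Q :: K ∈ insert [] (P₀.conts []) := Or.inr (hQ (Q.cons_mem_conts K))
    refine .step (next_cfg blank P₀ w _ (K' := P :: Q :: K)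
      (Or.inr (hP' (P.cons_mem_conts _))) s nop rfl) (hI _ _ _ hr.inv_left) ?_
    rw [apply_nop]
    exact ih1 (Q :: K) hP' hQK (ih2 K hQ hK hg)
  | @iteT t P Q s s' ht hr ih =>
    intro K hP hK hg
    have hP' : P.conts K ⊆ P₀.conts [] := fun x hx => hP (Or.inr (Or.inl hx))
    refine .step (next_cfg blank P₀ w _ (K' := P :: K)
      (Or.inr (hP' (P.cons_mem_conts _))) s nop ?_) (hI _ _ _ hr.inv_left) ?_
    · simp only [ctl, if_pos ht]
    · rw [apply_nop]
      exact ih K hP' hK hg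
  | @iteF t P Q s s' ht hr ih =>
    intro K hP hK hg
    have hP' : Q.conts K ⊆ P₀.conts [] := fun x hx => hP (Or.inr (Or.inr hx))
    refine .step (next_cfg blank P₀ w _ (K' := Q :: K)
      (Or.inr (hP' (Q.cons_mem_conts _))) s nop ?_) (hI _ _ _ hr.inv_left) ?_
    · simp only [ctl, if_neg ht]
    · rw [apply_nop]
      exact ih K hP' hK hg
  | @loopT t P s s' s'' ht hr _ ih1 ih2 =>
    intro K hP hK hg
    have hP' : P.conts (.loop t P :: K) ⊆ P₀.conts [] := fun x hx => hP (Or.inr hx)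
    refine .step (next_cfg blank P₀ w _ (K' := P :: .loop t P :: K)
      (Or.inr (hP' (P.cons_mem_conts _))) s nop ?_) (hI _ _ _ hr.inv_left) ?_
    · simp only [ctl, if_pos ht]
    · rw [apply_nop]
      exact ih1 _ hP' (Or.inr (hP (Prog.cons_mem_conts _ K))) (ih2 K hP hK hg)
  | @loopF t P s ht h =>
    intro K hP hK hg
    refine .step (next_cfg blank P₀ w _ (K' := K) hK s nop ?_) (hI _ _ _ h) ?_
    · simp only [ctl, if_neg ht]
    · rwa [apply_nop]

/-- If a program terminates and keeps the head of each work tape `i` on the cells `0, …, L i`,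
then its machine computes the same output and uses at most `∑ i, (L i + 1)` cells. -/
theorem outputs_and_space_of_run {w : List I} {L : ι → ℕ} {s : Store O ι W}
    (h : Runs w (fun s => ∀ i, s.pos i ≤ L i) P₀ (initStore blank) s) :
    (machine blank P₀).Outputs w s.output ∧
      (machine blank P₀).space w ≤ ((∑ i, (L i + 1) : ℕ) : ℕ∞) := by
  let Inv : (machine blank P₀).Cfg → Prop := fun c =>
    ∀ i, c.pos i ≤ L ((Fintype.equivFin ι).symm i)
  have hgood : Machine.Good (machine blank P₀) w Inv (fun c => c.output = s.output)
      (machine blank P₀).init := by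
    have hnil : [] ∈ insert [] (P₀.conts []) := Set.mem_insert _ _
    refine good_of_run blank P₀ (fun K hK s hs i => hs _) h [] subset_rfl hnil ?_
    refine .halt ?_ (fun i => h.inv_right _) rfl
    simp [Machine.next, machine, cfg, ctl]
  refine ⟨hgood.halts, ?_⟩
  let F : Finset (Fin (Fintype.card ι) × ℕ) :=
    (Finset.univ.sigma fun i => Finset.range (L ((Fintype.equivFin ι).symm i) + 1)).map
      (Equiv.sigmaEquivProd (Fin (Fintype.card ι)) ℕ).toEmbedding
  have hF : F.card = ∑ i, (L i + 1) := by
    rw [Finset.card_map, Finset.card_sigma]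
    simp only [Finset.card_range]
    exact Equiv.sum_comp (Fintype.equivFin ι).symm (fun i => L i + 1)
  rw [← hF, ← Set.encard_coe_eq_coe_finsetCard]
  refine Set.encard_le_encard ?_
  rintro ⟨i, p⟩ ⟨c, hc, hp⟩
  have := hgood.inv hc i
  refine Finset.mem_coe.2 (Finset.mem_map.2 ⟨⟨i, p⟩, ?_, rfl⟩)
  refine Finset.mem_sigma.2 ⟨Finset.mem_univ _, Finset.mem_range.2 ?_⟩
  simp only at hp
  simp only
  omega

end TM

/-! ### Binary counters -/

/-- The successor of a number given by its list of bits, least significant bit first. -/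
def incBits : List Bool → List Bool
  | [] => [true]
  | false :: l => true :: l
  | true :: l => false :: incBits l

/-- The predecessor of a positive number given by its list of bits, least significant bit first
and without leading zeros. -/
def decBits : List Bool → List Bool
  | [] => []
  | false :: l => true :: decBits l
  | [true] => []
  | true :: b :: l => false :: b :: l

theorem incBits_bits (n : ℕ) : incBits n.bits = (n + 1).bits := by
  induction n using Nat.binaryRec' with
  | zero => simp [incBits]
  | bit b n h ih =>
    rw [Nat.bits_append_bit n b h]
    cases b with
    | false =>
      have : Nat.bit false n + 1 = Nat.bit true n := by simp [Nat.bit]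
      rw [this, Nat.bits_append_bit n true (by simp)]
      rfl
    | true =>
      have : Nat.bit true n + 1 = Nat.bit false (n + 1) := by simp [Nat.bit]; omega
      rw [this, Nat.bits_append_bit (n + 1) false (by simp)]
      simp [incBits, ih]

theorem getLast?_bits {n : ℕ} (hn : n ≠ 0) : n.bits.getLast? = some true := by
  induction n using Nat.binaryRec' with
  | zero => exact absurd rfl hn
  | bit b n h ih =>
    rw [Nat.bits_append_bit n b h]
    rcases Nat.eq_zero_or_pos n with rfl | h0
    · simp [h rfl]
    · rw [List.getLast?_cons, ih h0.ne']; rfl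

theorem decBits_incBits {l : List Bool} (hl : l ≠ [] → l.getLast? = some true) :
    decBits (incBits l) = l := by
  induction l with
  | nil => rfl
  | cons b l ih =>
    have hl' : l ≠ [] → l.getLast? = some true := by
      intro h
      have := hl (by simp)
      rw [List.getLast?_cons] at this
      cases h' : l.getLast? with
      | none => simp at h'; exact absurd h' h
      | some x => simpa [h'] using this
    cases b with
    | false =>
      cases l with
      | nil => simp at hl
      | cons c l => rfl
    | true => simp [incBits, decBits, ih hl']

theorem decBits_bits {n : ℕ} (hn : n ≠ 0) : decBits n.bits = (n - 1).bits := by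
  obtain ⟨m, rfl⟩ := Nat.exists_eq_succ_of_ne_zero hn
  rw [Nat.succ_eq_add_one, ← incBits_bits, decBits_incBits, Nat.add_sub_cancel]
  intro h
  exact getLast?_bits (by rintro rfl; simp at h)

namespace TM

variable {I O ι Δ : Type} [DecidableEq ι]

/-- The work tape symbols of the machines constructed here: the Boolean marks the first cell of a
tape, and the rest is the content of the cell, which is either blank, or a bit, or an element of
`Δ`. -/
abbrev Symb (Δ : Type) := Bool × Option (Bool ⊕ Δ)

/-- The tape with given contents of the cells. -/
def tapeOf (f : ℕ → Option (Bool ⊕ Δ)) : ℕ → Symb Δ := fun k => (decide (k = 0), f k)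

/-- The instruction that acts on the tape `i` only. -/
def onTape (i : ι) (f : Symb Δ → Symb Δ × Move) : Instr I O ι (Symb Δ) :=
  fun _ b => (.stay, fun j => if j = i then f (b j) else (b j, .stay), none)

/-- Replace the content of the scanned cell of the tape `i` by `x`, and move. -/
def put (i : ι) (x : Option (Bool ⊕ Δ)) (m : Move) :
    Prog (Instr I O ι (Symb Δ)) (Test I ι (Symb Δ)) :=
  .act (onTape i fun y => ((y.1, x), m))

/-- Move the head of the tape `i`. -/
def move (i : ι) (m : Move) : Prog (Instr I O ι (Symb Δ)) (Test I ι (Symb Δ)) :=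
  .act (onTape i fun y => (y, m))

/-- Test the symbol scanned on the tape `i`. -/
def scan (i : ι) (p : Symb Δ → Prop) : Test I ι (Symb Δ) := fun _ b => p (b i)

/-- Move the head of the tape `i` to the first cell. -/
def rewind (i : ι) : Prog (Instr I O ι (Symb Δ)) (Test I ι (Symb Δ)) :=
  .loop (scan i fun x => x.1 = false) (move i .left)

/-- Replace the tape `i` and the position of its head. -/
def Store.setTape {W : Type} (c : Store O ι W) (i : ι) (t : ℕ → W) (p : ℕ) : Store O ι W :=
  { c with tape := Function.update c.tape i t, pos := Function.update c.pos i p }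

theorem Store.setTape_self {W : Type} (c : Store O ι W) (i : ι) :
    c.setTape i (c.tape i) (c.pos i) = c := by
  simp [setTape]

theorem apply_onTape (w : List I) (c : Store O ι (Symb Δ)) (i : ι) (t : ℕ → Symb Δ) (p : ℕ)
    (f : Symb Δ → Symb Δ × Move) :
    apply w (onTape i f) (c.setTape i t p) =
      c.setTape i (Function.update t p (f (t p)).1) (Machine.moveWork p (f (t p)).2) := by
  ext : 1
  · simp [apply, onTape, Store.setTape, Machine.moveInput]
  · funext j
    by_cases h : j = i
    · subst h
      simp [apply, onTape, Store.setTape]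
    · simp [apply, onTape, Store.setTape, h]
  · funext j
    by_cases h : j = i
    · subst h
      simp [apply, onTape, Store.setTape]
    · simp [apply, onTape, Store.setTape, h, Machine.moveWork]
  · simp [apply, onTape, Store.setTape]

theorem update_tapeOf (f : ℕ → Option (Bool ⊕ Δ)) (p : ℕ) (x : Option (Bool ⊕ Δ)) :
    Function.update (tapeOf f) p (decide (p = 0), x) = tapeOf (Function.update f p x) := by
  funext k
  by_cases h : k = p
  · subst h; simp [tapeOf]
  · simp [tapeOf, h]

section

variable {w : List I} {c : Store O ι (Symb Δ)} {i : ι} {L : ι → ℕ}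

/-- The head of each tape `i` is on one of the cells `0, …, L i`. -/
abbrev Within {W : Type} (L : ι → ℕ) (c : Store O ι W) : Prop := ∀ i, c.pos i ≤ L i

theorem within_setTape (hc : Within L c) (t : ℕ → Symb Δ) {p : ℕ} (hp : p ≤ L i) :
    Within L (c.setTape i t p) := by
  intro j
  by_cases h : j = i
  · subst h; simpa [Store.setTape] using hp
  · simpa [Store.setTape, h] using hc j

theorem run_put (hc : Within L c) (f : ℕ → Option (Bool ⊕ Δ)) (p : ℕ) (x : Option (Bool ⊕ Δ))
    (m : Move) (hp : p ≤ L i) (hm : Machine.moveWork p m ≤ L i) :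
    Runs w (Within L) (put i x m) (c.setTape i (tapeOf f) p)
      (c.setTape i (tapeOf (Function.update f p x)) (Machine.moveWork p m)) := by
  refine .act ?_ (within_setTape hc _ hp) (within_setTape hc _ hm)
  rw [apply_onTape]
  simp only [tapeOf]
  rw [← update_tapeOf]

theorem run_move (hc : Within L c) (t : ℕ → Symb Δ) (p : ℕ)
    (m : Move) (hp : p ≤ L i) (hm : Machine.moveWork p m ≤ L i) :
    Runs w (Within L) (move i m) (c.setTape i t p) (c.setTape i t (Machine.moveWork p m)) := by
  refine .act ?_ (within_setTape hc _ hp) (within_setTape hc _ hm)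
  rw [apply_onTape]
  simp

theorem scan_setTape (p : Symb Δ → Prop) (t : ℕ → Symb Δ) (k : ℕ) (x : Option I) :
    scan i p x (fun j => (c.setTape i t k).tape j ((c.setTape i t k).pos j)) ↔ p (t k) := by
  simp [scan, Store.setTape]

theorem run_rewind (hc : Within L c) (f : ℕ → Option (Bool ⊕ Δ)) (p : ℕ) (hp : p ≤ L i) :
    Runs w (Within L) (rewind i) (c.setTape i (tapeOf f) p) (c.setTape i (tapeOf f) 0) := by
  induction p with
  | zero =>
    refine .loopF ?_ (within_setTape hc _ hp)
    rw [scan_setTape]; simp [tapeOf]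
  | succ p ih =>
    refine .loopT ?_ (run_move hc _ _ _ hp ?_) (ih (by omega))
    · rw [scan_setTape]; simp [tapeOf]
    · simp only [Machine.moveWork]; omega

/-- The contents of a tape that holds a list of bits. -/
def bitCells (l : List Bool) : ℕ → Option (Bool ⊕ Δ) := fun k => l[k]?.map .inl

theorem update_bitCells_append (pre : List Bool) (a b : Bool) (l : List Bool) :
    Function.update (bitCells (pre ++ a :: l)) pre.length (some (.inl b)) =
      (bitCells (pre ++ b :: l) : ℕ → Option (Bool ⊕ Δ)) := by
  funext k
  rcases lt_trichotomy k pre.length with h | h | h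
  · simp [bitCells, h.ne, List.getElem?_append_left h]
  · subst h; simp [bitCells]
  · obtain ⟨m, rfl⟩ := Nat.exists_eq_add_of_lt h
    rw [Function.update_of_ne (by omega)]
    simp [bitCells, List.getElem?_append_right, add_assoc]

theorem update_bitCells_length (pre : List Bool) (b : Bool) :
    Function.update (bitCells pre) pre.length (some (.inl b)) =
      (bitCells (pre ++ [b]) : ℕ → Option (Bool ⊕ Δ)) := by
  funext k
  rcases lt_trichotomy k pre.length with h | h | h
  · simp [bitCells, h.ne, List.getElem?_append_left h]
  · subst h; simp [bitCells]
  · rw [Function.update_of_ne h.ne']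
    simp [bitCells, List.getElem?_eq_none, h.le, Nat.succ_le_of_lt h]

theorem update_bitCells_none (pre : List Bool) (b : Bool) :
    Function.update (bitCells (pre ++ [b])) pre.length none =
      (bitCells pre : ℕ → Option (Bool ⊕ Δ)) := by
  funext k
  rcases lt_trichotomy k pre.length with h | h | h
  · simp [bitCells, h.ne, List.getElem?_append_left h]
  · subst h; simp [bitCells]
  · rw [Function.update_of_ne h.ne']
    simp [bitCells, List.getElem?_eq_none, h.le, Nat.succ_le_of_lt h]

/-- Add one to the number on the tape `i`. -/
def incTape (i : ι) : Prog (Instr I O ι (Symb Δ)) (Test I ι (Symb Δ)) :=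
  .seq (.seq (.loop (scan i fun x => x.2 = some (.inl true)) (put i (some (.inl false)) .right))
    (put i (some (.inl true)) .stay)) (rewind i)

/-- Subtract one from the positive number on the tape `i`. -/
def decTape (i : ι) : Prog (Instr I O ι (Symb Δ)) (Test I ι (Symb Δ)) :=
  .seq (.seq (.loop (scan i fun x => x.2 = some (.inl false)) (put i (some (.inl true)) .right))
    (.seq (move i .right) (.ite (scan i fun x => x.2 = none)
      (.seq (move i .left) (put i none .stay))
      (.seq (move i .left) (put i (some (.inl false)) .stay))))) (rewind i)

theorem run_incTape (hc : Within L c) (l : List Bool) (hl : l.length ≤ L i) :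
    Runs w (Within L) (incTape i) (c.setTape i (tapeOf (bitCells l)) 0)
      (c.setTape i (tapeOf (bitCells (incBits l))) 0) := by
  have key : ∀ (l pre : List Bool), pre.length + l.length ≤ L i → ∃ p ≤ L i,
      Runs w (Within L)
        (.seq (.loop (scan i fun x => x.2 = some (.inl true)) (put i (some (.inl false)) .right))
          (put i (some (.inl true)) .stay))
        (c.setTape i (tapeOf (bitCells (pre ++ l))) pre.length)
        (c.setTape i (tapeOf (bitCells (pre ++ incBits l))) p) := by
    intro l
    induction l with
    | nil =>
      intro pre h
      simp only [List.length_nil, add_zero] at h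
      refine ⟨pre.length, h, .seq (.loopF ?_ (within_setTape hc _ h)) ?_⟩
      · rw [scan_setTape]; simp [tapeOf, bitCells]
      · have := run_put (w := w) (i := i) hc (bitCells pre) pre.length (some (.inl true)) .stay h h
        rw [update_bitCells_length] at this
        simpa [incBits, Machine.moveWork] using this
    | cons b l ih =>
      intro pre h
      simp only [List.length_cons] at h
      cases b with
      | false =>
        refine ⟨pre.length, by omega, .seq (.loopF ?_ (within_setTape hc _ (by omega))) ?_⟩
        · rw [scan_setTape]; simp [tapeOf, bitCells]
        · have := run_put (w := w) (i := i) hc (bitCells (pre ++ false :: l)) pre.length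
            (some (.inl true)) .stay (by omega) (by simp only [Machine.moveWork]; omega)
          rw [update_bitCells_append] at this
          exact this
      | true =>
        obtain ⟨p, hp, hr⟩ := ih (pre ++ [false]) (by simp; omega)
        refine ⟨p, hp, ?_⟩
        rcases hr with _ | _ | ⟨h1, h2⟩
        rename_i s₁
        refine .seq (s' := s₁) (.loopT ?_ (run_put (w := w) (i := i) hc
          (bitCells (pre ++ true :: l)) pre.length
            (some (.inl false)) .right (by omega) (by simp only [Machine.moveWork]; omega)) ?_) ?_
        rotate_left 1
        · rw [update_bitCells_append]
          simpa [Machine.moveWork] using h1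
        · simpa [incBits] using h2
        · rw [scan_setTape]; simp [tapeOf, bitCells]
  obtain ⟨p, hp, hr⟩ := key l [] (by simpa using hl)
  exact .seq hr (run_rewind hc _ _ hp)

theorem run_decTape (hc : Within L c) (l : List Bool) (h0 : l.getLast? = some true)
    (hl : l.length ≤ L i) :
    Runs w (Within L) (decTape i) (c.setTape i (tapeOf (bitCells l)) 0)
      (c.setTape i (tapeOf (bitCells (decBits l))) 0) := by
  have key : ∀ (l pre : List Bool), l.getLast? = some true → pre.length + l.length ≤ L i →
      ∃ p ≤ L i, Runs w (Within L)
        (.seq (.loop (scan i fun x => x.2 = some (.inl false)) (put i (some (.inl true)) .right))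
          (.seq (move i .right) (.ite (scan i fun x => x.2 = none)
            (.seq (move i .left) (put i none .stay))
            (.seq (move i .left) (put i (some (.inl false)) .stay)))))
        (c.setTape i (tapeOf (bitCells (pre ++ l))) pre.length)
        (c.setTape i (tapeOf (bitCells (pre ++ decBits l))) p) := by
    intro l
    induction l with
    | nil => intro pre h; simp at h
    | cons b l ih =>
      intro pre hlast h
      simp only [List.length_cons] at h
      cases b with
      | false =>
        have hlast' : l.getLast? = some true := by
          rw [List.getLast?_cons] at hlast
          cases h' : l.getLast? with
          | none => simp [h'] at hlast
          | some x => simpa [h'] using hlast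
        obtain ⟨p, hp, hr⟩ := ih (pre ++ [true]) hlast' (by simp; omega)
        refine ⟨p, hp, ?_⟩
        rcases hr with _ | _ | ⟨h1, h2⟩
        rename_i s₁
        refine .seq (s' := s₁) (.loopT ?_ (run_put (w := w) (i := i) hc
          (bitCells (pre ++ false :: l)) pre.length
            (some (.inl true)) .right (by omega) (by simp only [Machine.moveWork]; omega)) ?_) ?_
        rotate_left 1
        · rw [update_bitCells_append]
          simpa [Machine.moveWork] using h1
        · simpa [decBits] using h2
        · rw [scan_setTape]; simp [tapeOf, bitCells]
      | true =>
        refine ⟨pre.length, by omega, .seq (.loopF ?_ (within_setTape hc _ (by omega)))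
          (.seq (run_move hc _ _ .right (by omega) (by simp only [Machine.moveWork]; omega)) ?_)⟩
        · rw [scan_setTape]; simp [tapeOf, bitCells]
        · cases l with
          | nil =>
            refine .iteT ?_ (.seq (run_move hc _ _ .left (by simp only [Machine.moveWork]; omega)
              (by simp only [Machine.moveWork]; omega)) ?_)
            · rw [scan_setTape]; simp [tapeOf, bitCells, Machine.moveWork]
            · have := run_put (w := w) (i := i) hc (bitCells (pre ++ [true])) pre.length none .stay
                (by omega) (by simp only [Machine.moveWork]; omega)
              rw [update_bitCells_none] at this
              simpa [decBits, Machine.moveWork] using this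
          | cons b l =>
            refine .iteF ?_ (.seq (run_move hc _ _ .left (by simp only [Machine.moveWork]; omega)
              (by simp only [Machine.moveWork]; omega)) ?_)
            · rw [scan_setTape]; simp [tapeOf, bitCells, Machine.moveWork]
            · have := run_put (w := w) (i := i) hc (bitCells (pre ++ true :: b :: l)) pre.length
                (some (.inl false)) .stay (by omega) (by simp only [Machine.moveWork]; omega)
              rw [update_bitCells_append] at this
              simpa [decBits, Machine.moveWork] using this
  obtain ⟨p, hp, hr⟩ := key l [] h0 (by simpa using hl)
  exact .seq hr (run_rewind hc _ _ hp)

/-- Erase the tape `i`, whose nonblank cells are contiguous. -/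
def eraseTape (i : ι) : Prog (Instr I O ι (Symb Δ)) (Test I ι (Symb Δ)) :=
  .seq (rewind i) (.seq (.loop (scan i fun x => x.2 ≠ none ∨ x.1 = true) (move i .right))
    (.seq (.loop (scan i fun x => x.1 = false) (put i none .left)) (put i none .stay)))

theorem run_eraseTape (hc : Within L c) (f : ℕ → Option (Bool ⊕ Δ)) (p e : ℕ) (he : e + 1 ≤ L i)
    (hf : ∀ k, f k ≠ none → k ≤ e) (hf' : ∀ k, 0 < k → k ≤ e → f k ≠ none) (hp : p ≤ L i) :
    Runs w (Within L) (eraseTape i) (c.setTape i (tapeOf f) p)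
      (c.setTape i (tapeOf fun _ => none) 0) := by
  refine .seq (run_rewind hc f p hp) (.seq (s' := c.setTape i (tapeOf f) (e + 1)) ?_ ?_)
  · refine Run.loop_iterate (fun k => c.setTape i (tapeOf f) k) (e + 1) ?_ ?_ ?_
      (within_setTape hc _ he)
    · intro k hk
      rw [scan_setTape]
      rcases Nat.eq_zero_or_pos k with rfl | h
      · simp [tapeOf]
      · exact Or.inl (hf' k h (by omega))
    · intro k hk
      exact run_move hc _ _ .right (by omega) (by simp only [Machine.moveWork]; omega)
    · rw [scan_setTape]
      simp only [tapeOf, not_or, not_not]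
      refine ⟨?_, by simp⟩
      by_contra h
      have := hf _ h
      omega
  · have hgen : ∀ (k : ℕ) (f : ℕ → Option (Bool ⊕ Δ)), k ≤ L i → (∀ j, k < j → f j = none) →
        Runs w (Within L)
          (.seq (.loop (scan i fun x => x.1 = false) (put i none .left)) (put i none .stay))
          (c.setTape i (tapeOf f) k) (c.setTape i (tapeOf fun _ => none) 0) := by
      intro k
      induction k with
      | zero =>
        intro f hk hfk
        refine .seq (.loopF ?_ (within_setTape hc _ hk)) ?_
        · rw [scan_setTape]; simp [tapeOf]
        · have := run_put (w := w) (i := i) hc f 0 none .stay hk hk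
          have h2 : Function.update f 0 none = fun _ => none := by
            funext j
            rcases Nat.eq_zero_or_pos j with rfl | h
            · simp
            · rw [Function.update_of_ne h.ne']; exact hfk j h
          rwa [h2] at this
      | succ k ih =>
        intro f hk hfk
        have := ih (Function.update f (k + 1) none) (by omega) (by
          intro j hj
          by_cases h : j = k + 1
          · subst h; simp
          · rw [Function.update_of_ne h]; exact hfk j (by omega))
        rcases this with _ | _ | ⟨h1, h2⟩
        refine .seq (.loopT ?_ (run_put hc f (k + 1) none .left hk
          (by simp only [Machine.moveWork]; omega)) h1) h2
        rw [scan_setTape]; simp [tapeOf]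
    refine hgen (e + 1) f he fun j hj => ?_
    by_contra h
    have := hf _ h
    omega

end

end TM

/-! ### Register programs with a simulated machine -/

/-- The instructions of register programs.  Besides registers that hold natural numbers there is
a simulated machine; `feed`, `start`, `simStep` and `reset` write its input, put its head on the
first input cell, execute one of its steps and bring it back to its initial configuration. -/
inductive RAct
  | inc (r : ℕ)
  | dec (r : ℕ)
  | emit (o : Sym)
  | inRight
  | feed (b : Bool)
  | start
  | simStep
  | reset

/-- The tests of register programs: a register is not zero, the scanned input cell is not blank,
the simulated machine has not halted, it writes the bit `b` in its next step. -/
inductive RTst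
  | reg (r : ℕ)
  | input
  | simRun
  | simOut (b : Bool)

/-- Register programs. -/
abbrev RProg := Prog RAct RTst

/-- The state of a register program: the registers, the position of the input head, the output,
and the input and the configuration of the simulated machine. -/
@[ext]
structure RState (M : Machine Bool Bool) where
  regs : ℕ → ℕ
  inp : ℕ
  out : List Sym
  word : List Bool
  cfg : M.Cfg

variable {M : Machine Bool Bool}

namespace RState

/-- Change one register. -/
def set (s : RState M) (r n : ℕ) : RState M := { s with regs := Function.update s.regs r n }

end RState

/-- The effect of the instructions on the input `v`. -/
def rstp (v : List Unit) : RAct → RState M → RState M → Prop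
  | .inc r, s, s' => s' = s.set r (s.regs r + 1)
  | .dec r, s, s' => s.regs r ≠ 0 ∧ s' = s.set r (s.regs r - 1)
  | .emit o, s, s' => s' = { s with out := s.out ++ [o] }
  | .inRight, s, s' => s' = { s with inp := Machine.moveInput v s.inp .right }
  | .feed b, s, s' => s.cfg.inputPos = s.word.length + 1 ∧
      s' = { s with word := s.word ++ [b], cfg := { s.cfg with inputPos := s.word.length + 2 } }
  | .start, s, s' => s' = { s with cfg := { s.cfg with inputPos := 1 } }
  | .simStep, s, s' => ∃ c, M.next s.word s.cfg = some c ∧ s' = { s with cfg := c }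
  | .reset, s, s' => s' = { s with word := [], cfg := M.init }

/-- The step that the simulated machine is going to make. -/
def simNext (s : RState M) :
    Option (M.State × Move × (Fin M.tapes → M.Work × Move) × Option Bool) :=
  M.step s.cfg.state (Machine.inputSymbol s.word s.cfg.inputPos)
    (fun i => s.cfg.tape i (s.cfg.pos i))

/-- The meaning of the tests on the input `v`. -/
def rtst (v : List Unit) : RTst → RState M → Prop
  | .reg r, s => s.regs r ≠ 0
  | .input, s => Machine.inputSymbol v s.inp ≠ none
  | .simRun, s => simNext s ≠ none
  | .simOut b, s => ∃ r, simNext s = some r ∧ r.2.2.2 = some b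

/-- The simulated machine has an input of length at most `Lw` and the heads on its work tapes are
on the first `Ls` cells. -/
structure SimInv (Lw Ls : ℕ) (s : RState M) : Prop where
  word_le : s.word.length ≤ Lw
  inputPos_le : s.cfg.inputPos ≤ s.word.length + 1
  pos_lt : ∀ i, s.cfg.pos i < Ls

/-- The registers hold numbers up to `D`, and the simulated machine satisfies `SimInv`. -/
structure RInv (D Lw Ls : ℕ) (s : RState M) : Prop where
  regs_le : ∀ r, s.regs r ≤ D
  sim : SimInv Lw Ls s

/-- Big-step semantics of register programs. -/
abbrev RRun (v : List Unit) (D Lw Ls : ℕ) : RProg → RState M → RState M → Prop :=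
  Run (rstp v) (rtst v) (RInv D Lw Ls)

namespace Prog

/-- A bound for the registers used by a program. -/
def width : RProg → ℕ
  | skip => 0
  | act (.inc r) => r + 1
  | act (.dec r) => r + 1
  | act _ => 0
  | seq P Q => max P.width Q.width
  | ite (.reg r) P Q => max (r + 1) (max P.width Q.width)
  | ite _ P Q => max P.width Q.width
  | loop (.reg r) P => max (r + 1) P.width
  | loop _ P => P.width

end Prog

/-! #### Implementation by a Turing machine -/

namespace TM

/-- The work tapes of the machine that executes a register program: one for each of `R`
registers, one for the input and one for the state of the simulated machine `M`, and one for each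
work tape of `M`. -/
abbrev Tape (R : ℕ) (M : Machine Bool Bool) := Fin R ⊕ Bool ⊕ Fin M.tapes

variable {R : ℕ}

/-- The tape that holds the input of the simulated machine. -/
abbrev inT : Tape R M := .inr (.inl false)

/-- The tape that holds the state of the simulated machine. -/
abbrev stT : Tape R M := .inr (.inl true)

/-- The work tape `i` of the simulated machine. -/
abbrev wkT (i : Fin M.tapes) : Tape R M := .inr (.inr i)

/-- The work tape alphabet. -/
abbrev RSymb (M : Machine Bool Bool) := Symb (M.Work ⊕ M.State)

/-- Programs for the Turing machine that executes register programs. -/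
abbrev TProg (R : ℕ) (M : Machine Bool Bool) :=
  Prog (Instr Unit Sym (Tape R M) (RSymb M)) (Test Unit (Tape R M) (RSymb M))

/-- The state of the simulated machine encoded by a symbol. -/
def getState (x : RSymb M) : M.State :=
  match x.2 with
  | some (.inr (.inr q)) => q
  | _ => M.start

/-- The input symbol of the simulated machine encoded by a symbol. -/
def getInput (x : RSymb M) : Option Bool :=
  match x.2 with
  | some (.inl b) => some b
  | _ => none

/-- The work tape symbol of the simulated machine encoded by a symbol. -/
def getWork (x : RSymb M) : M.Work :=
  match x.2 with
  | some (.inr (.inl a)) => a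
  | _ => M.blank

/-- The next step of the simulated machine. -/
def simOf (b : Tape R M → RSymb M) :
    Option (M.State × Move × (Fin M.tapes → M.Work × Move) × Option Bool) :=
  M.step (getState (b stT)) (getInput (b inT)) fun i => getWork (b (wkT i))

open Classical in
/-- One step of the simulated machine.  Its input head does not move to the right from a blank
cell other than the first one. -/
noncomputable def simInstr : Instr Unit Sym (Tape R M) (RSymb M) := fun _ b =>
  match simOf b with
  | none => (.stay, fun j => (b j, .stay), none)
  | some u => (.stay, fun j =>
      match j with
      | .inl r => (b (.inl r), .stay)
      | .inr (.inl false) =>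
        (b inT, if (b inT).2 = none ∧ (b inT).1 = false ∧ u.2.1 = .right then .stay else u.2.1)
      | .inr (.inl true) => (((b stT).1, some (.inr (.inr u.1))), .stay)
      | .inr (.inr i) => (((b (wkT i)).1, some (.inr (.inl (u.2.2.1 i).1))), (u.2.2.1 i).2), none)

/-- Erase some work tapes of the simulated machine. -/
def eraseAll : List (Fin M.tapes) → TProg R M
  | [] => .skip
  | i :: l => .seq (eraseTape (wkT i)) (eraseAll l)

open Classical in
/-- The implementation of an instruction. -/
noncomputable def implAct (R : ℕ) (M : Machine Bool Bool) : RAct → TProg R M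
  | .inc r => if h : r < R then incTape (.inl ⟨r, h⟩) else .skip
  | .dec r => if h : r < R then decTape (.inl ⟨r, h⟩) else .skip
  | .emit o => .act fun _ b => (.stay, fun j => (b j, .stay), some o)
  | .inRight => .act fun _ b => (.right, fun j => (b j, .stay), none)
  | .feed b => put inT (some (.inl b)) .right
  | .start => .seq (rewind inT) (move inT .right)
  | .simStep => .act simInstr
  | .reset => .seq (eraseAll (List.finRange _)) (.seq (eraseTape inT) (.seq (move inT .right)
      (put stT (some (.inr (.inr M.start))) .stay)))

/-- The implementation of a test. -/
def implTst (R : ℕ) (M : Machine Bool Bool) : RTst → Test Unit (Tape R M) (RSymb M)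
  | .reg r => fun _ b => ∃ h : r < R, (b (.inl ⟨r, h⟩)).2 ≠ none
  | .input => fun x _ => x ≠ none
  | .simRun => fun _ b => simOf b ≠ none
  | .simOut o => fun _ b => ∃ u, simOf b = some u ∧ u.2.2.2 = some o

/-- The implementation of a register program. -/
noncomputable def impl (R : ℕ) (M : Machine Bool Bool) : RProg → TProg R M
  | .skip => .skip
  | .act a => implAct R M a
  | .seq P Q => .seq (impl R M P) (impl R M Q)
  | .ite t P Q => .ite (implTst R M t) (impl R M P) (impl R M Q)
  | .loop t P => .loop (implTst R M t) (impl R M P)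

/-- The store `c` represents the state `s`.  On the tapes of the simulated machine, the cells that
it has not visited are blank. -/
structure Rep (Ls : ℕ) (s : RState M) (c : Store Sym (Tape R M) (RSymb M)) : Prop where
  inputPos : c.inputPos = s.inp
  output : c.output = s.out
  reg_tape : ∀ r : Fin R, c.tape (.inl r) = tapeOf (bitCells (s.regs r).bits)
  reg_pos : ∀ r : Fin R, c.pos (.inl r) = 0
  in_tape : c.tape inT = tapeOf fun k => (Machine.inputSymbol s.word k).map .inl
  in_pos : c.pos inT = s.cfg.inputPos
  st_tape : c.tape stT = tapeOf fun k => if k = 0 then some (.inr (.inr s.cfg.state)) else none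
  st_pos : c.pos stT = 0
  wk_tape : ∀ i, ∃ e ≤ Ls, s.cfg.pos i ≤ e ∧ (∀ k, e ≤ k → s.cfg.tape i k = M.blank) ∧
    c.tape (wkT i) = tapeOf fun k => if k < e then some (.inr (.inl (s.cfg.tape i k))) else none
  wk_pos : ∀ i, c.pos (wkT i) = s.cfg.pos i

/-- The last cell of each tape that may be visited. -/
def tapeBound (D Lw Ls : ℕ) : Tape R M → ℕ
  | .inl _ => D.size
  | .inr (.inl false) => Lw + 1
  | .inr (.inl true) => 0
  | .inr (.inr _) => Ls + 1

section

variable {v : List Unit} {D Lw Ls : ℕ} {s s' : RState M} {c : Store Sym (Tape R M) (RSymb M)}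

theorem Rep.within (h : Rep Ls s c) (hs : RInv D Lw Ls s) : Within (tapeBound D Lw Ls) c := by
  rintro (r | (_ | _) | i)
  · rw [h.reg_pos]; exact Nat.zero_le _
  · rw [h.in_pos]
    have h1 := hs.sim.inputPos_le
    have h2 := hs.sim.word_le
    simp only [tapeBound]; omega
  · rw [h.st_pos]; exact Nat.zero_le _
  · rw [h.wk_pos]
    have := hs.sim.pos_lt i
    simp only [tapeBound]; omega

theorem Rep.simOf_eq (h : Rep Ls s c) : simOf (fun i => c.tape i (c.pos i)) = simNext s := by
  unfold simOf simNext
  congr 1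
  · simp [h.st_tape, h.st_pos, tapeOf, getState]
  · simp only [h.in_tape, h.in_pos, tapeOf, getInput]
    cases Machine.inputSymbol s.word s.cfg.inputPos <;> rfl
  · funext i
    obtain ⟨e, -, -, h1, h2⟩ := h.wk_tape i
    simp only [h2, h.wk_pos, tapeOf, getWork]
    by_cases hk : s.cfg.pos i < e
    · simp [hk]
    · simp [hk, h1 _ (not_lt.1 hk)]

theorem Rep.implTst_iff (h : Rep Ls s c) (t : RTst)
    (ht : ∀ r, t = .reg r → r < R) :
    implTst R M t (Machine.inputSymbol v c.inputPos) (fun i => c.tape i (c.pos i)) ↔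
      rtst v t s := by
  cases t with
  | reg r =>
    have hr := ht r rfl
    simp only [implTst, rtst, hr, exists_true_left, h.reg_tape, h.reg_pos, tapeOf, bitCells]
    rcases Nat.eq_zero_or_pos (s.regs r) with h0 | h0
    · simp [h0]
    · have : (s.regs r).bits ≠ [] := by
        intro h1
        have := getLast?_bits h0.ne'
        simp [h1] at this
      obtain ⟨b, l, hl⟩ := List.exists_cons_of_ne_nil this
      simp [hl, h0.ne']
  | input => simp [implTst, rtst, h.inputPos]
  | simRun => simp only [implTst, rtst, h.simOf_eq]
  | simOut b => simp only [implTst, rtst, h.simOf_eq]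

theorem length_bits_le {n D : ℕ} (h : n ≤ D) : n.bits.length ≤ D.size := by
  rw [Nat.size_eq_bits_len]; exact Nat.size_le_size h

theorem Rep.setReg (h : Rep Ls s c) {r n : ℕ} (hr : r < R) :
    Rep Ls (s.set r n) (c.setTape (.inl ⟨r, hr⟩) (tapeOf (bitCells n.bits)) 0) := by
  refine ⟨h.inputPos, h.output, fun q => ?_, fun q => ?_, ?_, ?_, ?_, ?_, fun i => ?_, fun i => ?_⟩
  · by_cases hq : q = ⟨r, hr⟩
    · subst hq; simp [RState.set, Store.setTape]
    · have hq' : (q : ℕ) ≠ r := fun h => hq (Fin.ext h)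
      simp [RState.set, Store.setTape, hq, hq', h.reg_tape]
  · by_cases hq : q = ⟨r, hr⟩
    · subst hq; simp [Store.setTape]
    · simp [Store.setTape, hq, h.reg_pos]
  · simpa [Store.setTape, RState.set] using h.in_tape
  · simpa [Store.setTape, RState.set] using h.in_pos
  · simpa [Store.setTape, RState.set] using h.st_tape
  · simpa [Store.setTape, RState.set] using h.st_pos
  · simpa [Store.setTape, RState.set] using h.wk_tape i
  · simpa [Store.setTape, RState.set] using h.wk_pos i

theorem Rep.setReg_self (h : Rep Ls s c) {r : ℕ} (hr : r < R) :
    c.setTape (.inl ⟨r, hr⟩) (tapeOf (bitCells (s.regs r).bits)) 0 = c := by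
  have := c.setTape_self (.inl ⟨r, hr⟩)
  rwa [h.reg_tape, h.reg_pos] at this

/-- The tape `i` can be erased by `eraseTape`. -/
def Erasable {ι Δ : Type} (L : ι → ℕ) (c : Store Sym ι (Symb Δ)) (i : ι) : Prop :=
  ∃ (f : ℕ → Option (Bool ⊕ Δ)) (e : ℕ), c.tape i = tapeOf f ∧ e + 1 ≤ L i ∧
    (∀ k, f k ≠ none → k ≤ e) ∧ ∀ k, 0 < k → k ≤ e → f k ≠ none

theorem run_eraseTape' {ι Δ : Type} [DecidableEq ι] {L : ι → ℕ} {c : Store Sym ι (Symb Δ)} {i : ι}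
    (hc : Within L c) (h : Erasable L c i) :
    Runs v (Within L) (eraseTape i) c (c.setTape i (tapeOf fun _ => none) 0) := by
  obtain ⟨f, e, h1, h2, h3, h4⟩ := h
  have := run_eraseTape (w := v) hc f (c.pos i) e h2 h3 h4 (hc i)
  rwa [← h1, c.setTape_self] at this

theorem run_eraseAll {L : Tape R M → ℕ} (l : List (Fin M.tapes)) (hc : Within L c)
    (h : ∀ i, Erasable L c (wkT i)) :
    ∃ c', Runs v (Within L) (eraseAll l) c c' ∧ c'.inputPos = c.inputPos ∧ c'.output = c.output ∧
      (∀ r, c'.tape (.inl r) = c.tape (.inl r)) ∧ (∀ r, c'.pos (.inl r) = c.pos (.inl r)) ∧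
      (∀ b, c'.tape (.inr (.inl b)) = c.tape (.inr (.inl b))) ∧
      (∀ b, c'.pos (.inr (.inl b)) = c.pos (.inr (.inl b))) ∧
      (∀ i, (i ∈ l ∨ (c.tape (wkT i) = tapeOf fun _ => none)) →
        c'.tape (wkT i) = tapeOf fun _ => none) ∧
      (∀ i, (i ∈ l ∨ c.pos (wkT i) = 0) → c'.pos (wkT i) = 0) := by
  induction l generalizing c with
  | nil => exact ⟨c, .skip hc, rfl, rfl, by simp, by simp, by simp, by simp, by simp, by simp⟩
  | cons i l ih =>
    have hrun := run_eraseTape' (v := v) hc (h i)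
    obtain ⟨c', h1, h2, h3, h4, h5, h6, h7, h8, h9⟩ := ih hrun.inv_right (by
      intro j
      by_cases hj : j = i
      · subst hj
        obtain ⟨-, e, -, he, -⟩ := h j
        refine ⟨fun _ => none, 0, by simp [Store.setTape], by omega, by simp, ?_⟩
        intro k hk hk'; omega
      · obtain ⟨f, e, he⟩ := h j
        exact ⟨f, e, by simpa [Store.setTape, hj] using he.1, he.2⟩)
    refine ⟨c', .seq hrun h1, h2, h3, fun r => ?_, fun r => ?_, fun r => ?_, fun r => ?_,
      fun j hj => ?_, fun j hj => ?_⟩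
    · simp [h4, Store.setTape]
    · simp [h5, Store.setTape]
    · simp [h6, Store.setTape]
    · simp [h7, Store.setTape]
    · apply h8
      by_cases hji : j = i
      · subst hji; right; simp [Store.setTape]
      · simpa [hji, Store.setTape] using hj
    · apply h9
      by_cases hji : j = i
      · subst hji; right; simp [Store.setTape]
      · simpa [hji, Store.setTape] using hj

theorem Rep.setIn (h : Rep Ls s c) (u : List Bool) (p : ℕ) :
    Rep Ls { s with word := u, cfg := { s.cfg with inputPos := p } }
      (c.setTape inT (tapeOf fun k => (Machine.inputSymbol u k).map .inl) p) := by
  refine ⟨h.inputPos, h.output, fun q => ?_, fun q => ?_, ?_, ?_, ?_, ?_, fun i => ?_, fun i => ?_⟩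
  · simpa [Store.setTape] using h.reg_tape q
  · simpa [Store.setTape] using h.reg_pos q
  · simp [Store.setTape]
  · simp [Store.setTape]
  · simpa [Store.setTape] using h.st_tape
  · simpa [Store.setTape] using h.st_pos
  · simpa [Store.setTape] using h.wk_tape i
  · simpa [Store.setTape] using h.wk_pos i

theorem Rep.setIn_self (h : Rep Ls s c) :
    c.setTape inT (tapeOf fun k => (Machine.inputSymbol s.word k).map .inl) s.cfg.inputPos = c := by
  have := c.setTape_self inT
  rwa [h.in_tape, h.in_pos] at this

theorem inputSymbol_append_singleton (u : List Bool) (b : Bool) :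
    (fun k => (Machine.inputSymbol (u ++ [b]) k).map Sum.inl) =
      Function.update (fun k => (Machine.inputSymbol u k).map Sum.inl) (u.length + 1)
        (some (.inl b) : Option (Bool ⊕ (M.Work ⊕ M.State))) := by
  funext k
  cases k with
  | zero => simp [Machine.inputSymbol]
  | succ k =>
    rcases lt_trichotomy k u.length with h | h | h
    · simp [Machine.inputSymbol, h.ne, List.getElem?_append_left h]
    · subst h; simp [Machine.inputSymbol]
    · rw [Function.update_of_ne (by omega)]
      simp [Machine.inputSymbol, List.getElem?_eq_none, h.le, Nat.succ_le_of_lt h]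

theorem Rep.simStep (h : Rep Ls s c) (hs : RInv D Lw Ls s) (hs' : RInv D Lw Ls s')
    (hst : rstp v .simStep s s') : Rep Ls s' (apply v simInstr c) := by
  classical
  obtain ⟨c', hc', rfl⟩ := hst
  obtain ⟨u, hu, rfl⟩ := Option.map_eq_some_iff.1 hc'
  have hsim : simOf (fun i => c.tape i (c.pos i)) = some u := by rw [h.simOf_eq]; exact hu
  refine ⟨?_, ?_, fun q => ?_, fun q => ?_, ?_, ?_, ?_, ?_, fun i => ?_, fun i => ?_⟩
  · simp [apply, simInstr, hsim, Machine.moveInput, h.inputPos]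
  · simp [apply, simInstr, hsim, h.output]
  · simpa [apply, simInstr, hsim] using h.reg_tape q
  · simpa [apply, simInstr, hsim, Machine.moveWork] using h.reg_pos q
  · simpa [apply, simInstr, hsim] using h.in_tape
  · have hcell : c.tape inT (c.pos inT) = (decide (s.cfg.inputPos = 0),
        (Machine.inputSymbol s.word s.cfg.inputPos).map .inl) := by
      rw [h.in_tape, h.in_pos]; rfl
    have hmv : (apply v simInstr c).pos inT = Machine.moveWork s.cfg.inputPos
        (if (c.tape inT (c.pos inT)).2 = none ∧ (c.tape inT (c.pos inT)).1 = false ∧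
          u.2.1 = .right then .stay else u.2.1) := by
      simp only [apply, simInstr, hsim, h.in_pos]
    rw [hmv, hcell]
    have hle := hs.sim.inputPos_le
    obtain ⟨q, m, x, y⟩ := u
    cases m with
    | left => simp [Machine.moveWork, Machine.moveInput]
    | stay => simp [Machine.moveWork, Machine.moveInput]
    | right =>
      cases hp : s.cfg.inputPos with
      | zero => simp [Machine.moveWork, Machine.moveInput, Machine.inputSymbol]
      | succ p =>
        rw [hp] at hle
        rcases Nat.lt_or_ge p s.word.length with h1 | h1
        · simp [Machine.moveWork, Machine.moveInput, Machine.inputSymbol, h1]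
        · have : p = s.word.length := by omega
          simp [Machine.moveWork, Machine.moveInput, Machine.inputSymbol, this]
  · funext k
    simp only [apply, simInstr, hsim, h.st_tape, h.st_pos, tapeOf]
    by_cases hk : k = 0
    · subst hk; simp
    · simp [hk, tapeOf]
  · simpa [apply, simInstr, hsim, Machine.moveWork] using h.st_pos
  · obtain ⟨e, he, h1, h2, h3⟩ := h.wk_tape i
    have h4 := hs.sim.pos_lt i
    refine ⟨max e (s.cfg.pos i + 1), by omega, ?_, ?_, ?_⟩
    · simp only
      have : Machine.moveWork (s.cfg.pos i) (u.2.2.1 i).2 ≤ s.cfg.pos i + 1 := by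
        cases (u.2.2.1 i).2 <;> simp only [Machine.moveWork] <;> omega
      omega
    · intro k hk
      simp only
      rw [Function.update_of_ne (by omega)]
      exact h2 k (by omega)
    · funext k
      simp only [apply, simInstr, hsim, h3, h.wk_pos, tapeOf]
      by_cases hk : k = s.cfg.pos i
      · subst hk; simp
      · have : k < max e (s.cfg.pos i + 1) ↔ k < e := by omega
        simp [hk, this]
        rfl
  · simp [apply, simInstr, hsim, h.wk_pos]

theorem Rep.reset (h : Rep Ls s c) (hs : RInv D Lw Ls s) :
    ∃ c', Runs v (Within (tapeBound D Lw Ls)) (implAct R M .reset) c c' ∧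
      Rep Ls { s with word := [], cfg := M.init } c' := by
  have hw := h.within hs
  obtain ⟨c₁, h1, h2, h3, h4, h5, h6, h7, h8, h9⟩ := run_eraseAll (v := v)
    (List.finRange M.tapes) hw (by
      intro i
      obtain ⟨e, he, -, -, h3⟩ := h.wk_tape i
      refine ⟨_, e - 1, h3, by simp only [tapeBound]; omega, fun k hk => ?_, fun k hk hk' => ?_⟩
      · simp only [ne_eq, ite_eq_right_iff, reduceCtorEq, imp_false, not_not] at hk
        omega
      · rw [if_pos (by omega)]; simp)
  have e1 := run_eraseTape' (v := v) (i := inT) h1.inv_right (by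
    refine ⟨_, s.word.length, by rw [h6, h.in_tape], ?_, fun k hk => ?_, fun k hk hk' => ?_⟩
    · have := hs.sim.word_le
      simp only [tapeBound]; omega
    · cases k with
      | zero => omega
      | succ k =>
        by_contra hlt
        exact hk (by simp [Machine.inputSymbol]; omega)
    · cases k with
      | zero => omega
      | succ k => simp [Machine.inputSymbol, Nat.lt_of_succ_le hk'])
  have e2 := run_move (w := v) h1.inv_right (i := inT) (tapeOf fun _ => none) 0 .right
    (Nat.zero_le _) (by simp [tapeBound, Machine.moveWork])
  have e3 := run_put (w := v) e2.inv_right (i := stT)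
    (fun k => if k = 0 then some (.inr (.inr s.cfg.state)) else none) 0
    (some (.inr (.inr M.start))) .stay (Nat.zero_le _) (Nat.zero_le _)
  have e4 : (c₁.setTape inT (tapeOf fun _ => none) (Machine.moveWork 0 .right)).setTape stT
      (tapeOf fun k => if k = 0 then some (.inr (.inr s.cfg.state)) else none) 0 =
      c₁.setTape inT (tapeOf fun _ => none) (Machine.moveWork 0 .right) := by
    have := (c₁.setTape inT (tapeOf fun _ => none) (Machine.moveWork 0 .right)).setTape_self stT
    have ht : (c₁.setTape inT (tapeOf fun _ => none) (Machine.moveWork 0 .right)).tape stT =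
        tapeOf fun k => if k = 0 then some (.inr (.inr s.cfg.state)) else none := by
      rw [← h.st_tape, ← h6]; simp [Store.setTape]
    have hp : (c₁.setTape inT (tapeOf fun _ => none) (Machine.moveWork 0 .right)).pos stT = 0 := by
      rw [← h.st_pos, ← h7]; simp [Store.setTape]
    rwa [ht, hp] at this
  rw [e4] at e3
  refine ⟨_, .seq h1 (.seq e1 (.seq e2 e3)), ?_⟩
  refine ⟨?_, ?_, fun q => ?_, fun q => ?_, ?_, ?_, ?_, ?_, fun i => ?_, fun i => ?_⟩
  · simp [Store.setTape, h2, h.inputPos]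
  · simp [Store.setTape, h3, h.output]
  · simpa [Store.setTape, h4] using h.reg_tape q
  · simpa [Store.setTape, h5] using h.reg_pos q
  · simp only [Store.setTape, ne_eq, Sum.inr.injEq, Sum.inl.injEq, Bool.false_eq_true,
      not_false_eq_true, Function.update_of_ne, Function.update_self]
    congr 1
    funext k
    cases k <;> simp [Machine.inputSymbol]
  · simp [Store.setTape, Machine.moveWork, Machine.init]
  · simp only [Store.setTape, Function.update_self]
    congr 1
    funext k
    by_cases hk : k = 0
    · subst hk; simp [Machine.init]
    · simp [hk]
  · simp [Store.setTape, Machine.moveWork]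
  · refine ⟨0, Nat.zero_le _, by simp [Machine.init], fun k _ => rfl, ?_⟩
    simpa [Store.setTape] using h8 i (Or.inl (List.mem_finRange i))
  · simpa [Store.setTape, Machine.init] using h9 i (Or.inl (List.mem_finRange i))

theorem Rep.act (h : Rep Ls s c) (hs : RInv D Lw Ls s) (hs' : RInv D Lw Ls s') (a : RAct)
    (ha : (Prog.act a : RProg).width ≤ R) (hst : rstp v a s s') :
    ∃ c', Runs v (Within (tapeBound D Lw Ls)) (implAct R M a) c c' ∧ Rep Ls s' c' := by
  have hw := h.within hs
  cases a with
  | inc r =>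
    have hr : r < R := ha
    obtain rfl := hst
    have := run_incTape (w := v) (i := (.inl ⟨r, hr⟩ : Tape R M)) hw (s.regs r).bits
      (length_bits_le (hs.regs_le r))
    rw [h.setReg_self hr, incBits_bits] at this
    simp only [implAct, hr, dif_pos]
    exact ⟨_, this, h.setReg hr⟩
  | dec r =>
    have hr : r < R := ha
    obtain ⟨h0, rfl⟩ := hst
    have := run_decTape (w := v) (i := (.inl ⟨r, hr⟩ : Tape R M)) hw (s.regs r).bits
      (getLast?_bits h0) (length_bits_le (hs.regs_le r))
    rw [h.setReg_self hr, decBits_bits h0] at this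
    simp only [implAct, hr, dif_pos]
    exact ⟨_, this, h.setReg hr⟩
  | emit o =>
    obtain rfl := hst
    have hrep : Rep Ls { s with out := s.out ++ [o] }
        (apply v (fun _ b => (.stay, fun j => (b j, .stay), some o)) c) := by
      constructor <;> simp [apply, Machine.moveInput, Machine.moveWork, h.inputPos, h.output,
        h.reg_tape, h.reg_pos, h.in_tape, h.in_pos, h.st_tape, h.st_pos, h.wk_tape, h.wk_pos]
    exact ⟨_, .act rfl hw (hrep.within hs'), hrep⟩
  | inRight =>
    obtain rfl := hst
    have hrep : Rep Ls { s with inp := Machine.moveInput v s.inp .right }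
        (apply v (fun _ b => (.right, fun j => (b j, .stay), none)) c) := by
      constructor <;> simp [apply, Machine.moveInput, Machine.moveWork, h.inputPos, h.output,
        h.reg_tape, h.reg_pos, h.in_tape, h.in_pos, h.st_tape, h.st_pos, h.wk_tape, h.wk_pos]
    exact ⟨_, .act rfl hw (hrep.within hs'), hrep⟩
  | feed b =>
    obtain ⟨hp, rfl⟩ := hst
    have h1 := hs'.sim.word_le
    simp only [List.length_append, List.length_singleton] at h1
    have := run_put (w := v) (i := inT) hw (fun k => (Machine.inputSymbol s.word k).map .inl)
      (s.word.length + 1) (some (.inl b)) .right (by simp only [tapeBound]; omega)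
      (by simp only [tapeBound, Machine.moveWork]; omega)
    rw [← hp, h.setIn_self, hp, ← inputSymbol_append_singleton] at this
    exact ⟨_, this, h.setIn _ _⟩
  | start =>
    obtain rfl := hst
    have e1 := run_rewind (w := v) (i := inT) hw
      (fun k => (Machine.inputSymbol s.word k).map .inl) s.cfg.inputPos
      (by rw [← h.in_pos]; exact hw _)
    rw [h.setIn_self] at e1
    have e2 := run_move (w := v) (i := inT) hw
      (tapeOf fun k => (Machine.inputSymbol s.word k).map .inl) 0 .right (Nat.zero_le _)
      (by simp [tapeBound, Machine.moveWork])
    exact ⟨_, .seq e1 e2, h.setIn _ _⟩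
  | simStep =>
    have hrep := h.simStep hs hs' hst
    exact ⟨_, .act rfl hw (hrep.within hs'), hrep⟩
  | reset =>
    obtain rfl := hst
    exact h.reset hs

/-- The Turing machine simulates the register program. -/
theorem runs_impl {P : RProg} (hP : RRun v D Lw Ls P s s') (hR : P.width ≤ R) (h : Rep Ls s c) :
    ∃ c', Runs v (Within (tapeBound D Lw Ls)) (impl R M P) c c' ∧ Rep Ls s' c' := by
  have htst : ∀ {t : RTst} {P Q : RProg}, (Prog.ite t P Q).width ≤ R →
      (∀ r, t = .reg r → r < R) ∧ P.width ≤ R ∧ Q.width ≤ R := by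
    intro t P Q h
    cases t <;> simp [Prog.width] at h ⊢ <;> omega
  have hlp : ∀ {t : RTst} {P : RProg}, (Prog.loop t P).width ≤ R →
      (∀ r, t = .reg r → r < R) ∧ P.width ≤ R := by
    intro t P h
    cases t <;> simp [Prog.width] at h ⊢ <;> omega
  induction hP generalizing c with
  | skip hs => exact ⟨c, .skip (h.within hs), h⟩
  | @act a _ _ hst hs hs' => exact h.act hs hs' a hR hst
  | seq _ _ ih1 ih2 =>
    simp only [Prog.width, max_le_iff] at hR
    obtain ⟨c₁, h1, h1'⟩ := ih1 hR.1 h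
    obtain ⟨c₂, h2, h2'⟩ := ih2 hR.2 h1'
    exact ⟨c₂, .seq h1 h2, h2'⟩
  | iteT ht _ ih =>
    obtain ⟨h1, h2, h3⟩ := htst hR
    obtain ⟨c', hc, hc'⟩ := ih h2 h
    exact ⟨c', .iteT ((h.implTst_iff _ h1).2 ht) hc, hc'⟩
  | iteF ht _ ih =>
    obtain ⟨h1, h2, h3⟩ := htst hR
    obtain ⟨c', hc, hc'⟩ := ih h3 h
    exact ⟨c', .iteF (fun h' => ht ((h.implTst_iff _ h1).1 h')) hc, hc'⟩
  | loopT ht _ _ ih1 ih2 =>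
    obtain ⟨h1, h2⟩ := hlp hR
    obtain ⟨c₁, hc, hc'⟩ := ih1 h2 h
    obtain ⟨c₂, hd, hd'⟩ := ih2 hR hc'
    exact ⟨c₂, .loopT ((h.implTst_iff _ h1).2 ht) hc hd, hd'⟩
  | loopF ht hs =>
    obtain ⟨h1, h2⟩ := hlp hR
    exact ⟨c, .loopF (fun h' => ht ((h.implTst_iff _ h1).1 h')) (h.within hs), h⟩

end

end TM

namespace TM

instance (M : Machine Bool Bool) : Finite M.Work := M.finite_work

instance (M : Machine Bool Bool) : Finite M.State := M.finite_state

/-- The first instruction: it marks the first cells of the tapes and initializes the simulated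
machine. -/
def initInstr (R : ℕ) (M : Machine Bool Bool) : Instr Unit Sym (Tape R M) (RSymb M) := fun _ _ =>
  (.stay, fun j =>
    match j with
    | .inr (.inl false) => ((true, none), .right)
    | .inr (.inl true) => ((true, some (.inr (.inr M.start))), .stay)
    | _ => ((true, none), .stay), none)

end TM

/-- The Turing machine that executes a register program. -/
noncomputable def rMachine (M : Machine Bool Bool) (P : RProg) : Machine Unit Sym :=
  TM.machine (false, none) (.seq (.act (TM.initInstr P.width M)) (TM.impl P.width M P))

/-- The initial state of a register program. -/
def RState.init (M : Machine Bool Bool) : RState M where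
  regs := fun _ => 0
  inp := 1
  out := []
  word := []
  cfg := M.init

variable {M : Machine Bool Bool}

theorem rMachine_spec {P : RProg} {v : List Unit} {D Lw Ls : ℕ} {s : RState M}
    (h : RRun v D Lw Ls P (RState.init M) s) :
    (rMachine M P).Outputs v s.out ∧ (rMachine M P).space v ≤
      ((P.width * (D.size + 1) + (Lw + 3) + M.tapes * (Ls + 2) : ℕ) : ℕ∞) := by
  have hrep : TM.Rep (R := P.width) Ls (RState.init M)
      (TM.apply v (TM.initInstr P.width M) (TM.initStore (false, none))) := by
    refine ⟨rfl, rfl, fun q => ?_, fun q => rfl, ?_, rfl, ?_, rfl, fun i => ?_, fun i => rfl⟩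
    · funext k
      by_cases hk : k = 0
      · subst hk; simp [TM.apply, TM.initInstr, TM.initStore, TM.tapeOf, TM.bitCells, RState.init]
      · simp [TM.apply, TM.initInstr, TM.initStore, TM.tapeOf, TM.bitCells, RState.init, hk]
    · funext k
      cases k <;> simp [TM.apply, TM.initInstr, TM.initStore, TM.tapeOf, RState.init,
        Machine.inputSymbol]
    · funext k
      by_cases hk : k = 0
      · subst hk; simp [TM.apply, TM.initInstr, TM.initStore, TM.tapeOf, RState.init, Machine.init]
      · simp [TM.apply, TM.initInstr, TM.initStore, TM.tapeOf, hk]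
    · refine ⟨0, Nat.zero_le _, Nat.zero_le _, fun k _ => rfl, ?_⟩
      funext k
      by_cases hk : k = 0
      · subst hk; simp [TM.apply, TM.initInstr, TM.initStore, TM.tapeOf]
      · simp [TM.apply, TM.initInstr, TM.initStore, TM.tapeOf, hk]
  obtain ⟨c, hc, hc'⟩ := TM.runs_impl h le_rfl hrep
  have hrun : TM.Runs v (TM.Within (TM.tapeBound D Lw Ls))
      (.seq (.act (TM.initInstr P.width M)) (TM.impl P.width M P))
      (TM.initStore (false, none)) c :=
    .seq (.act rfl (fun i => Nat.zero_le _) hc.inv_left) hc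
  have := TM.outputs_and_space_of_run _ _ hrun
  rw [hc'.output] at this
  refine ⟨this.1, this.2.trans (le_of_eq ?_)⟩
  congr 1
  simp only [Fintype.sum_sum_type, TM.tapeBound, Fintype.sum_bool, Finset.sum_const,
    Finset.card_univ, Fintype.card_fin, smul_eq_mul]
  ring

/-! ### Functions computed by register programs with polynomially bounded registers -/

section RegisterPrograms

variable {v : List Unit} {D D' Lw Ls : ℕ} {s : RState M}

theorem RRun.mono_bound {P : RProg} {s s' : RState M} (h : RRun v D Lw Ls P s s') (hD : D ≤ D') :
    RRun v D' Lw Ls P s s' :=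
  Run.mono (fun _ hs => ⟨fun r => (hs.regs_le r).trans hD, hs.sim⟩) h

theorem RState.set_regs_self (s : RState M) (r n : ℕ) : (s.set r n).regs r = n := by
  simp [RState.set]

theorem RState.set_regs_of_ne (s : RState M) {r q : ℕ} (n : ℕ) (h : q ≠ r) :
    (s.set r n).regs q = s.regs q := by
  simp [RState.set, h]

theorem RState.set_regs (s : RState M) (r q n : ℕ) :
    (s.set r n).regs q = if q = r then n else s.regs q := by
  simp [RState.set, Function.update_apply]

theorem RState.set_set (s : RState M) (r n m : ℕ) : (s.set r n).set r m = s.set r m := by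
  simp [RState.set]

theorem RState.set_comm (s : RState M) {r q : ℕ} (n m : ℕ) (h : r ≠ q) :
    (s.set r n).set q m = (s.set q m).set r n := by
  simp [RState.set, Function.update_comm h]

theorem RState.set_eq_self (s : RState M) {r n : ℕ} (h : s.regs r = n) : s.set r n = s := by
  subst h
  simp [RState.set]

theorem RInv.set (h : RInv D Lw Ls s) {n : ℕ} (hn : n ≤ D) (r : ℕ) :
    RInv D Lw Ls (s.set r n) := by
  refine ⟨fun q => ?_, h.sim.1, h.sim.2, h.sim.3⟩
  rw [RState.set_regs]
  split_ifs
  exacts [hn, h.regs_le q]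

theorem run_inc (h : RInv D Lw Ls s) (r : ℕ) (hr : s.regs r + 1 ≤ D) :
    RRun v D Lw Ls (.act (.inc r)) s (s.set r (s.regs r + 1)) :=
  .act rfl h (h.set hr r)

theorem run_dec (h : RInv D Lw Ls s) (r : ℕ) (hr : s.regs r ≠ 0) :
    RRun v D Lw Ls (.act (.dec r)) s (s.set r (s.regs r - 1)) :=
  .act ⟨hr, rfl⟩ h (h.set ((Nat.sub_le _ _).trans (h.regs_le r)) r)

/-- Set a register to zero. -/
def clear (r : ℕ) : RProg := .loop (.reg r) (.act (.dec r))

theorem run_clear (h : RInv D Lw Ls s) (r : ℕ) : RRun v D Lw Ls (clear r) s (s.set r 0) := by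
  have := Run.loop_iterate (stp := rstp v) (tst := rtst v) (Inv := RInv D Lw Ls) (t := .reg r)
    (P := .act (.dec r)) (fun i => s.set r (s.regs r - i)) (s.regs r) (fun i hi => ?_)
    (fun i hi => ?_) ?_ (h.set (by omega) r)
  · simp only [Nat.sub_zero, Nat.sub_self, s.set_eq_self] at this
    exact this
  · simp only [rtst, RState.set_regs_self]; omega
  · have := run_dec (v := v) (h.set (n := s.regs r - i) ((Nat.sub_le _ _).trans (h.regs_le r)) r) r
      (by rw [RState.set_regs_self]; omega)
    rwa [RState.set_regs_self, RState.set_set, Nat.sub_sub] at this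
  · simp [rtst, RState.set_regs_self]

/-- Add a register to another one, and set the former to zero. -/
def addTo (r q : ℕ) : RProg := .loop (.reg r) (.seq (.act (.dec r)) (.act (.inc q)))

theorem run_addTo (h : RInv D Lw Ls s) {r q : ℕ} (hrq : r ≠ q) (hD : s.regs q + s.regs r ≤ D) :
    RRun v D Lw Ls (addTo r q) s ((s.set q (s.regs q + s.regs r)).set r 0) := by
  have := Run.loop_iterate (stp := rstp v) (tst := rtst v) (Inv := RInv D Lw Ls) (t := .reg r)
    (P := .seq (.act (.dec r)) (.act (.inc q)))
    (fun i => (s.set q (s.regs q + i)).set r (s.regs r - i)) (s.regs r) (fun i hi => ?_)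
    (fun i hi => ?_) ?_ ((h.set hD q).set (by omega) r)
  · simp only [Nat.sub_zero, Nat.sub_self, add_zero, s.set_eq_self] at this
    exact this
  · simp only [rtst, RState.set_regs_self]; omega
  · have hle := h.regs_le r
    have hI : RInv D Lw Ls ((s.set q (s.regs q + i)).set r (s.regs r - i)) :=
      (h.set (by omega) q).set (by omega) r
    have h1 := run_dec (v := v) hI r (by rw [RState.set_regs_self]; omega)
    rw [RState.set_regs_self, RState.set_set, Nat.sub_sub] at h1
    have h2 := run_inc (v := v) h1.inv_right q (by
      rw [RState.set_regs_of_ne _ _ hrq.symm, RState.set_regs_self]; omega)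
    rw [RState.set_regs_of_ne _ _ hrq.symm, RState.set_regs_self, RState.set_comm _ _ _ hrq,
      RState.set_set, add_assoc] at h2
    exact .seq h1 h2
  · simp [rtst, RState.set_regs_self]

/-- Copy the register `r` to the register `q`, using the register `t`. -/
def copyTo (r q t : ℕ) : RProg :=
  .seq (.loop (.reg r) (.seq (.act (.dec r)) (.seq (.act (.inc q)) (.act (.inc t))))) (addTo t r)

theorem run_copyTo (h : RInv D Lw Ls s) {r q t : ℕ} (hrq : r ≠ q) (hrt : r ≠ t) (hqt : q ≠ t)
    (hq : s.regs q = 0) (ht : s.regs t = 0) :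
    RRun v D Lw Ls (copyTo r q t) s (s.set q (s.regs r)) := by
  have hle := h.regs_le r
  have h1 := Run.loop_iterate (stp := rstp v) (tst := rtst v) (Inv := RInv D Lw Ls) (t := .reg r)
    (P := .seq (.act (.dec r)) (.seq (.act (.inc q)) (.act (.inc t))))
    (fun i => ((s.set t i).set q i).set r (s.regs r - i)) (s.regs r) (fun i hi => ?_)
    (fun i hi => ?_) ?_ (((h.set hle t).set hle q).set (by omega) r)
  · simp only [Nat.sub_zero, Nat.sub_self] at h1
    rw [s.set_eq_self ht, s.set_eq_self hq, s.set_eq_self rfl] at h1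
    have h2 := run_addTo (v := v) h1.inv_right hrt.symm (by
      simp only [RState.set_regs, if_true, if_neg hrt.symm, if_neg hqt.symm]
      omega)
    refine .seq h1 ?_
    convert h2 using 1
    refine RState.ext (funext fun p => ?_) rfl rfl rfl rfl
    simp only [RState.set_regs]
    by_cases hp : p = t
    · subst hp; simp [hqt.symm, ht]
    · by_cases hp' : p = r
      · subst hp'; simp [hrt, hrq, hrt.symm, hqt.symm]
      · simp [hp, hp']
  · simp only [rtst, RState.set_regs_self]; omega
  · have hI : RInv D Lw Ls (((s.set t i).set q i).set r (s.regs r - i)) :=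
      ((h.set (by omega) t).set (by omega) q).set (by omega) r
    have h1 := run_dec (v := v) hI r (by rw [RState.set_regs_self]; omega)
    rw [RState.set_regs_self, RState.set_set, Nat.sub_sub] at h1
    have h2 := run_inc (v := v) h1.inv_right q (by
      rw [RState.set_regs_of_ne _ _ hrq.symm, RState.set_regs_self]; omega)
    rw [RState.set_regs_of_ne _ _ hrq.symm, RState.set_regs_self, RState.set_comm _ _ _ hrq,
      RState.set_set] at h2
    have h3 := run_inc (v := v) h2.inv_right t (by
      rw [RState.set_regs_of_ne _ _ hrt.symm, RState.set_regs_of_ne _ _ hqt.symm,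
        RState.set_regs_self]; omega)
    rw [RState.set_regs_of_ne _ _ hrt.symm, RState.set_regs_of_ne _ _ hqt.symm,
        RState.set_regs_self, RState.set_comm _ _ _ hrt, RState.set_comm _ _ _ hqt,
        RState.set_set] at h3
    exact .seq h1 (.seq h2 h3)
  · simp [rtst, RState.set_regs_self]

end RegisterPrograms

/-- The function `e`, which depends on a global parameter `K` and on variables, is bounded by a
polynomial in `K` and in the variables, and depends on the variables below `w` only. -/
structure PolyBdd (w c : ℕ) (e : ℕ → (ℕ → ℕ) → ℕ) : Prop where
  congr : ∀ K σ τ, (∀ i < w, σ i = τ i) → e K σ = e K τ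
  le : ∀ K σ B, K ≤ B → (∀ i < w, σ i ≤ B) → e K σ ≤ (B + 2) ^ c

/-- The simulated machine `M` computes `f k` for all `k ≤ K`, where the binary numeral of `k` has
length at most `Lw` and the first `Ls` cells of each work tape suffice. -/
structure Adequate (M : Machine Bool Bool) (f : ℕ → ℕ) (K Lw Ls : ℕ) : Prop where
  length_le : ∀ k ≤ K, (numeral k).length ≤ Lw
  outputs : ∀ k ≤ K, M.Outputs (numeral k) (numeral (f k))
  pos_lt : ∀ k ≤ K, ∀ c, StateTransition.Reaches (M.next (numeral k)) M.init c →
    ∀ i, c.pos i < Ls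

/-- The program `P` computes the value of `e` in the register `b`, where the variable `i` is in the
register `ρ i < b`, the parameter `K` is in the register `0`, and the registers from `b` on are
available for the computation.  If `q` holds, then the program may use the simulated machine. -/
def Evals (M : Machine Bool Bool) (f : ℕ → ℕ) (q : Prop) (e : ℕ → (ℕ → ℕ) → ℕ) (c : ℕ)
    (ρ : ℕ → ℕ) (b : ℕ) (P : RProg) : Prop :=
  ∀ (v : List Unit) (K Lw Ls : ℕ) (s : RState M) (B : ℕ),
    (q → Adequate M f K Lw Ls ∧ s.word = [] ∧ s.cfg = M.init) → s.regs 0 = K →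
    (∀ r, b ≤ r → s.regs r = 0) → (∀ r, s.regs r ≤ B) → SimInv Lw Ls s →
    RRun v ((B + 2) ^ c) Lw Ls P s (s.set b (e K fun i => s.regs (ρ i)))

/-- The functions of a global parameter and of variables that are computed by register programs
whose registers remain polynomially bounded, so that the work tapes of the corresponding Turing
machine remain logarithmically bounded.  If `q` holds, the programs may call the machine `M` for
the function `f`. -/
def LS (M : Machine Bool Bool) (f : ℕ → ℕ) (q : Prop) (e : ℕ → (ℕ → ℕ) → ℕ) : Prop :=
  ∃ w c, PolyBdd w c e ∧ ∀ ρ b, 0 < b → (∀ i < w, ρ i < b) → ∃ P, Evals M f q e c ρ b P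

theorem pow_add_two_pow_le {B a d c : ℕ} (ha : 1 ≤ a) (h : (a + 1) * d ≤ c) :
    ((B + 2) ^ a + 2) ^ d ≤ (B + 2) ^ c := by
  have h1 : B + 2 ≤ (B + 2) ^ a := Nat.le_self_pow (by omega) _
  have h2 : (B + 2) ^ a + 2 ≤ (B + 2) ^ (a + 1) := by
    rw [pow_succ]; nlinarith
  calc ((B + 2) ^ a + 2) ^ d ≤ ((B + 2) ^ (a + 1)) ^ d := Nat.pow_le_pow_left h2 d
    _ = (B + 2) ^ ((a + 1) * d) := by rw [← pow_mul]
    _ ≤ _ := Nat.pow_le_pow_right (by omega) h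

theorem PolyBdd.mono {w c w' c' : ℕ} {e : ℕ → (ℕ → ℕ) → ℕ} (h : PolyBdd w c e) (hw : w ≤ w')
    (hc : c ≤ c') : PolyBdd w' c' e :=
  ⟨fun K σ τ hst => h.congr K σ τ fun i hi => hst i (by omega), fun K σ B hK hσ =>
    (h.le K σ B hK fun i hi => hσ i (by omega)).trans (Nat.pow_le_pow_right (by omega) hc)⟩

/-- Extend an assignment of the variables by a new variable `0`. -/
def push (a : ℕ) (σ : ℕ → ℕ) : ℕ → ℕ
  | 0 => a
  | i + 1 => σ i

namespace LS

variable {f : ℕ → ℕ} {q : Prop}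

protected theorem zero : LS M f q fun _ _ => 0 := by
  refine ⟨0, 1, ⟨fun _ _ _ _ => rfl, fun _ _ _ _ _ => Nat.zero_le _⟩, fun ρ b hb _ =>
    ⟨.skip, fun v K Lw Ls s B _ _ h0 hB hs => ?_⟩⟩
  rw [s.set_eq_self (h0 b le_rfl)]
  exact .skip ⟨fun r => (hB r).trans (by rw [pow_one]; omega), hs⟩

protected theorem var (i : ℕ) : LS M f q fun _ σ => σ i := by
  refine ⟨i + 1, 1, ⟨fun _ _ _ h => h i (by omega), fun _ _ B _ h =>
    (h i (by omega)).trans (by rw [pow_one]; omega)⟩, fun ρ b hb hρ =>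
    ⟨copyTo (ρ i) b (b + 1), fun v K Lw Ls s B _ _ h0 hB hs => ?_⟩⟩
  have := hρ i (by omega)
  exact run_copyTo ⟨fun r => (hB r).trans (by rw [pow_one]; omega), hs⟩ (by omega) (by omega)
    (by omega) (h0 _ le_rfl) (h0 _ (by omega))

/-- The global parameter. -/
protected theorem param : LS M f q fun K _ => K := by
  refine ⟨0, 1, ⟨fun _ _ _ h => rfl, fun _ _ B h _ =>
    h.trans (by rw [pow_one]; omega)⟩, fun ρ b hb hρ =>
    ⟨copyTo 0 b (b + 1), fun v K Lw Ls s B _ hK h0 hB hs => ?_⟩⟩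
  subst hK
  exact run_copyTo ⟨fun r => (hB r).trans (by rw [pow_one]; omega), hs⟩ (by omega) (by omega)
    (by omega) (h0 _ le_rfl) (h0 _ (by omega))

protected theorem succ {e : ℕ → (ℕ → ℕ) → ℕ} (he : LS M f q e) :
    LS M f q fun K σ => e K σ + 1 := by
  obtain ⟨w, c, hc, h⟩ := he
  have hpow : ∀ B, (B + 2) ^ c + 1 ≤ (B + 2) ^ (c + 1) := fun B => by
    have : 1 ≤ (B + 2) ^ c := Nat.one_le_pow _ _ (by omega)
    rw [pow_succ]; nlinarith
  refine ⟨w, c + 1, ⟨fun K σ τ hs => by rw [hc.congr K σ τ hs], fun K σ B hK hσ => ?_⟩,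
    fun ρ b hb hρ => ?_⟩
  · exact (Nat.add_le_add_right (hc.le K σ B hK hσ) 1).trans (hpow B)
  · obtain ⟨P, hP⟩ := h ρ b hb hρ
    refine ⟨.seq P (.act (.inc b)), fun v K Lw Ls s B hq hK h0 hB hs => ?_⟩
    have h1 := (hP v K Lw Ls s B hq hK h0 hB hs).mono_bound
      (Nat.pow_le_pow_right (by omega) (Nat.le_succ c))
    have h2 := run_inc (v := v) h1.inv_right b (by
      rw [RState.set_regs_self]
      refine le_trans ?_ (hpow B)
      exact Nat.add_le_add_right (hc.le K _ B (hK ▸ hB 0) fun i _ => hB _) 1)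
    rw [RState.set_regs_self, RState.set_set] at h2
    exact .seq h1 h2

/-- Renaming of variables. -/
protected theorem ren {e : ℕ → (ℕ → ℕ) → ℕ} (he : LS M f q e) (g : ℕ → ℕ) :
    LS M f q fun K σ => e K fun i => σ (g i) := by
  obtain ⟨w, c, hc, h⟩ := he
  have hg : ∀ i < w, g i < (Finset.range w).sup g + 1 := fun i hi =>
    Nat.lt_succ_of_le (Finset.le_sup (Finset.mem_range.2 hi))
  refine ⟨(Finset.range w).sup g + 1, c, ⟨fun K σ τ hs => hc.congr _ _ _ fun i hi => hs _ (hg i hi),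
    fun K σ B hK hσ => hc.le _ _ _ hK fun i hi => hσ _ (hg i hi)⟩, fun ρ b hb hρ => ?_⟩
  exact h (fun i => ρ (g i)) b hb fun i hi => hρ _ (hg i hi)

/-- Primitive recursion with polynomially bounded values. -/
protected theorem recursion {e h β : ℕ → (ℕ → ℕ) → ℕ} {g : ℕ → ℕ → ℕ → (ℕ → ℕ) → ℕ}
    (he : LS M f q e) (hg : LS M f q fun K σ => g K (σ 1) (σ 0) fun i => σ (i + 2))
    (hh : LS M f q h) (hβ : ∃ w c, PolyBdd w c β)
    (hle : ∀ K σ n, n ≤ h K σ → Nat.rec (e K σ) (fun i a => g K i a σ) n ≤ β K σ) :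
    LS M f q fun K σ => Nat.rec (e K σ) (fun i a => g K i a σ) (h K σ) := by
  obtain ⟨w₁, c₁, hb₁, h₁⟩ := he
  obtain ⟨w₂, c₂, hb₂, h₂⟩ := hg
  obtain ⟨w₃, c₃, hb₃, h₃⟩ := hh
  obtain ⟨w₄, c₄, hb₄⟩ := hβ
  set w := max (max w₁ w₂) (max w₃ w₄) with hw
  set a := c₁ + c₃ + c₄ + 1 with ha
  set c := (a + 1) * (c₁ + c₂ + c₃ + 1) with hc
  have hac : a ≤ c := by rw [hc]; nlinarith
  have hrec : ∀ K σ τ, (∀ i < w, σ i = τ i) → ∀ n,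
      (Nat.rec (e K σ) (fun i a => g K i a σ) n : ℕ) =
        Nat.rec (e K τ) (fun i a => g K i a τ) n := by
    intro K σ τ hs n
    induction n with
    | zero => exact hb₁.congr K σ τ fun i hi => hs i (by omega)
    | succ n ih =>
      simp only [ih]
      refine hb₂.congr K (push _ (push n σ)) (push _ (push n τ)) fun i hi => ?_
      rcases i with _ | _ | i
      · rfl
      · rfl
      · exact hs i (by omega)
  refine ⟨w, c, ⟨fun K σ τ hs => ?_, fun K σ B hK hσ => ?_⟩, fun ρ b hb hρ => ?_⟩
  · rw [hb₃.congr K σ τ fun i hi => hs i (by omega)]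
    exact hrec K σ τ hs _
  · refine (hle K σ _ le_rfl).trans ((hb₄.le K σ B hK fun i hi => hσ i (by omega)).trans ?_)
    exact Nat.pow_le_pow_right (by omega) (by omega)
  · obtain ⟨P₁, hP₁⟩ := h₁ ρ b hb fun i hi => hρ i (by omega)
    obtain ⟨P₃, hP₃⟩ := h₃ ρ (b + 1) (by omega) fun i hi => (hρ i (by omega)).trans (by omega)
    obtain ⟨P₂, hP₂⟩ := h₂ (push b (push (b + 2) ρ)) (b + 3) (by omega) fun i hi => by
      rcases i with _ | _ | i
      · simp only [push]; omega
      · simp only [push]; omega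
      · have := hρ i (by omega)
        simp only [push]; omega
    refine ⟨.seq P₁ (.seq P₃ (.seq (.loop (.reg (b + 1)) (.seq (.act (.dec (b + 1)))
      (.seq P₂ (.seq (clear b) (.seq (addTo (b + 3) b) (.act (.inc (b + 2)))))))) (clear (b + 2)))),
      fun v K Lw Ls s B hq hK h0 hB hs => ?_⟩
    set σ : ℕ → ℕ := fun i => s.regs (ρ i) with hσ
    -- All registers are bounded by `B₁` at the start of each pass through the loop.
    set B₁ := (B + 2) ^ a with hB₁
    have hBB : B + 2 ≤ B₁ := Nat.le_self_pow (by omega) _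
    have hB1c : B₁ ≤ (B + 2) ^ c := Nat.pow_le_pow_right (by omega) hac
    have hKB : K ≤ B := hK ▸ hB 0
    have hv₁ : e K σ ≤ B₁ := (hb₁.le K σ B hKB fun i _ => hB _).trans
      (Nat.pow_le_pow_right (by omega) (by omega))
    have hv₃ : h K σ ≤ B₁ := (hb₃.le K σ B hKB fun i _ => hB _).trans
      (Nat.pow_le_pow_right (by omega) (by omega))
    have hv₄ : ∀ n ≤ h K σ, Nat.rec (e K σ) (fun i a => g K i a σ) n ≤ B₁ := fun n hn =>
      (hle K σ n hn).trans ((hb₄.le K σ B hKB fun i _ => hB _).trans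
        (Nat.pow_le_pow_right (by omega) (by omega)))
    have hs₀ : RInv B₁ Lw Ls s := ⟨fun r => (hB r).trans (by omega), hs⟩
    have hcl : ∀ d, d ≤ c₁ + c₂ + c₃ → (B₁ + 2) ^ d ≤ (B + 2) ^ c := fun d hd =>
      pow_add_two_pow_le (by omega) (by rw [hc]; exact Nat.mul_le_mul_left _ (by omega))
    have r₁ := (hP₁ v K Lw Ls s B hq hK h0 hB hs).mono_bound (D' := (B + 2) ^ c)
      (Nat.pow_le_pow_right (by omega) (by omega))
    have hs₁ : RInv B₁ Lw Ls (s.set b (e K σ)) := hs₀.set hv₁ b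
    have r₂ := (hP₃ v K Lw Ls (s.set b (e K σ)) B₁ hq
      (by rw [RState.set_regs_of_ne _ _ hb.ne]; exact hK)
      (fun r hr => by rw [RState.set_regs_of_ne _ _ (by omega)]; exact h0 r (by omega))
      hs₁.regs_le hs₁.sim).mono_bound (hcl c₃ (by omega))
    have hh' : h K (fun i => (s.set b (e K σ)).regs (ρ i)) = h K σ :=
      hb₃.congr K _ _ fun i hi => by
        rw [RState.set_regs_of_ne _ _ (hρ i (by omega)).ne]
    rw [hh'] at r₂
    -- The state after `i` passes: the value in `b`, the remaining passes in `b + 1`, and `i` in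
    -- `b + 2`.
    let x : ℕ → RState M := fun i =>
      ((s.set b (Nat.rec (e K σ) (fun i a => g K i a σ) i)).set (b + 1) (h K σ - i)).set (b + 2) i
    have hx : ∀ i ≤ h K σ, RInv B₁ Lw Ls (x i) := fun i hi =>
      ((hs₀.set (hv₄ i hi) b).set (by omega) _).set (by omega) _
    have hx0 : x 0 = (s.set b (e K σ)).set (b + 1) (h K σ) := by
      simp only [x, Nat.sub_zero]
      refine RState.set_eq_self _ ?_
      rw [RState.set_regs_of_ne _ _ (by omega), RState.set_regs_of_ne _ _ (by omega)]
      exact h0 _ (by omega)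
    rw [← hx0] at r₂
    have r₃ := Run.loop_iterate (stp := rstp v) (tst := rtst v) (Inv := RInv ((B + 2) ^ c) Lw Ls)
      (t := .reg (b + 1)) (P := .seq (.act (.dec (b + 1)))
      (.seq P₂ (.seq (clear b) (.seq (addTo (b + 3) b) (.act (.inc (b + 2))))))) x (h K σ)
      (fun i hi => ?_) (fun i hi => ?_) ?_ ⟨fun r => ((hx _ le_rfl).regs_le r).trans hB1c,
        (hx _ le_rfl).sim⟩
    rotate_left
    · simp only [rtst, x, RState.set_regs]
      simp; omega
    · have hreg : ∀ r, (x i).regs r = if r = b + 2 then i else if r = b + 1 then h K σ - i else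
          if r = b then Nat.rec (e K σ) (fun i a => g K i a σ) i else s.regs r := by
        intro r
        simp only [x, RState.set_regs]
      have d₁ := run_dec (v := v) (hx i hi.le) (b + 1) (by rw [hreg]; simp; omega)
      set y := (x i).set (b + 1) ((x i).regs (b + 1) - 1) with hy
      have hyreg : ∀ r, y.regs r = if r = b + 2 then i else if r = b + 1 then h K σ - (i + 1) else
          if r = b then Nat.rec (e K σ) (fun i a => g K i a σ) i else s.regs r := by
        intro r
        rw [hy, RState.set_regs, hreg, hreg]
        simp only [Nat.add_left_cancel_iff, OfNat.one_ne_ofNat, if_false, if_true]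
        split_ifs <;> omega
      have d₂ := (hP₂ v K Lw Ls y B₁ hq
        (by rw [hyreg, if_neg (by omega), if_neg (by omega), if_neg (by omega)]; exact hK)
        (fun r hr => by
          rw [hyreg, if_neg (by omega), if_neg (by omega), if_neg (by omega)]
          exact h0 r (by omega))
        d₁.inv_right.regs_le d₁.inv_right.sim).mono_bound (hcl c₂ (by omega))
      have hval : g K (y.regs (push b (push (b + 2) ρ) 1)) (y.regs (push b (push (b + 2) ρ) 0))
          (fun j => y.regs (push b (push (b + 2) ρ) (j + 2))) =
          Nat.rec (e K σ) (fun i a => g K i a σ) (i + 1) := by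
        refine hb₂.congr K (fun j => y.regs (push b (push (b + 2) ρ) j))
          (push (Nat.rec (e K σ) (fun i a => g K i a σ) i) (push i σ)) fun j hj => ?_
        rcases j with _ | _ | j
        · simp [push, hyreg]
        · simp [push, hyreg]
        · have := hρ j (by omega)
          simp only [push]
          rw [hyreg, if_neg (by omega), if_neg (by omega), if_neg (by omega)]
      beta_reduce at d₂
      rw [hval] at d₂
      have d₃ := run_clear (v := v) d₂.inv_right b
      have d₄ := run_addTo (v := v) d₃.inv_right (r := b + 3) (q := b) (by omega) (by
        simp only [RState.set_regs]
        simp only [if_true, Nat.add_eq_left, OfNat.ofNat_ne_zero, if_false, zero_add]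
        exact (hv₄ (i + 1) hi).trans hB1c)
      have d₅ := run_inc (v := v) d₄.inv_right (b + 2) (by
        simp only [RState.set_regs, hyreg]
        simp
        omega)
      refine .seq (d₁.mono_bound hB1c) (.seq d₂ (.seq d₃ (.seq d₄ ?_)))
      convert d₅ using 1
      refine RState.ext (funext fun r => ?_) rfl rfl rfl rfl
      simp only [x, RState.set_regs, hyreg]
      by_cases hr2 : r = b + 2
      · subst hr2; simp
      · by_cases hr3 : r = b + 3
        · subst hr3; simp; exact h0 (b + 3) (by omega)
        · by_cases hr0 : r = b
          · subst hr0; simp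
          · simp [hr2, hr3, hr0]
    · simp only [rtst, x, RState.set_regs]
      simp
    have r₄ := run_clear (v := v) r₃.inv_right (b + 2)
    have hfin : (x (h K σ)).set (b + 2) 0 =
        s.set b (Nat.rec (e K σ) (fun i a => g K i a σ) (h K σ)) := by
      refine RState.ext (funext fun r => ?_) rfl rfl rfl rfl
      simp only [x, RState.set_regs]
      by_cases hr2 : r = b + 2
      · subst hr2; simp; exact (h0 _ (by omega)).symm
      · by_cases hr1 : r = b + 1
        · subst hr1; simp; exact (h0 _ (by omega)).symm
        · simp [hr2, hr1]
    rw [hfin] at r₄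
    exact .seq r₁ (.seq r₂ (.seq r₃ r₄))

end LS

namespace LS

variable {M : Machine Bool Bool} {f : ℕ → ℕ} {q : Prop} {a b e h m : ℕ → (ℕ → ℕ) → ℕ}
  {F : ℕ → ℕ → (ℕ → ℕ) → ℕ}

/-! #### Arithmetic -/

theorem polyBdd (he : LS M f q e) : ∃ w c, PolyBdd w c e := by
  obtain ⟨w, c, h, -⟩ := he
  exact ⟨w, c, h⟩

protected theorem const (n : ℕ) : LS M f q fun _ _ => n := by
  induction n with
  | zero => exact .zero
  | succ n ih => exact ih.succ

/-- A function without an additional variable as a function with an additional variable. -/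
theorem lift (he : LS M f q e) : LS M f q fun K σ => e K fun i => σ (i + 1) :=
  he.ren (· + 1)

theorem lift₂ (he : LS M f q e) : LS M f q fun K σ => e K fun i => σ (i + 2) :=
  he.ren (· + 2)

theorem polyBdd_add {a b : ℕ → (ℕ → ℕ) → ℕ} (ha : ∃ w c, PolyBdd w c a)
    (hb : ∃ w c, PolyBdd w c b) : ∃ w c, PolyBdd w c fun K σ => a K σ + b K σ := by
  obtain ⟨w, c, ha⟩ := ha
  obtain ⟨w', c', hb⟩ := hb
  refine ⟨max w w', max c c' + 1, fun K σ τ h => ?_, fun K σ B hK h => ?_⟩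
  · rw [ha.congr K σ τ fun i hi => h i (by omega), hb.congr K σ τ fun i hi => h i (by omega)]
  · have h1 := (ha.mono (le_max_left w w') (le_max_left c c')).le K σ B hK h
    have h2 := (hb.mono (le_max_right w w') (le_max_right c c')).le K σ B hK h
    rw [pow_succ]
    nlinarith

theorem polyBdd_mul {a b : ℕ → (ℕ → ℕ) → ℕ} (ha : ∃ w c, PolyBdd w c a)
    (hb : ∃ w c, PolyBdd w c b) : ∃ w c, PolyBdd w c fun K σ => a K σ * b K σ := by
  obtain ⟨w, c, ha⟩ := ha
  obtain ⟨w', c', hb⟩ := hb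
  refine ⟨max w w', c + c', fun K σ τ h => ?_, fun K σ B hK h => ?_⟩
  · rw [ha.congr K σ τ fun i hi => h i (by omega), hb.congr K σ τ fun i hi => h i (by omega)]
  · rw [pow_add]
    exact Nat.mul_le_mul (ha.le K σ B hK fun i hi => h i (by omega))
      (hb.le K σ B hK fun i hi => h i (by omega))

protected theorem add (ha : LS M f q a) (hb : LS M f q b) :
    LS M f q fun K σ => a K σ + b K σ := by
  have key : ∀ K σ n, (Nat.rec (a K σ) (fun _ x => x + 1) n : ℕ) = a K σ + n := by
    intro K σ n
    induction n with
    | zero => rfl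
    | succ n ih => simp only [ih, add_assoc]
  have := LS.recursion (g := fun _ _ x _ => x + 1) ha (LS.var 0).succ hb
    (polyBdd_add ha.polyBdd hb.polyBdd) (fun K σ n hn => by rw [key]; omega)
  simpa only [key] using this

protected theorem pred (ha : LS M f q a) : LS M f q fun K σ => a K σ - 1 := by
  have key : ∀ n, (Nat.rec 0 (fun i _ => i) n : ℕ) = n - 1 := by
    intro n
    cases n <;> rfl
  have := LS.recursion (g := fun _ i _ _ => i) LS.zero (LS.var 1) ha ha.polyBdd
    (fun K σ n hn => by rw [key]; omega)
  simpa only [key] using this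

protected theorem sub (ha : LS M f q a) (hb : LS M f q b) :
    LS M f q fun K σ => a K σ - b K σ := by
  have key : ∀ K σ n, (Nat.rec (a K σ) (fun _ x => x - 1) n : ℕ) = a K σ - n := by
    intro K σ n
    induction n with
    | zero => rfl
    | succ n ih => simp only [ih, Nat.sub_sub]
  have := LS.recursion (g := fun _ _ x _ => x - 1) ha (LS.var 0).pred hb
    ha.polyBdd (fun K σ n hn => by rw [key]; omega)
  simpa only [key] using this

protected theorem mul (ha : LS M f q a) (hb : LS M f q b) :
    LS M f q fun K σ => a K σ * b K σ := by
  have key : ∀ K σ n, (Nat.rec 0 (fun _ x => x + a K σ) n : ℕ) = a K σ * n := by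
    intro K σ n
    induction n with
    | zero => rfl
    | succ n ih => simp only [ih, Nat.mul_succ]
  have := LS.recursion (g := fun K _ x σ => x + a K σ) LS.zero ((LS.var 0).add ha.lift₂) hb
    (polyBdd_mul ha.polyBdd hb.polyBdd)
    (fun K σ n hn => by rw [key]; exact Nat.mul_le_mul_left _ hn)
  simpa only [key] using this

/-- Sums of polynomial length. -/
protected theorem sum (hh : LS M f q h) (hF : LS M f q fun K σ => F K (σ 0) fun i => σ (i + 1)) :
    LS M f q fun K σ => ∑ i ∈ Finset.range (h K σ), F K i σ := by
  have key : ∀ K σ n, (Nat.rec 0 (fun i x => x + F K i σ) n : ℕ) =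
      ∑ i ∈ Finset.range n, F K i σ := by
    intro K σ n
    induction n with
    | zero => rfl
    | succ n ih => simp only [ih, Finset.sum_range_succ]
  have hβ : ∃ w c, PolyBdd w c fun K σ => ∑ i ∈ Finset.range (h K σ), F K i σ := by
    obtain ⟨w, c, hb⟩ := hh.polyBdd
    obtain ⟨w', c', hb'⟩ := hF.polyBdd
    refine ⟨max w w', c + (c + 2) * c', fun K σ τ hs => ?_, fun K σ B hK hs => ?_⟩
    · rw [hb.congr K σ τ fun i hi => hs i (by omega)]
      refine Finset.sum_congr rfl fun i _ => hb'.congr K (push i σ) (push i τ) fun j hj => ?_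
      rcases j with _ | j
      · rfl
      · exact hs j (by omega)
    · have h1 := hb.le K σ B hK fun i hi => hs i (by omega)
      have h2 : B + 2 ≤ (B + 2) ^ (c + 1) := Nat.le_self_pow (by omega) _
      have h3 : (B + 2) ^ c ≤ (B + 2) ^ (c + 1) := Nat.pow_le_pow_right (by omega) (by omega)
      calc ∑ i ∈ Finset.range (h K σ), F K i σ
          ≤ ∑ i ∈ Finset.range (h K σ), (B + 2) ^ ((c + 2) * c') := by
            refine Finset.sum_le_sum fun i hi => ?_
            rw [Finset.mem_range] at hi
            refine (hb'.le K (push i σ) ((B + 2) ^ (c + 1)) (by omega) fun j hj => ?_).trans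
              (pow_add_two_pow_le (by omega) le_rfl)
            rcases j with _ | j
            · simp only [push]; omega
            · have := hs j (by omega)
              simp only [push]; omega
        _ = h K σ * (B + 2) ^ ((c + 2) * c') := by simp
        _ ≤ (B + 2) ^ c * (B + 2) ^ ((c + 2) * c') := Nat.mul_le_mul_right _ h1
        _ = _ := by rw [← pow_add]
  have := LS.recursion (g := fun K i x σ => x + F K i σ) LS.zero
    ((LS.var 0).add (hF.ren (· + 1))) hh hβ (fun K σ n hn => by
      rw [key]
      exact Finset.sum_le_sum_of_subset (Finset.range_subset_range.2 hn))
  simpa only [key] using this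

/-! #### Case distinctions -/

section

variable {p r : ℕ → (ℕ → ℕ) → Prop} [∀ K σ, Decidable (p K σ)] [∀ K σ, Decidable (r K σ)]

protected theorem ite (hp : LS M f q fun K σ => if p K σ then 1 else 0) (ha : LS M f q a)
    (hb : LS M f q b) : LS M f q fun K σ => if p K σ then a K σ else b K σ := by
  have := (hp.mul ha).add (((LS.const 1).sub hp).mul hb)
  convert this using 3 with K σ
  split_ifs <;> simp

protected theorem le (ha : LS M f q a) (hb : LS M f q b) :
    LS M f q fun K σ => if a K σ ≤ b K σ then 1 else 0 := by
  have := (LS.const 1).sub (ha.sub hb)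
  convert this using 3 with K σ
  split_ifs <;> omega

protected theorem lt (ha : LS M f q a) (hb : LS M f q b) :
    LS M f q fun K σ => if a K σ < b K σ then 1 else 0 :=
  ha.succ.le hb

protected theorem and (hp : LS M f q fun K σ => if p K σ then 1 else 0)
    (hr : LS M f q fun K σ => if r K σ then 1 else 0) :
    LS M f q fun K σ => if p K σ ∧ r K σ then 1 else 0 := by
  convert hp.mul hr using 3 with K σ
  by_cases h1 : p K σ <;> by_cases h2 : r K σ <;> simp [h1, h2]

protected theorem not (hp : LS M f q fun K σ => if p K σ then 1 else 0) :
    LS M f q fun K σ => if ¬ p K σ then 1 else 0 := by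
  convert (LS.const 1).sub hp using 3 with K σ
  split_ifs <;> rfl

protected theorem eq (ha : LS M f q a) (hb : LS M f q b) :
    LS M f q fun K σ => if a K σ = b K σ then 1 else 0 := by
  convert (ha.le hb).and (hb.le ha) using 4 with K σ
  exact le_antisymm_iff

end

protected theorem min (ha : LS M f q a) (hb : LS M f q b) :
    LS M f q fun K σ => min (a K σ) (b K σ) := by
  simpa only [min_def] using LS.ite (ha.le hb) ha hb

/-! #### Division -/

protected theorem div (ha : LS M f q a) (hb : LS M f q b) :
    LS M f q fun K σ => a K σ / b K σ := by
  have := LS.sum (F := fun K i σ => if (i + 1) * b K σ ≤ a K σ ∧ 0 < b K σ then 1 else 0) ha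
    (((((LS.var 0).succ.mul hb.lift).le ha.lift)).and (LS.zero.lt hb.lift))
  convert this using 3 with K σ
  rcases Nat.eq_zero_or_pos (b K σ) with h0 | h0
  · simp [h0]
  · rw [Finset.sum_boole, Nat.cast_id]
    have : ({i ∈ Finset.range (a K σ) | (i + 1) * b K σ ≤ a K σ ∧ 0 < b K σ}) =
        Finset.range (a K σ / b K σ) := by
      ext i
      simp only [Finset.mem_filter, Finset.mem_range, h0, and_true, ← Nat.le_div_iff_mul_le h0]
      have := Nat.div_le_self (a K σ) (b K σ)
      omega
    rw [this, Finset.card_range]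

protected theorem mod (ha : LS M f q a) (hb : LS M f q b) :
    LS M f q fun K σ => a K σ % b K σ := by
  convert ha.sub (hb.mul (ha.div hb)) using 3 with K σ
  have := Nat.mod_add_div (a K σ) (b K σ)
  omega

/-- Products of polynomial length modulo a number. -/
theorem prodMod (hh : LS M f q h) (hF : LS M f q fun K σ => F K (σ 0) fun i => σ (i + 1))
    (hm : LS M f q m) (hpos : ∀ K σ, 0 < m K σ) :
    LS M f q fun K σ => (∏ i ∈ Finset.range (h K σ), F K i σ) % m K σ := by
  have key : ∀ K σ n, (Nat.rec (1 % m K σ) (fun i x => (x * F K i σ) % m K σ) n : ℕ) =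
      (∏ i ∈ Finset.range n, F K i σ) % m K σ := by
    intro K σ n
    induction n with
    | zero => rfl
    | succ n ih => simp only [ih, Finset.prod_range_succ, Nat.mod_mul_mod]
  have := LS.recursion (g := fun K i x σ => (x * F K i σ) % m K σ) ((LS.const 1).mod hm)
    (((LS.var 0).mul (hF.ren (· + 1))).mod hm.lift₂) hh hm.polyBdd (fun K σ n hn => by
      rw [key]
      exact (Nat.mod_lt _ (hpos K σ)).le)
  simpa only [key] using this

theorem powMod (ha : LS M f q a) (hb : LS M f q b) (hm : LS M f q m) (hpos : ∀ K σ, 0 < m K σ) :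
    LS M f q fun K σ => a K σ ^ b K σ % m K σ := by
  simpa using prodMod (F := fun K _ σ => a K σ) hb ha.lift hm hpos

theorem prime (ha : LS M f q a) :
    LS M f q fun K σ => if (a K σ).Prime then 1 else 0 := by
  have := LS.eq (LS.sum (F := fun K d σ => if a K σ % d = 0 then 1 else 0) ha
    ((ha.lift.mod (LS.var 0)).eq LS.zero)) (LS.const 1)
  convert this using 4 with K σ
  rw [Finset.sum_boole, Nat.cast_id]
  have : ({d ∈ Finset.range (a K σ) | a K σ % d = 0}) = (a K σ).properDivisors := by
    ext d
    simp only [Finset.mem_filter, Finset.mem_range, Nat.mem_properDivisors,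
      Nat.dvd_iff_mod_eq_zero]
    tauto
  rw [this, ← Nat.properDivisors_eq_singleton_one_iff_prime, Finset.card_eq_one]
  constructor
  · intro h; exact ⟨1, h⟩
  · rintro ⟨x, hx⟩
    have h1 : x ∈ (a K σ).properDivisors := by rw [hx]; exact Finset.mem_singleton_self x
    have h2 := Nat.mem_properDivisors.1 h1
    have h3 : 1 ∈ (a K σ).properDivisors := by
      rw [Nat.one_mem_properDivisors_iff_one_lt]
      by_contra h4
      have h5 := Nat.pos_of_dvd_of_pos h2.1 (by omega)
      omega
    rw [hx, Finset.mem_singleton] at h3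
    rw [hx, h3]

end LS

variable {M : Machine Bool Bool} {f : ℕ → ℕ}

/-! #### Calling the simulated machine -/

/-- The length of the binary numeral of a number. -/
def numeralLength (k : ℕ) : ℕ := if k = 0 then 1 else k.size

theorem length_numeral (k : ℕ) : (numeral k).length = numeralLength k := by
  unfold numeral numeralLength
  split_ifs
  · rfl
  · rw [List.length_reverse, Nat.size_eq_bits_len]

theorem getElem_numeral {k i : ℕ} (hi : i < (numeral k).length) :
    (numeral k)[i] = decide (k / 2 ^ (numeralLength k - (i + 1)) % 2 = 1) := by
  have hl := length_numeral k
  unfold numeral numeralLength at *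
  split_ifs at * with h
  · subst h
    simp
  · replace hi : i < k.bits.length := by simpa [h] using hi
    simp only [List.getElem_reverse, ← Nat.testBit_eq_decide_div_mod_eq]
    rw [Nat.testBit_eq_inth, List.getI_eq_getElem _ (by rw [Nat.size_eq_bits_len] at hi ⊢; omega)]
    congr 1
    rw [Nat.size_eq_bits_len]; omega

theorem bitsVal_append_singleton (l : List Bool) (b : Bool) :
    bitsVal (l ++ [b]) = 2 * bitsVal l + b.toNat := by
  simp [bitsVal]

theorem bitsVal_numeral (n : ℕ) : bitsVal (numeral n) = n := by
  have key : ∀ n : ℕ, bitsVal n.bits.reverse = n := by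
    intro n
    induction n using Nat.binaryRec' with
    | zero => rfl
    | bit b n h ih =>
      rw [Nat.bits_append_bit n b h, List.reverse_cons, bitsVal_append_singleton, ih,
        Nat.bit_val]
  unfold numeral
  split_ifs with h
  · subst h; rfl
  · exact key n

namespace LS

variable {q : Prop} {a b e : ℕ → (ℕ → ℕ) → ℕ}

/-- Division by a power of two, without computing the power. -/
theorem divPow (ha : LS M f q a) (hb : LS M f q b) :
    LS M f q fun K σ => a K σ / 2 ^ b K σ := by
  have key : ∀ K σ n, (Nat.rec (a K σ) (fun _ x => x / 2) n : ℕ) = a K σ / 2 ^ n := by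
    intro K σ n
    induction n with
    | zero => simp
    | succ n ih => simp only [ih, Nat.div_div_eq_div_mul, pow_succ]
  have := LS.recursion (g := fun _ _ x _ => x / 2) ha ((LS.var 0).div (LS.const 2)) hb ha.polyBdd
    (fun K σ n hn => by rw [key]; exact Nat.div_le_self _ _)
  simpa only [key] using this

theorem numeralLength (ha : LS M f q a) : LS M f q fun K σ => numeralLength (a K σ) := by
  refine LS.ite (ha.eq LS.zero) (LS.const 1) ?_
  have := LS.sum (F := fun K i σ => if ¬ a K σ / 2 ^ i = 0 then 1 else 0) ha
    (LS.not ((ha.lift.divPow (LS.var 0)).eq LS.zero))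
  convert this using 3 with K σ
  rw [Finset.sum_boole, Nat.cast_id]
  have : ({i ∈ Finset.range (a K σ) | ¬ a K σ / 2 ^ i = 0}) = Finset.range (a K σ).size := by
    ext i
    simp only [Finset.mem_filter, Finset.mem_range, Nat.lt_size, Nat.div_eq_zero_iff, not_or,
      not_lt]
    refine ⟨fun h => h.2.2, fun h => ⟨(Nat.lt_two_pow_self).trans_le h, by positivity, h⟩⟩
  rw [this, Finset.card_range]

end LS

theorem simInv_of_word {Lw Ls : ℕ} {s : RState M} (hw : s.word.length ≤ Lw)
    (hp : s.cfg.inputPos ≤ s.word.length + 1) (h : ∀ i, s.cfg.pos i < Ls) : SimInv Lw Ls s :=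
  ⟨hw, hp, h⟩

/-- Writing the numeral of the register `b` on the input tape of the simulated machine. -/
theorem exists_feed (M : Machine Bool Bool) : ∃ d, ∀ b, 0 < b → ∃ P : RProg,
    ∀ (v : List Unit) (Lw Ls : ℕ) (s : RState M) (B : ℕ), (∀ r, b < r → s.regs r = 0) →
      (∀ r, s.regs r ≤ B) → SimInv Lw Ls s → s.word = [] → s.cfg = M.init →
      (numeral (s.regs b)).length ≤ Lw →
      RRun v ((B + 2) ^ d) Lw Ls P s { s with word := numeral (s.regs b) } := by
  obtain ⟨w₁, c₁, hb₁, h₁⟩ := LS.numeralLength (M := M) (f := id) (q := False) (LS.var 0)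
  obtain ⟨w₂, c₂, hb₂, h₂⟩ := LS.mod (M := M) (f := id) (q := False) (LS.divPow (LS.var 0)
    ((LS.numeralLength (LS.var 0)).sub (LS.var 1).succ)) (LS.const 2)
  refine ⟨(c₁ + 2) * (c₁ + c₂ + 1), fun b hb => ?_⟩
  obtain ⟨P₁, hP₁⟩ := h₁ (fun i => if i = 0 then b else 0) (b + 1) (by omega)
    (fun i _ => by split_ifs <;> omega)
  obtain ⟨P₂, hP₂⟩ := h₂ (fun i => if i = 0 then b else if i = 1 then b + 2 else 0) (b + 3)
    (by omega) (fun i _ => by split_ifs <;> omega)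
  refine ⟨.seq P₁ (.seq (.loop (.reg (b + 1)) (.seq (.act (.dec (b + 1))) (.seq P₂
    (.seq (.ite (.reg (b + 3)) (.seq (.act (.feed true)) (clear (b + 3))) (.act (.feed false)))
      (.act (.inc (b + 2))))))) (.seq (clear (b + 2)) (.act .start))), ?_⟩
  intro v Lw Ls s B h0 hB hs hword hcfg hLw
  set k := s.regs b with hk
  set c := (c₁ + 2) * (c₁ + c₂ + 1) with hc
  -- All registers are bounded by `B₁` at the start of each pass through the loop.
  set B₁ := (B + 2) ^ (c₁ + 1) with hB₁
  have hBB : B + 2 ≤ B₁ := Nat.le_self_pow (by omega) _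
  have hcl : ∀ d, d ≤ c₁ + c₂ → (B₁ + 2) ^ d ≤ (B + 2) ^ c := fun d hd =>
    pow_add_two_pow_le (by omega) (by rw [hc]; exact Nat.mul_le_mul_left _ (by omega))
  have hB1c : B₁ ≤ (B + 2) ^ c := Nat.pow_le_pow_right (by omega) (by rw [hc]; nlinarith)
  have hlen : numeralLength k ≤ B₁ :=
    (hb₁.le 0 (fun _ => k) B (Nat.zero_le _) fun _ _ => hB b).trans
      (Nat.pow_le_pow_right (by omega) (by omega))
  have hlen' := length_numeral k
  have r₁ := (hP₁ v (s.regs 0) Lw Ls s B False.elim rfl (fun r hr => h0 r (by omega)) hB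
    hs).mono_bound (D' := (B + 2) ^ c)
      (Nat.pow_le_pow_right (by omega) (by rw [hc]; nlinarith))
  simp only [if_true] at r₁
  have hs₀ : RInv B₁ Lw Ls s := ⟨fun r => (hB r).trans (by omega), hs⟩
  -- The state after the first `i` bits of the numeral have been fed: the register `b + 1` counts
  -- the remaining bits, and `b + 2` those that have been fed.
  let x : ℕ → RState M := fun i =>
    { ((s.set (b + 1) (numeralLength k - i)).set (b + 2) i) with
      word := (numeral k).take i, cfg := { M.init with inputPos := i + 1 } }
  have hpos : ∀ i, M.init.pos i < Ls := fun i => by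
    have := hs.pos_lt i
    rwa [hcfg] at this
  have hx : ∀ i ≤ numeralLength k, RInv B₁ Lw Ls (x i) := fun i hi =>
    ⟨((hs₀.set (by omega) (b + 1)).set (by omega) (b + 2)).regs_le, simInv_of_word
      (by simp only [x, List.length_take]; omega) (by simp only [x, List.length_take]; omega)
      hpos⟩
  have hx0 : s.set (b + 1) (numeralLength k) = x 0 := by
    refine RState.ext (funext fun r => ?_) rfl rfl ?_ ?_
    · simp only [x, RState.set_regs]
      by_cases hr : r = b + 2
      · subst hr; simpa using h0 (b + 2) (by omega)
      · simp [hr]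
    · simp [x, RState.set, hword]
    · simp only [x, RState.set, hcfg]; rfl
  rw [hx0] at r₁
  have r₂ := Run.loop_iterate (stp := rstp v) (tst := rtst v) (Inv := RInv ((B + 2) ^ c) Lw Ls)
    (t := .reg (b + 1)) (P := .seq (.act (.dec (b + 1))) (.seq P₂
    (.seq (.ite (.reg (b + 3)) (.seq (.act (.feed true)) (clear (b + 3))) (.act (.feed false)))
      (.act (.inc (b + 2)))))) x (numeralLength k)
    (fun i hi => ?_) (fun i hi => ?_) ?_ ⟨fun r => ((hx _ le_rfl).regs_le r).trans hB1c,
        (hx _ le_rfl).sim⟩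
  rotate_left
  · simp only [rtst, x, RState.set_regs]
    simp; omega
  · have hreg : ∀ r, (x i).regs r = if r = b + 2 then i else
        if r = b + 1 then numeralLength k - i else s.regs r := by
      intro r
      simp only [x, RState.set_regs]
    have d₁ := run_dec (v := v) (hx i hi.le) (b + 1) (by rw [hreg]; simp; omega)
    set y := (x i).set (b + 1) ((x i).regs (b + 1) - 1) with hy
    have hyreg : ∀ r, y.regs r = if r = b + 2 then i else
        if r = b + 1 then numeralLength k - (i + 1) else s.regs r := by
      intro r
      rw [hy, RState.set_regs, hreg, hreg]
      simp only [Nat.add_left_cancel_iff, OfNat.one_ne_ofNat, if_false, if_true]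
      split_ifs <;> omega
    have d₂ := (hP₂ v (y.regs 0) Lw Ls y B₁ False.elim rfl
      (fun r hr => by
        rw [hyreg, if_neg (by omega), if_neg (by omega)]
        exact h0 r (by omega))
      d₁.inv_right.regs_le d₁.inv_right.sim).mono_bound (hcl c₂ (by omega))
    have hyb : y.regs b = k := by rw [hyreg, if_neg (by omega), if_neg (by omega)]
    have hyb2 : y.regs (b + 2) = i := by rw [hyreg, if_pos rfl]
    simp only [if_true, one_ne_zero, if_false, hyb, hyb2] at d₂
    have hi' : i < (numeral k).length := by omega
    have hget := getElem_numeral hi'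
    have htake := List.take_append_getElem hi'
    -- The state after the next bit has been fed.
    let z : RState M := { y with
      word := (numeral k).take (i + 1), cfg := { M.init with inputPos := i + 2 } }
    have hzsim : SimInv Lw Ls z := simInv_of_word
      (by simp only [z, List.length_take]; omega) (by simp only [z, List.length_take]; omega) hpos
    have hyI : RInv ((B + 2) ^ c) Lw Ls y :=
      ⟨fun r => (d₁.inv_right.regs_le r).trans hB1c, d₁.inv_right.sim⟩
    have hzI : RInv ((B + 2) ^ c) Lw Ls z := ⟨hyI.regs_le, hzsim⟩
    have hyword : y.word = (numeral k).take i := rfl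
    have hycfg : y.cfg = { M.init with inputPos := i + 1 } := rfl
    have hylen : y.word.length = i := by rw [hyword, List.length_take]; omega
    have hy3 : y.regs (b + 3) = 0 := by
      rw [hyreg, if_neg (by omega), if_neg (by omega)]; exact h0 _ (by omega)
    have d₃ : RRun v ((B + 2) ^ c) Lw Ls
        (.ite (.reg (b + 3)) (.seq (.act (.feed true)) (clear (b + 3))) (.act (.feed false)))
        (y.set (b + 3) (k / 2 ^ (numeralLength k - (i + 1)) % 2)) z := by
      rcases Nat.mod_two_eq_zero_or_one (k / 2 ^ (numeralLength k - (i + 1))) with hbit | hbit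
      · rw [hbit] at hget ⊢
        rw [y.set_eq_self hy3]
        refine .iteF (by simp [rtst, hy3]) (.act ⟨?_, ?_⟩ hyI hzI)
        · rw [hylen, hycfg]
        · refine RState.ext rfl rfl rfl ?_ ?_
          · simp only [z, hyword, ← htake, hget]; rfl
          · simp only [z, hycfg, hylen]
      · rw [hbit] at hget ⊢
        have hle : 1 ≤ (B + 2) ^ c := Nat.one_le_pow _ _ (by omega)
        have hz1 : RInv ((B + 2) ^ c) Lw Ls (z.set (b + 3) 1) := hzI.set hle _
        refine .iteT (by simp [rtst, RState.set_regs_self])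
          (.seq (s' := z.set (b + 3) 1) (.act ⟨?_, ?_⟩ (hyI.set hle _) hz1) ?_)
        · simp only [RState.set]; rw [hylen, hycfg]
        · refine RState.ext rfl rfl rfl ?_ ?_
          · simp only [z, RState.set, hyword, ← htake, hget]; rfl
          · simp only [z, RState.set, hycfg, hylen]
        · have := run_clear (v := v) hz1 (b + 3)
          rwa [RState.set_set, RState.set_eq_self (n := 0) z hy3] at this
    have hz2 : z.regs (b + 2) = i := hyb2
    have d₄ := run_inc (v := v) hzI (b + 2) (by rw [hz2]; omega)
    have hend : z.set (b + 2) (z.regs (b + 2) + 1) = x (i + 1) := by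
      refine RState.ext (funext fun r => ?_) rfl rfl rfl rfl
      rw [hz2]
      simp only [x, z, RState.set_regs, hyreg]
      by_cases hr : r = b + 2 <;> simp [hr]
    rw [hend] at d₄
    exact .seq (d₁.mono_bound hB1c) (.seq d₂ (.seq d₃ d₄))
  · simp only [rtst, x, RState.set_regs]
    simp
  have r₃ := run_clear (v := v) r₂.inv_right (b + 2)
  refine .seq r₁ (.seq r₂ (.seq r₃ ?_))
  have hxl : (x (numeralLength k)).word = numeral k := by
    simp [x, ← hlen']
  refine .act (s' := { s with word := numeral k }) ?_ r₃.inv_right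
    ⟨fun r => (hB r).trans (by omega), simInv_of_word hLw ?_ (by simpa [hcfg] using hpos)⟩
  · refine RState.ext (funext fun r => ?_) rfl rfl ?_ ?_
    · simp only [x, RState.set_regs]
      by_cases hr : r = b + 2
      · subst hr; simpa using h0 (b + 2) (by omega)
      · by_cases hr1 : r = b + 1
        · subst hr1; simpa using h0 (b + 1) (by omega)
        · simp [hr, hr1]
    · exact hxl.symm
    · simp only [x, RState.set, hcfg]; rfl
  · simp [hcfg, Machine.init]

theorem inputPos_le_of_reaches {w : List Bool} {c : M.Cfg}
    (h : StateTransition.Reaches (M.next w) M.init c) : c.inputPos ≤ w.length + 1 := by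
  induction h with
  | refl => simp [Machine.init]
  | tail _ h ih =>
    obtain ⟨u, -, rfl⟩ := Option.map_eq_some_iff.1 h
    simp only
    cases u.2.1 <;> simp only [Machine.moveInput] <;> omega

/-- Running the simulated machine and collecting the number that it writes, capped at `K`, in the
register `b`. -/
theorem exists_sim (M : Machine Bool Bool) : ∃ d, ∀ b, 0 < b → ∃ P : RProg,
    ∀ (f : ℕ → ℕ) (v : List Unit) (K Lw Ls : ℕ) (s : RState M) (B k : ℕ), Adequate M f K Lw Ls →
      k ≤ K → s.regs 0 = K → (∀ r, b ≤ r → s.regs r = 0) → (∀ r, s.regs r ≤ B) →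
      s.word = numeral k → s.cfg = M.init →
      ∃ c, RRun v ((B + 2) ^ d) Lw Ls P s { s.set b (min (f k) K) with cfg := c } := by
  obtain ⟨w₁, c₁, hb₁, h₁⟩ := LS.min (M := M) (f := id) (q := False)
    ((LS.const 2).mul (LS.var 0)).succ LS.param
  obtain ⟨w₂, c₂, hb₂, h₂⟩ := LS.min (M := M) (f := id) (q := False)
    ((LS.const 2).mul (LS.var 0)) LS.param
  refine ⟨c₁ + c₂ + 1, fun b hb => ?_⟩
  obtain ⟨P₁, hP₁⟩ := h₁ (fun i => if i = 0 then b else 0) (b + 1) (by omega)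
    (fun i _ => by split_ifs <;> omega)
  obtain ⟨P₂, hP₂⟩ := h₂ (fun i => if i = 0 then b else 0) (b + 1) (by omega)
    (fun i _ => by split_ifs <;> omega)
  refine ⟨.loop .simRun (.seq (.ite (.simOut true)
      (.seq P₁ (.seq (clear b) (addTo (b + 1) b)))
      (.ite (.simOut false) (.seq P₂ (.seq (clear b) (addTo (b + 1) b))) .skip))
    (.act .simStep)), ?_⟩
  intro f v K Lw Ls s B k hA hk hK h0 hB hword hcfg
  set d := c₁ + c₂ + 1
  have hKB : K ≤ B := hK ▸ hB 0
  have hBd : B ≤ (B + 2) ^ d :=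
    (Nat.le_add_right B 2).trans (Nat.le_self_pow (by omega) _)
  -- While the simulated machine is in the configuration `c`, the register `b` holds the capped
  -- value of its output so far.  Capping commutes with appending a bit, so that nothing is lost.
  let x : M.Cfg → RState M := fun c => { s.set b (min (bitsVal c.output) K) with cfg := c }
  have hsim : ∀ {c}, StateTransition.Reaches (M.next (numeral k)) M.init c → ∀ n,
      SimInv Lw Ls ((x c).set b n) := fun {c} hc n => simInv_of_word
    (by simp only [x, RState.set, hword]; exact hA.length_le k hk)
    (by simp only [x, RState.set, hword]; exact inputPos_le_of_reaches hc)
    (fun i => hA.pos_lt k hk c hc i)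
  have hI : ∀ {c}, StateTransition.Reaches (M.next (numeral k)) M.init c → ∀ n ≤ K,
      RInv B Lw Ls ((x c).set b n) := fun {c} hc n hn => by
    refine ⟨fun r => ?_, hsim hc n⟩
    simp only [x, RState.set_regs]
    split_ifs
    exacts [hn.trans hKB, hB r]
  have hself : ∀ c, (x c).set b (min (bitsVal c.output) K) = x c := fun c =>
    RState.set_eq_self _ (by simp [x, RState.set_regs_self])
  have hI' : ∀ {c}, StateTransition.Reaches (M.next (numeral k)) M.init c →
      RInv ((B + 2) ^ d) Lw Ls (x c) := fun {c} hc => by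
    have := hI hc _ (min_le_right (bitsVal c.output) K)
    rw [hself] at this
    exact ⟨fun r => (this.regs_le r).trans hBd, this.sim⟩
  -- Replacing the value in the register `b`.
  have hupd : ∀ (P : RProg) (g : ℕ → ℕ → ℕ) (e : ℕ) (he : e ≤ d), (∀ n, g K n ≤ K) →
      Evals M id False (fun K σ => g K (σ 0)) e (fun i => if i = 0 then b else 0) (b + 1) P →
      ∀ {c}, StateTransition.Reaches (M.next (numeral k)) M.init c →
      RRun v ((B + 2) ^ d) Lw Ls (.seq P (.seq (clear b) (addTo (b + 1) b))) (x c)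
        ((x c).set b (g K (min (bitsVal c.output) K))) := by
    intro P g e he hg hP c hc
    have hxc := hI hc _ (min_le_right (bitsVal c.output) K)
    rw [hself] at hxc
    have r₁ := (hP v K Lw Ls (x c) B False.elim
      (by simp only [x]; rw [RState.set_regs_of_ne _ _ hb.ne]; exact hK)
      (fun r hr => by
        simp only [x]; rw [RState.set_regs_of_ne _ _ (by omega)]; exact h0 r (by omega))
      hxc.regs_le hxc.sim).mono_bound (D' := (B + 2) ^ d)
        (Nat.pow_le_pow_right (by omega) he)
    have hxb : (x c).regs b = min (bitsVal c.output) K := by simp [x, RState.set_regs_self]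
    simp only [if_true, hxb] at r₁
    have r₂ := run_clear (v := v) r₁.inv_right b
    have r₃ := run_addTo (v := v) r₂.inv_right (r := b + 1) (q := b) (by omega) (by
      simp only [RState.set_regs]
      simp
      exact (hg _).trans (hKB.trans hBd))
    refine .seq r₁ (.seq r₂ ?_)
    convert r₃ using 1
    refine RState.ext (funext fun r => ?_) rfl rfl rfl rfl
    simp only [x, RState.set_regs]
    by_cases hr : r = b
    · subst hr; simp
    · by_cases hr1 : r = b + 1
      · subst hr1; simpa using h0 (b + 1) (by omega)
      · simp [hr, hr1]
  obtain ⟨cend, hreach, hhalt, hout⟩ := hA.outputs k hk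
  have main : ∀ {c}, StateTransition.Reaches (M.next (numeral k)) c cend →
      StateTransition.Reaches (M.next (numeral k)) M.init c →
      RRun v ((B + 2) ^ d) Lw Ls (.loop .simRun (.seq (.ite (.simOut true)
          (.seq P₁ (.seq (clear b) (addTo (b + 1) b)))
          (.ite (.simOut false) (.seq P₂ (.seq (clear b) (addTo (b + 1) b))) .skip))
        (.act .simStep))) (x c) (x cend) := by
    intro c hc
    induction hc using Relation.ReflTransGen.head_induction_on with
    | refl =>
      intro hc
      refine .loopF ?_ (hI' hc)
      simp only [rtst, not_not]
      have : simNext (x cend) = none := by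
        have h2 := hhalt
        simp only [Machine.next, Option.map_eq_none_iff] at h2
        simpa only [simNext, x, RState.set, hword] using h2
      exact this
    | @head c c' hstep _ ih =>
      intro hc
      have hc' : StateTransition.Reaches (M.next (numeral k)) M.init c' := hc.tail hstep
      obtain ⟨u, hu, hu'⟩ := Option.map_eq_some_iff.1 hstep
      have hn : simNext (x c) = some u := by
        simpa only [simNext, x, RState.set, hword] using hu
      have hval : c'.output = c.output ++ u.2.2.2.toList := by rw [← hu']
      -- The register is updated before the step is made.
      have hreg : RRun v ((B + 2) ^ d) Lw Ls (.ite (.simOut true)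
          (.seq P₁ (.seq (clear b) (addTo (b + 1) b)))
          (.ite (.simOut false) (.seq P₂ (.seq (clear b) (addTo (b + 1) b))) .skip)) (x c)
          ((x c).set b (min (bitsVal c'.output) K)) := by
        rcases ho : u.2.2.2 with _ | _ | _
        · rw [ho, Option.toList_none, List.append_nil] at hval
          rw [hval, hself]
          refine .iteF ?_ (.iteF ?_ (.skip (hI' hc)))
          · rintro ⟨u', h1, h2⟩
            rw [hn] at h1; cases h1; rw [ho] at h2; cases h2
          · rintro ⟨u', h1, h2⟩
            rw [hn] at h1; cases h1; rw [ho] at h2; cases h2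
        · rw [ho, Option.toList_some] at hval
          rw [hval, bitsVal_append_singleton]
          refine .iteF ?_ (.iteT ⟨u, hn, ho⟩ ?_)
          · rintro ⟨u', h1, h2⟩
            rw [hn] at h1; cases h1; rw [ho] at h2; cases h2
          · convert hupd P₂ (fun K n => min (2 * n) K) c₂ (by omega)
              (fun n => min_le_right _ _) hP₂ hc using 2
            simp only [Bool.toNat_false]; omega
        · rw [ho, Option.toList_some] at hval
          rw [hval, bitsVal_append_singleton]
          refine .iteT ⟨u, hn, ho⟩ ?_
          convert hupd P₁ (fun K n => min (2 * n + 1) K) c₁ (by omega)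
            (fun n => min_le_right _ _) hP₁ hc using 2
          simp only [Bool.toNat_true]; omega
      refine .loopT (by simp [rtst, hn]) (.seq hreg (.act ⟨c', ?_, ?_⟩ hreg.inv_right (hI' hc')))
        (ih hc')
      · simpa only [x, RState.set, hword] using Option.mem_def.1 hstep
      · refine RState.ext (funext fun r => ?_) rfl rfl rfl rfl
        simp only [x, RState.set_regs]
        split_ifs <;> rfl
  refine ⟨cend, ?_⟩
  have := main hreach .refl
  have h1 : x M.init = s := by
    refine RState.ext (funext fun r => ?_) rfl rfl rfl hcfg.symm
    simp only [x, RState.set_regs]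
    split_ifs with hr
    · subst hr; simp [Machine.init, bitsVal, h0]
    · rfl
  rw [h1] at this
  have h2 : bitsVal cend.output = f k := by rw [hout, bitsVal_numeral]
  simpa only [x, h2] using this

/-- The function `f` capped at the global parameter. -/
def cap (f : ℕ → ℕ) (K k : ℕ) : ℕ := if k ≤ K then min (f k) K else K

theorem cap_le (f : ℕ → ℕ) (K k : ℕ) : cap f K k ≤ K := by
  unfold cap; split_ifs <;> omega

/-- The function `f`, capped at the global parameter, is computed by calling the simulated
machine. -/
theorem LS.cap_call {a : ℕ → (ℕ → ℕ) → ℕ} (ha : LS M f True a) :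
    LS M f True fun K σ => cap f K (a K σ) := by
  obtain ⟨w₁, c₁, hb₁, h₁⟩ := ha
  obtain ⟨w₂, c₂, hb₂, h₂⟩ := LS.le (M := M) (f := f) (q := True) (LS.var 0) LS.param
  obtain ⟨d₁, hd₁⟩ := exists_feed M
  obtain ⟨d₂, hd₂⟩ := exists_sim M
  set c := (c₁ + 2) * (c₁ + c₂ + d₁ + d₂ + 1) with hc
  refine ⟨w₁, c, ⟨fun K σ τ h => by rw [hb₁.congr K σ τ h], fun K σ B hK _ =>
    (cap_le _ _ _).trans (hK.trans ?_)⟩, fun ρ b hb hρ => ?_⟩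
  · have : c ≠ 0 := by positivity
    exact (Nat.le_add_right B 2).trans (Nat.le_self_pow this _)
  obtain ⟨P₁, hP₁⟩ := h₁ ρ b hb hρ
  obtain ⟨P₂, hP₂⟩ := h₂ (fun i => if i = 0 then b else 0) (b + 1) (by omega)
    (fun i _ => by split_ifs <;> omega)
  obtain ⟨P₃, hP₃⟩ := hd₁ b hb
  obtain ⟨P₄, hP₄⟩ := hd₂ b hb
  -- The machine is only called for arguments `k ≤ K`, where `Adequate` bounds its space.
  refine ⟨.seq P₁ (.seq P₂ (.ite (.reg (b + 1))
    (.seq (clear (b + 1)) (.seq P₃ (.seq (clear b) (.seq P₄ (.act .reset)))))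
    (.seq (clear b) (copyTo 0 b (b + 1))))), ?_⟩
  intro v K Lw Ls s B hq hK h0 hB hs
  obtain ⟨hA, hword, hcfg⟩ := hq trivial
  set k := a K fun i => s.regs (ρ i) with hk
  have hKB : K ≤ B := hK ▸ hB 0
  set B₁ := (B + 2) ^ (c₁ + 1) with hB₁
  have hBB : B + 2 ≤ B₁ := Nat.le_self_pow (by omega) _
  have hcl : ∀ d, d ≤ c₁ + c₂ + d₁ + d₂ → (B₁ + 2) ^ d ≤ (B + 2) ^ c := fun d hd =>
    pow_add_two_pow_le (by omega) (by rw [hc]; exact Nat.mul_le_mul_left _ (by omega))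
  have hB1c : B₁ ≤ (B + 2) ^ c := Nat.pow_le_pow_right (by omega) (by rw [hc]; nlinarith)
  have hs₀ : RInv B₁ Lw Ls s := ⟨fun r => (hB r).trans (by omega), hs⟩
  have hkB : k ≤ B₁ := (hb₁.le K _ B hKB fun i _ => hB _).trans
    (Nat.pow_le_pow_right (by omega) (by omega))
  have hk0 : ∀ n r, b < r → (s.set b n).regs r = 0 := fun n r hr => by
    rw [RState.set_regs_of_ne _ _ (by omega)]; exact h0 r (by omega)
  have hK0 : ∀ n, (s.set b n).regs 0 = K := fun n => by
    rw [RState.set_regs_of_ne _ _ hb.ne]; exact hK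
  have r₁ := (hP₁ v K Lw Ls s B (fun _ => ⟨hA, hword, hcfg⟩) hK h0 hB hs).mono_bound
    (D' := (B + 2) ^ c) (Nat.pow_le_pow_right (by omega) (by rw [hc]; nlinarith))
  have hs₁ : RInv B₁ Lw Ls (s.set b k) := hs₀.set hkB b
  have hs₁c : RInv ((B + 2) ^ c) Lw Ls (s.set b k) :=
    ⟨fun r => (hs₁.regs_le r).trans hB1c, hs₁.sim⟩
  have r₂ := (hP₂ v K Lw Ls (s.set b k) B₁ (fun _ => ⟨hA, hword, hcfg⟩) (hK0 k)
    (fun r hr => hk0 k r (by omega)) hs₁.regs_le hs₁.sim).mono_bound (hcl c₂ (by omega))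
  simp only [if_true, RState.set_regs_self] at r₂
  refine .seq r₁ (.seq r₂ ?_)
  change Run _ _ _ _ _ (s.set b (cap f K k))
  by_cases hkK : k ≤ K
  · rw [if_pos hkK] at r₂ ⊢
    rw [show cap f K k = min (f k) K from if_pos hkK]
    refine .iteT (by simp [rtst, RState.set_regs_self]) ?_
    have r₃ := run_clear (v := v) r₂.inv_right (b + 1)
    rw [RState.set_set, RState.set_eq_self _ (hk0 k (b + 1) (by omega))] at r₃
    have r₄ := (hP₃ v Lw Ls (s.set b k) B₁ (hk0 k) hs₁.regs_le hs₁.sim hword hcfg (by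
      rw [RState.set_regs_self]; exact hA.length_le k hkK)).mono_bound (hcl d₁ (by omega))
    rw [RState.set_regs_self] at r₄
    have r₅ := run_clear (v := v) r₄.inv_right b
    have e₅ : ({ s.set b k with word := numeral k } : RState M).set b 0 =
        { s with word := numeral k } := by
      refine RState.ext (funext fun r => ?_) rfl rfl rfl rfl
      simp only [RState.set_regs]
      split_ifs with hr
      · subst hr; exact (h0 r le_rfl).symm
      · rfl
    rw [e₅] at r₅
    obtain ⟨cend, r₆⟩ := hP₄ f v K Lw Ls { s with word := numeral k } B₁ k hA hkK hK h0
      hs₀.regs_le rfl hcfg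
    have r₆' := r₆.mono_bound (hcl d₂ (by omega))
    refine .seq r₃ (.seq r₄ (.seq r₅ (.seq r₆' (.act ?_ r₆'.inv_right ?_))))
    · simp only [rstp, RState.set]
      rw [← hword, ← hcfg]
    · have := hs₀.set (n := min (f k) K) (by omega) b
      exact ⟨fun r => (this.regs_le r).trans hB1c, this.sim⟩
  · rw [if_neg hkK] at r₂ ⊢
    rw [show cap f K k = K from if_neg hkK]
    rw [RState.set_eq_self _ (hk0 k (b + 1) (by omega))] at r₂ ⊢
    refine .iteF (by simp [rtst, hk0 k (b + 1)]) ?_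
    have r₃ := run_clear (v := v) hs₁c b
    rw [RState.set_set] at r₃
    have r₄ := run_copyTo (v := v) r₃.inv_right (r := 0) (q := b) (t := b + 1) (by omega)
      (by omega) (by omega) (RState.set_regs_self _ _ _) (hk0 0 _ (by omega))
    rw [hK0, RState.set_set] at r₄
    exact .seq r₃ r₄

/-! ### Rational approximations with squarefree denominators -/

/-- The number of candidates `20, 21, …` among which the prime moduli are chosen. -/
def cand (K : ℕ) : ℕ := (K + 32) ^ 4

/-- The number of primes in `[20, j + 20)`. -/
def rank (j : ℕ) : ℕ := ∑ i ∈ Finset.range j, if (i + 20).Prime then 1 else 0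

theorem rank_eq_count (j : ℕ) : rank j = Nat.count (fun i => (i + 20).Prime) j := by
  rw [Nat.count_eq_card_filter_range, rank, Finset.sum_boole, Nat.cast_id]

/-- The elementary inequality behind `le_rank_cand`, with `L` for `log m`. -/
theorem sq_add_le_of_mul_ge {m L x : ℝ} (hm : 32 ≤ m) (hL : 0 < L) (hLm : L ≤ m)
    (h : m ^ 4 * 0.69 - (4 * L + 1) ≤ x * (4 * L)) : 4 * m ^ 2 + 8 ≤ x := by
  by_contra! hx
  have h1 : x * (4 * L) ≤ (4 * m ^ 2 + 8) * (4 * L) :=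
    mul_le_mul_of_nonneg_right hx.le (by linarith)
  have h2 : (4 * m ^ 2 + 8) * (4 * L) ≤ (4 * m ^ 2 + 8) * (4 * m) :=
    mul_le_mul_of_nonneg_left (by linarith) (by positivity)
  have h3 : 32 * m ^ 3 ≤ m ^ 4 := by
    rw [pow_succ' m 3]; exact mul_le_mul_of_nonneg_right hm (by positivity)
  have h4 : 32 * m ^ 2 ≤ m ^ 3 := by
    rw [pow_succ' m 2]; exact mul_le_mul_of_nonneg_right hm (by positivity)
  have h5 : 32 * m ≤ m ^ 2 := by
    rw [pow_two]; exact mul_le_mul_of_nonneg_right hm (by linarith)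
  have h6 : (4 * m ^ 2 + 8) * (4 * m) = 16 * m ^ 3 + 32 * m := by ring
  linarith

/-- There are enough primes for `K` groups of `4 * K` primes. -/
theorem le_rank_cand (K : ℕ) : 4 * K ^ 2 ≤ rank (cand K) := by
  -- There are eight primes below `20`.
  have h1 : Nat.count Nat.Prime (20 + cand K) = 8 + rank (cand K) := by
    rw [Nat.count_add, rank_eq_count]
    congr 1
    simp only [add_comm 20]
  have h2 : Nat.primeCounting (cand K) ≤ Nat.count Nat.Prime (20 + cand K) :=
    Nat.count_monotone _ (by omega)
  have h3 := Chebyshev.pi_ge (cand K)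
  have hm : (32 : ℝ) ≤ (K : ℝ) + 32 := by
    have : (0 : ℝ) ≤ K := K.cast_nonneg
    linarith
  have hcast : ((cand K : ℕ) : ℝ) = ((K : ℝ) + 32) ^ 4 := by simp [cand]
  rw [hcast] at h3
  have h5 : (4 * ((K : ℝ) + 32) ^ 2 + 8 : ℝ) ≤ (Nat.primeCounting (cand K) : ℝ) := by
    generalize (K : ℝ) + 32 = m at hm h3
    have hlogm : Real.log m ≤ m - 1 := Real.log_le_sub_one_of_pos (by linarith)
    have hlogm0 : 0 < Real.log m := Real.log_pos (by linarith)
    have hlog : Real.log (m ^ 4) = 4 * Real.log m := by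
      rw [Real.log_pow]; norm_num
    have hlog1 : Real.log (m ^ 4 + 1) ≤ 4 * Real.log m + 1 := by
      have hm4 : (1 : ℝ) ≤ m ^ 4 := one_le_pow₀ (by linarith)
      calc Real.log (m ^ 4 + 1) ≤ Real.log (2 * m ^ 4) :=
            Real.log_le_log (by positivity) (by linarith)
        _ = Real.log 2 + 4 * Real.log m := by
            rw [Real.log_mul (by norm_num) (by positivity), hlog]
        _ ≤ _ := by linarith [Real.log_two_lt_d9]
    rw [hlog, div_le_iff₀ (by linarith)] at h3
    have h4 : m ^ 4 * 0.69 ≤ m ^ 4 * Real.log 2 :=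
      mul_le_mul_of_nonneg_left (by linarith [Real.log_two_gt_d9]) (by positivity)
    exact sq_add_le_of_mul_ge hm hlogm0 (by linarith) (by linarith)
  have h6 : 4 * (K + 32) ^ 2 + 8 ≤ Nat.primeCounting (cand K) := by exact_mod_cast h5
  have h7 : K ^ 2 ≤ (K + 32) ^ 2 := Nat.pow_le_pow_left (by omega) 2
  omega

/-- The product of the primes of a group, `j + 20` belonging to the group `rank j % K`. -/
def grpProd (K i : ℕ) : ℕ :=
  ∏ j ∈ Finset.range (cand K), if (j + 20).Prime ∧ rank j % K = i then j + 20 else 1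

/-- The product of the residues modulo `10` of the primes of a group. -/
def grpRes (K i : ℕ) : ℕ :=
  ∏ j ∈ Finset.range (cand K), if (j + 20).Prime ∧ rank j % K = i then (j + 20) % 10 else 1

theorem grpRes_modEq (K i : ℕ) : grpRes K i ≡ grpProd K i [MOD 10] := by
  unfold grpRes grpProd
  refine Nat.ModEq.prod fun j _ => ?_
  split_ifs
  · exact Nat.mod_modEq _ _
  · rfl

theorem grpRes_le (K i : ℕ) : grpRes K i ≤ grpProd K i := by
  unfold grpRes grpProd
  refine Finset.prod_le_prod' fun j _ => ?_
  split_ifs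
  · exact Nat.mod_le _ _
  · rfl

/-- Each group contains at least `4 * K` primes, since the ranks of the primes are consecutive. -/
theorem le_card_group {K i : ℕ} (hi : i < K) :
    4 * K ≤ (Finset.filter (fun j => (j + 20).Prime ∧ rank j % K = i)
      (Finset.range (cand K))).card := by
  set p : ℕ → Prop := fun j => (j + 20).Prime with hp
  have hinf : (Set.ofPred p).Infinite := by
    rw [Set.infinite_iff_exists_gt]
    intro a
    obtain ⟨q, hq, hq'⟩ := Nat.exists_infinite_primes (a + 21)
    refine ⟨q - 20, ?_, by omega⟩
    change (q - 20 + 20).Prime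
    rwa [Nat.sub_add_cancel (by omega)]
  rw [← Finset.card_range (4 * K)]
  have hlt : ∀ m < 4 * K, i + K * m < rank (cand K) := fun m hm => by
    have h1 := le_rank_cand K
    have h2 : K * (m + 1) ≤ K * (4 * K) := Nat.mul_le_mul_left _ hm
    nlinarith
  -- The primes of the group `i` are those of rank `i + K * m`.
  refine Finset.card_le_card_of_injOn (fun m => Nat.nth p (i + K * m)) ?_ ?_
  · intro m hm
    rw [Finset.mem_coe, Finset.mem_range] at hm
    rw [Finset.mem_coe, Finset.mem_filter, Finset.mem_range]
    refine ⟨Nat.nth_lt_of_lt_count (by rw [← rank_eq_count]; exact hlt m hm),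
      Nat.nth_mem_of_infinite hinf _, ?_⟩
    rw [rank_eq_count, Nat.count_nth_of_infinite hinf, Nat.add_mul_mod_self_left,
      Nat.mod_eq_of_lt hi]
  · intro m _ n _ h
    have := Nat.nth_injective hinf h
    exact Nat.eq_of_mul_eq_mul_left (by omega) (Nat.add_left_cancel this)

theorem grpProd_pos (K i : ℕ) : 0 < grpProd K i :=
  Finset.prod_pos fun j _ => by split_ifs <;> omega

/-- Each of the at least `4 * K` factors of the quotient is at most `10 / 20`. -/
theorem grpRes_div_le {K i : ℕ} (hi : i < K) :
    (grpRes K i : ℝ) / grpProd K i ≤ (1 / 2) ^ (4 * K) := by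
  have h1 : (grpRes K i : ℝ) / grpProd K i ≤
      ∏ j ∈ Finset.range (cand K), if (j + 20).Prime ∧ rank j % K = i then (1 / 2 : ℝ) else 1 := by
    unfold grpRes grpProd
    rw [Nat.cast_prod, Nat.cast_prod, ← Finset.prod_div_distrib]
    refine Finset.prod_le_prod (fun j _ => by positivity) fun j _ => ?_
    split_ifs
    · have h2 : (j + 20) % 10 < 10 := Nat.mod_lt _ (by norm_num)
      have h3 : (((j + 20) % 10 : ℕ) : ℝ) ≤ 10 := by exact_mod_cast h2.le
      rw [div_le_iff₀ (by positivity)]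
      push_cast at h3 ⊢
      have : (0 : ℝ) ≤ j := j.cast_nonneg
      linarith
    · simp
  refine h1.trans ?_
  rw [← Finset.prod_filter, Finset.prod_const]
  exact pow_le_pow_of_le_one (by norm_num) (by norm_num) (le_card_group hi)

theorem one_sub_sum_le_prod {ι : Type*} (s : Finset ι) (x : ι → ℝ) (h0 : ∀ i ∈ s, 0 ≤ x i)
    (h1 : ∀ i ∈ s, x i ≤ 1) : 1 - ∑ i ∈ s, x i ≤ ∏ i ∈ s, (1 - x i) := by
  classical
  induction s using Finset.induction_on with
  | empty => simp
  | insert a s ha ih =>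
    rw [Finset.sum_insert ha, Finset.prod_insert ha]
    have hi := ih (fun i hi => h0 i (Finset.mem_insert_of_mem hi))
      fun i hi => h1 i (Finset.mem_insert_of_mem hi)
    have h2 := h0 a (Finset.mem_insert_self a s)
    have h3 := h1 a (Finset.mem_insert_self a s)
    have h4 : 0 ≤ ∑ i ∈ s, x i := Finset.sum_nonneg fun i hi =>
      h0 i (Finset.mem_insert_of_mem hi)
    nlinarith

/-- The product of all prime moduli. -/
def modulus (K : ℕ) : ℕ :=
  ∏ j ∈ Finset.range (cand K), if (j + 20).Prime then j + 20 else 1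

theorem modulus_pos (K : ℕ) : 0 < modulus K :=
  Finset.prod_pos fun j _ => by split_ifs <;> omega

theorem prod_grpProd {K : ℕ} (hK : 0 < K) : ∏ i ∈ Finset.range K, grpProd K i = modulus K := by
  unfold grpProd modulus
  rw [Finset.prod_comm]
  refine Finset.prod_congr rfl fun j _ => ?_
  split_ifs with h
  · simp only [h, true_and]
    rw [Finset.prod_ite_eq, if_pos (Finset.mem_range.2 (Nat.mod_lt _ hK))]
  · simp [h]

/-- The product of the prime moduli other than `j + 20`. -/
def cofactor (K j : ℕ) : ℕ :=
  ∏ i ∈ Finset.range (cand K), if (i + 20).Prime ∧ i ≠ j then i + 20 else 1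

theorem mul_cofactor {K j : ℕ} (hj : j < cand K) (hp : (j + 20).Prime) :
    (j + 20) * cofactor K j = modulus K := by
  have h1 : cofactor K j = ∏ i ∈ (Finset.range (cand K)).erase j,
      if (i + 20).Prime then i + 20 else 1 := by
    rw [cofactor, ← Finset.mul_prod_erase _ _ (Finset.mem_range.2 hj), if_neg (by simp), one_mul]
    refine Finset.prod_congr rfl fun i hi => ?_
    simp [Finset.ne_of_mem_erase hi]
  rw [h1, modulus, ← Finset.mul_prod_erase _ _ (Finset.mem_range.2 hj), if_pos hp]

theorem coprime_cofactor {K j : ℕ} (hp : (j + 20).Prime) :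
    Nat.Coprime (j + 20) (cofactor K j) := by
  refine Nat.Coprime.prod_right fun i _ => ?_
  split_ifs with h
  · rw [Nat.coprime_primes hp h.1]; omega
  · exact Nat.coprime_one_right _

theorem dvd_cofactor {K i j : ℕ} (hi : i < cand K) (hp : (i + 20).Prime) (hij : i ≠ j) :
    i + 20 ∣ cofactor K j := by
  have := Finset.dvd_prod_of_mem (fun i => if (i + 20).Prime ∧ i ≠ j then i + 20 else 1)
    (Finset.mem_range.2 hi)
  rwa [if_pos ⟨hp, hij⟩] at this

/-- The solution `c < j + 20` of the linear congruence `c * a ≡ b` modulo `j + 20`. -/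
def solve (j a b : ℕ) : ℕ :=
  ∑ c ∈ Finset.range (j + 20), if c * a % (j + 20) = b % (j + 20) then c else 0

theorem solve_modEq {j a : ℕ} (b : ℕ) (h : Nat.Coprime (j + 20) a) :
    solve j a b * a ≡ b [MOD j + 20] ∧ solve j a b < j + 20 := by
  obtain ⟨c, hc⟩ : ∃ c, c * a ≡ b [MOD j + 20] := by
    obtain ⟨m, -, hm⟩ := Nat.exists_mul_mod_eq_one_of_coprime h.symm (by omega)
    refine ⟨m * b, ?_⟩
    have h1 : a * m ≡ 1 [MOD j + 20] := by
      rw [Nat.ModEq, hm, Nat.mod_eq_of_lt (by omega : 1 < j + 20)]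
    calc m * b * a = a * m * b := by ring
      _ ≡ 1 * b [MOD j + 20] := h1.mul_right b
      _ = b := one_mul b
  have hlt : c % (j + 20) < j + 20 := Nat.mod_lt _ (by omega)
  have hc' : c % (j + 20) * a ≡ b [MOD j + 20] := ((Nat.mod_modEq c _).mul_right a).trans hc
  have hs : solve j a b = c % (j + 20) := by
    unfold solve
    rw [Finset.sum_eq_single (c % (j + 20)), if_pos (show _ % _ = _ % _ from hc')]
    · intro x hx hne
      rw [Finset.mem_range] at hx
      rw [if_neg]
      intro hx'
      have h2 : x * a ≡ c % (j + 20) * a [MOD j + 20] := Nat.ModEq.trans hx' hc'.symm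
      have h3 := Nat.ModEq.cancel_right_of_coprime h h2
      exact hne (by rwa [Nat.ModEq, Nat.mod_mod, Nat.mod_eq_of_lt hx] at h3)
    · intro h; exact absurd (Finset.mem_range.2 hlt) h
  rw [hs]
  exact ⟨hc', hlt⟩

section

variable (K A : ℕ)

/-- Both sides of the congruence that determines the residue of the approximation. -/
def target : ℕ := A * ∏ i ∈ Finset.range K, (grpProd K i - grpRes K i)

/-- The numerator of the partial fraction with denominator `j + 20`. -/
def coef (j : ℕ) : ℕ := solve j (2 * 10 ^ K * cofactor K j) (target K A)

/-- The number of binary digits that are computed. -/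
def len : ℕ := cand K + 3 * K

/-- The sum of the rounded partial fractions, scaled by `2 ^ len K`. -/
def total : ℕ := cand K +
  ∑ j ∈ Finset.range (cand K), if (j + 20).Prime then 2 ^ len K * coef K A j / (j + 20) else 0

variable {K A}

theorem coef_spec {j : ℕ} (hp : (j + 20).Prime) :
    coef K A j * (2 * 10 ^ K * cofactor K j) ≡ target K A [MOD j + 20] ∧
      coef K A j < j + 20 := by
  refine solve_modEq _ ?_
  have h2 : Nat.Coprime (j + 20) 2 := by
    rw [Nat.coprime_primes hp Nat.prime_two]; omega
  have h5 : Nat.Coprime (j + 20) 5 := by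
    rw [Nat.coprime_primes hp Nat.prime_five]; omega
  have h10 : Nat.Coprime (j + 20) 10 := Nat.Coprime.mul_right h2 h5
  exact ((h2.mul_right (h10.pow_right K))).mul_right (coprime_cofactor hp)

theorem dvd_target (hA : 2 ∣ A) : 2 * 10 ^ K ∣ target K A := by
  refine Nat.mul_dvd_mul hA ?_
  calc 10 ^ K = ∏ i ∈ Finset.range K, 10 := by simp
    _ ∣ _ := Finset.prod_dvd_prod_of_dvd _ _ fun i _ =>
      (Nat.modEq_iff_dvd' (grpRes_le K i)).1 (grpRes_modEq K i)

/-- The Chinese remainder theorem: the partial fractions add up to the approximation. -/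
theorem sum_coef_modEq {N : ℕ} (hN : target K A = 2 * 10 ^ K * N) :
    (∑ j ∈ Finset.range (cand K), if (j + 20).Prime then coef K A j * cofactor K j else 0) ≡ N
      [MOD modulus K] := by
  set S := ∑ j ∈ Finset.range (cand K), if (j + 20).Prime then coef K A j * cofactor K j else 0
    with hS
  have key : ∀ j < cand K, (j + 20).Prime → S ≡ N [MOD j + 20] := by
    intro j hj hp
    have h1 : S ≡ coef K A j * cofactor K j [MOD j + 20] := by
      rw [hS, ← Finset.add_sum_erase _ _ (Finset.mem_range.2 hj), if_pos hp]
      have : (∑ i ∈ (Finset.range (cand K)).erase j,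
          if (i + 20).Prime then coef K A i * cofactor K i else 0) ≡ 0 [MOD j + 20] := by
        rw [Nat.modEq_zero_iff_dvd]
        refine Finset.dvd_sum fun i hi => ?_
        split_ifs
        · exact (dvd_cofactor hj hp (Finset.ne_of_mem_erase hi).symm).mul_left _
        · exact dvd_zero _
      simpa using this.add_left (coef K A j * cofactor K j)
    have h2 := (coef_spec (K := K) (A := A) hp).1
    have hc : Nat.Coprime (j + 20) (2 * 10 ^ K) := by
      have h2 : Nat.Coprime (j + 20) 2 := by
        rw [Nat.coprime_primes hp Nat.prime_two]; omega
      have h5 : Nat.Coprime (j + 20) 5 := by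
        rw [Nat.coprime_primes hp Nat.prime_five]; omega
      exact h2.mul_right ((Nat.Coprime.mul_right h2 h5).pow_right K)
    refine h1.trans (Nat.ModEq.cancel_left_of_coprime hc ?_)
    rw [← hN]
    convert h2 using 1
    ring
  rw [Nat.modEq_iff_dvd]
  unfold modulus
  rw [Nat.cast_prod]
  refine Finset.prod_dvd_of_coprime ?_ fun j hj => ?_
  · intro i _ j _ hij
    simp only [Function.onFun]
    rw [← Nat.isCoprime_iff_coprime.symm.eq]
    split_ifs with h1 h2
    · rw [Nat.coprime_primes h1 h2]; omega
    all_goals simp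
  · split_ifs with h
    · exact (Nat.modEq_iff_dvd).1 (key j (Finset.mem_range.1 hj) h)
    · simp

end

/-! #### Error bounds -/

-- Unfolding the power `(K + 32) ^ 4` slows down unification.
attribute [local irreducible] cand

/-- The numerator of the sum of the terms of `mu f` that exceed `1 / 10 ^ K`, over the denominator
`10 ^ K`. -/
def numer (f : ℕ → ℕ) (K : ℕ) : ℕ :=
  ∑ k ∈ Finset.range K, if cap f K (k + 1) < K then 10 ^ (K - cap f K (k + 1)) else 0

theorem two_dvd_numer (f : ℕ → ℕ) (K : ℕ) : 2 ∣ numer f K := by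
  refine Finset.dvd_sum fun k _ => ?_
  split_ifs with h
  · exact dvd_pow (by norm_num) (by omega)
  · exact dvd_zero _

theorem numer_div (f : ℕ → ℕ) (K : ℕ) :
    (numer f K : ℝ) / 10 ^ K =
      ∑ k ∈ Finset.range K, if f (k + 1) < K then 1 / (10 : ℝ) ^ f (k + 1) else 0 := by
  rw [numer, Nat.cast_sum, Finset.sum_div]
  refine Finset.sum_congr rfl fun k hk => ?_
  have hk' : k + 1 ≤ K := Finset.mem_range.1 hk
  rw [cap, if_pos hk']
  by_cases h : f (k + 1) < K
  · rw [if_pos (by omega), if_pos h, min_eq_left h.le, div_eq_div_iff (by positivity)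
      (by positivity), one_mul]
    push_cast
    rw [← pow_add, Nat.sub_add_cancel h.le]
  · rw [if_neg (by omega), if_neg h]; simp

theorem le_apply_succ {f : ℕ → ℕ} (hf : StrictMonoOn f (Set.Ici 1)) (k : ℕ) : k ≤ f (k + 1) := by
  have hg : StrictMono fun k => f (k + 1) := fun a b hab =>
    hf (by simp) (by simp) (by omega)
  exact hg.le_apply

theorem one_div_pow_le_one_div_pow {a b : ℕ} (h : a ≤ b) :
    1 / (10 : ℝ) ^ b ≤ 1 / 10 ^ a :=
  one_div_le_one_div_of_le (by positivity) (pow_le_pow_right₀ (by norm_num) h)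

theorem hasSum_tail (K : ℕ) :
    HasSum (fun k : ℕ => 1 / (10 : ℝ) ^ (k + K)) (10 / 9 * (1 / 10 ^ K)) := by
  have h : HasSum (fun k : ℕ => (1 / 10 : ℝ) ^ k) (1 - 1 / 10)⁻¹ :=
    hasSum_geometric_of_lt_one (by norm_num) (by norm_num)
  have h' := h.mul_right (1 / 10 ^ K : ℝ)
  rw [show (1 - 1 / 10 : ℝ)⁻¹ = 10 / 9 by norm_num] at h'
  have h'' : (fun k : ℕ => 1 / (10 : ℝ) ^ (k + K)) = fun k => (1 / 10) ^ k * (1 / 10 ^ K) :=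
    funext fun k => by rw [pow_add, one_div_pow, one_div_mul_one_div]
  rw [h'']
  exact h'

theorem numer_div_le_mu {f : ℕ → ℕ} (hf : StrictMonoOn f (Set.Ici 1)) (K : ℕ) :
    (numer f K : ℝ) / 10 ^ K ≤ mu f := by
  rw [numer_div]
  refine le_trans (Finset.sum_le_sum fun k _ => ?_)
    ((summable_mu hf).sum_le_tsum (Finset.range K) fun k _ => by positivity)
  split_ifs
  · exact le_rfl
  · positivity

theorem mu_le {f : ℕ → ℕ} (hf : StrictMonoOn f (Set.Ici 1)) : mu f ≤ 10 / 9 := by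
  have h := hasSum_tail 0
  simp only [add_zero, pow_zero, div_one, mul_one] at h
  rw [← h.tsum_eq]
  exact (summable_mu hf).tsum_le_tsum (fun k => one_div_pow_le_one_div_pow (le_apply_succ hf k))
    h.summable

theorem mu_le_numer_div_add {f : ℕ → ℕ} (hf : StrictMonoOn f (Set.Ici 1)) (K : ℕ) :
    mu f ≤ (numer f K : ℝ) / 10 ^ K + (K + 10 / 9) * (1 / 10 ^ K) := by
  rw [mu, ← (summable_mu hf).sum_add_tsum_nat_add K, numer_div]
  have h1 : ∑ k ∈ Finset.range K, 1 / (10 : ℝ) ^ f (k + 1) ≤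
      ∑ k ∈ Finset.range K, ((if f (k + 1) < K then 1 / (10 : ℝ) ^ f (k + 1) else 0) +
        1 / 10 ^ K) := by
    refine Finset.sum_le_sum fun k _ => ?_
    split_ifs with h
    · have : (0 : ℝ) ≤ 1 / 10 ^ K := by positivity
      linarith
    · rw [zero_add]; exact one_div_pow_le_one_div_pow (not_lt.1 h)
  rw [Finset.sum_add_distrib, Finset.sum_const, Finset.card_range, nsmul_eq_mul] at h1
  have h2 : ∑' k : ℕ, 1 / (10 : ℝ) ^ f (k + K + 1) ≤ 10 / 9 * (1 / 10 ^ K) := by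
    rw [← (hasSum_tail K).tsum_eq]
    exact ((summable_nat_add_iff K).2 (summable_mu hf)).tsum_le_tsum
      (fun k => one_div_pow_le_one_div_pow (le_apply_succ hf _)) (hasSum_tail K).summable
  linarith

/-- The exact value of the rational approximation with squarefree denominator. -/
theorem target_div {K A N : ℕ} (hK : 0 < K) (hN : target K A = 2 * 10 ^ K * N) :
    (N : ℝ) / modulus K = (A : ℝ) / 10 ^ K / 2 *
      ∏ i ∈ Finset.range K, (1 - (grpRes K i : ℝ) / grpProd K i) := by
  have h1 : ∏ i ∈ Finset.range K, (1 - (grpRes K i : ℝ) / grpProd K i) =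
      (∏ i ∈ Finset.range K, ((grpProd K i - grpRes K i : ℕ) : ℝ)) / modulus K := by
    rw [← prod_grpProd hK, Nat.cast_prod, ← Finset.prod_div_distrib]
    refine Finset.prod_congr rfl fun i _ => ?_
    have := grpProd_pos K i
    rw [Nat.cast_sub (grpRes_le K i), sub_div, div_self (by positivity)]
  have h2 : (A : ℝ) * ∏ i ∈ Finset.range K, ((grpProd K i - grpRes K i : ℕ) : ℝ) =
      2 * 10 ^ K * N := by
    rw [← Nat.cast_prod, ← Nat.cast_mul]
    exact_mod_cast hN
  have := modulus_pos K
  rw [h1]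
  field_simp
  linarith

theorem target_div_le {K A N : ℕ} (hK : 0 < K) (hN : target K A = 2 * 10 ^ K * N) :
    (N : ℝ) / modulus K ≤ (A : ℝ) / 10 ^ K / 2 := by
  rw [target_div hK hN]
  refine mul_le_of_le_one_right (by positivity) (Finset.prod_le_one (fun i _ => ?_) fun i _ => ?_)
  · rw [sub_nonneg]
    exact div_le_one_of_le₀ (by exact_mod_cast grpRes_le K i) (by positivity)
  · have : (0 : ℝ) ≤ (grpRes K i : ℝ) / grpProd K i := by positivity
    linarith

theorem le_target_div {K A N : ℕ} (hK : 0 < K) (hN : target K A = 2 * 10 ^ K * N) :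
    (A : ℝ) / 10 ^ K / 2 * (1 - K * (1 / 2) ^ (4 * K)) ≤ (N : ℝ) / modulus K := by
  rw [target_div hK hN]
  refine mul_le_mul_of_nonneg_left (le_trans ?_ (one_sub_sum_le_prod _ _ (fun i _ => by positivity)
    fun i _ => div_le_one_of_le₀ (by exact_mod_cast grpRes_le K i) (by positivity)))
    (by positivity)
  have : ∑ i ∈ Finset.range K, (grpRes K i : ℝ) / grpProd K i ≤
      ∑ i ∈ Finset.range K, (1 / 2 : ℝ) ^ (4 * K) :=
    Finset.sum_le_sum fun i hi => grpRes_div_le (Finset.mem_range.1 hi)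
  rw [Finset.sum_const, Finset.card_range, nsmul_eq_mul] at this
  linarith

/-- The rounding error in the sum of the partial fractions, and the constant that is added to
make it nonnegative. -/
theorem total_bounds (K A : ℕ) :
    (2 : ℝ) ^ len K * ((∑ j ∈ Finset.range (cand K),
      if (j + 20).Prime then coef K A j * cofactor K j else 0 : ℕ) / modulus K) ≤ total K A ∧
    (total K A : ℝ) ≤ 2 ^ len K * ((∑ j ∈ Finset.range (cand K),
      if (j + 20).Prime then coef K A j * cofactor K j else 0 : ℕ) / modulus K) + cand K := by
  have hterm : ∀ j ∈ Finset.range (cand K),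
      (2 : ℝ) ^ len K * (((if (j + 20).Prime then coef K A j * cofactor K j else 0 : ℕ) : ℝ) /
        modulus K) - 1 ≤
        ((if (j + 20).Prime then 2 ^ len K * coef K A j / (j + 20) else 0 : ℕ) : ℝ) ∧
      ((if (j + 20).Prime then 2 ^ len K * coef K A j / (j + 20) else 0 : ℕ) : ℝ) ≤
      (2 : ℝ) ^ len K * (((if (j + 20).Prime then coef K A j * cofactor K j else 0 : ℕ) : ℝ) /
        modulus K) := by
    intro j hj
    by_cases hp : (j + 20).Prime
    · rw [if_pos hp, if_pos hp]
      have hc := mul_cofactor (Finset.mem_range.1 hj) hp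
      have hm := modulus_pos K
      have hc0 : 0 < cofactor K j := Nat.pos_of_mul_pos_left (hc ▸ hm)
      have h1 : (2 : ℝ) ^ len K * (((coef K A j * cofactor K j : ℕ) : ℝ) / modulus K) =
          ((2 ^ len K * coef K A j : ℕ) : ℝ) / ((j + 20 : ℕ) : ℝ) := by
        rw [← hc]
        push_cast
        field_simp
      rw [h1]
      refine ⟨?_, Nat.cast_div_le⟩
      have h2 := Nat.lt_div_mul_add (a := 2 ^ len K * coef K A j) (show 0 < j + 20 by omega)
      have h3 : ((2 ^ len K * coef K A j : ℕ) : ℝ) ≤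
          (((2 ^ len K * coef K A j / (j + 20) : ℕ) : ℝ) + 1) * ((j + 20 : ℕ) : ℝ) := by
        rw [add_mul, one_mul]; exact_mod_cast h2.le
      rw [sub_le_iff_le_add, div_le_iff₀ (by positivity)]
      exact h3
    · simp [hp]
  rw [total]
  simp only [Nat.cast_add, Nat.cast_sum] at hterm ⊢
  rw [Finset.sum_div, Finset.mul_sum]
  have h1 := Finset.sum_le_sum fun j hj => (hterm j hj).1
  have h2 := Finset.sum_le_sum fun j hj => (hterm j hj).2
  rw [Finset.sum_sub_distrib, Finset.sum_const, Finset.card_range, nsmul_eq_mul, mul_one] at h1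
  constructor <;> linarith

/-- The rounding error is small because `len K` exceeds `3 * K` by `cand K`. -/
theorem cand_div_le (K : ℕ) : (cand K : ℝ) / 2 ^ len K ≤ 1 / 8 ^ K := by
  have h : (cand K : ℝ) ≤ 2 ^ cand K := by exact_mod_cast Nat.lt_two_pow_self.le
  rw [len, pow_add, pow_mul, div_le_div_iff₀ (by positivity) (by positivity), one_mul,
    show (2 : ℝ) ^ 3 = 8 by norm_num]
  exact mul_le_mul_of_nonneg_right h (by positivity)

/-- Reduction modulo `b` removes the integer part `m` of a number given up to an error `c`, since
`x + ε < 1` excludes an overflow. -/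
theorem mod_bounds {t b : ℕ} {m : ℤ} {x c ε : ℝ} (hb : 0 < b) (h1 : b * (x + m) ≤ t)
    (h2 : t ≤ b * (x + m) + c) (hc : c ≤ ε * b) (hx : 0 ≤ x) (hxε : x + ε < 1) :
    x ≤ ((t % b : ℕ) : ℝ) / b ∧ ((t % b : ℕ) : ℝ) / b ≤ x + ε := by
  have hb' : (0 : ℝ) < b := by exact_mod_cast hb
  have hr : (((t : ℤ) - b * m : ℤ) : ℝ) = t - b * m := by push_cast; rfl
  have hlo : (0 : ℤ) ≤ t - b * m := by
    have : (0 : ℝ) ≤ (((t : ℤ) - b * m : ℤ) : ℝ) := by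
      rw [hr]; nlinarith [mul_nonneg hb'.le hx]
    exact_mod_cast this
  have hhi : (t : ℤ) - b * m < b := by
    have : (((t : ℤ) - b * m : ℤ) : ℝ) < ((b : ℤ) : ℝ) := by
      rw [hr, Int.cast_natCast]
      nlinarith [mul_lt_mul_of_pos_left hxε hb']
    exact_mod_cast this
  have hmod : ((t % b : ℕ) : ℤ) = t - b * m := by
    rw [← Int.emod_eq_of_lt hlo hhi, Int.sub_mul_emod_self_left, Int.natCast_mod]
  have hmod' := congrArg (Int.cast : ℤ → ℝ) hmod
  rw [Int.cast_natCast, hr] at hmod'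
  rw [hmod', le_div_iff₀ hb', div_le_iff₀ hb']
  constructor <;> linarith

theorem total_mod_bounds {K A N : ℕ} (hK : 0 < K) (hN : target K A = 2 * 10 ^ K * N)
    (hle : (N : ℝ) / modulus K ≤ 5 / 9) :
    (N : ℝ) / modulus K ≤ ((total K A % 2 ^ len K : ℕ) : ℝ) / 2 ^ len K ∧
    ((total K A % 2 ^ len K : ℕ) : ℝ) / 2 ^ len K ≤ (N : ℝ) / modulus K + 1 / 8 ^ K := by
  obtain ⟨h1, h2⟩ := total_bounds K A
  obtain ⟨m, hm⟩ := (Nat.modEq_iff_dvd.1 (sum_coef_modEq hN).symm)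
  generalize (∑ j ∈ Finset.range (cand K),
    if (j + 20).Prime then coef K A j * cofactor K j else 0) = S at h1 h2 hm
  have hm' : (S : ℝ) = N + modulus K * m := by
    have : (S : ℤ) = N + modulus K * m := by linarith
    exact_mod_cast this
  have hP : (0 : ℝ) < modulus K := by exact_mod_cast modulus_pos K
  have hS : (S : ℝ) / modulus K = N / modulus K + m := by
    rw [hm']; field_simp
  rw [hS] at h1 h2
  have hc := cand_div_le K
  have h8 : (1 : ℝ) / 8 ^ K ≤ 1 / 8 := by
    refine one_div_le_one_div_of_le (by norm_num) ?_
    calc (8 : ℝ) = 8 ^ 1 := by norm_num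
      _ ≤ 8 ^ K := pow_le_pow_right₀ (by norm_num) hK
  have hT : ((2 ^ len K : ℕ) : ℝ) = 2 ^ len K := by push_cast; rfl
  rw [← hT] at h1 h2 hc ⊢
  rw [div_le_iff₀ (by positivity)] at hc
  exact mod_bounds (by positivity) h1 h2 hc (by positivity) (by linarith)

/-- Bernoulli's inequality for `(10 / 8) ^ K`. -/
theorem cast_div_ten_pow_le (K : ℕ) : (K : ℝ) / 10 ^ K ≤ 4 / 8 ^ K := by
  have h := one_add_mul_le_pow (show (-2 : ℝ) ≤ 1 / 4 by norm_num) K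
  have h2 : (10 : ℝ) ^ K = (1 + 1 / 4) ^ K * 8 ^ K := by rw [← mul_pow]; norm_num
  rw [h2, div_le_div_iff₀ (by positivity) (by positivity), ← mul_assoc]
  refine mul_le_mul_of_nonneg_right ?_ (by positivity)
  linarith

/-- The digits that are printed represent a good approximation of `mu f`. -/
theorem abs_total_mod_sub_mu_le {f : ℕ → ℕ} (hf : StrictMonoOn f (Set.Ici 1)) {K : ℕ}
    (hK : 0 < K) :
    |((total K (numer f K) % 2 ^ len K : ℕ) : ℝ) / 2 ^ (len K - 1) - mu f| ≤ 8 / 8 ^ K := by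
  obtain ⟨N, hN⟩ := dvd_target (K := K) (two_dvd_numer f K)
  have hy := numer_div_le_mu hf K
  have hy' := mu_le_numer_div_add hf K
  have hmu := mu_le hf
  have h1 := target_div_le hK hN
  have h2 := le_target_div hK hN
  obtain ⟨h3, h4⟩ := total_mod_bounds hK hN (by linarith)
  have hlen : len K = len K - 1 + 1 := by rw [len]; omega
  have h5 : ((total K (numer f K) % 2 ^ len K : ℕ) : ℝ) / 2 ^ (len K - 1) =
      2 * (((total K (numer f K) % 2 ^ len K : ℕ) : ℝ) / 2 ^ len K) := by
    generalize ((total K (numer f K) % 2 ^ len K : ℕ) : ℝ) = z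
    rw [hlen, pow_succ, Nat.add_sub_cancel]
    field_simp
  rw [h5]
  have h6 := cast_div_ten_pow_le K
  have h7 : (1 : ℝ) / 10 ^ K ≤ 1 / 8 ^ K :=
    one_div_le_one_div_of_le (by positivity) (pow_le_pow_left₀ (by norm_num) (by norm_num) K)
  have h8 : (K : ℝ) * (1 / 2) ^ (4 * K) ≤ 1 / 8 ^ K := by
    have : (K : ℝ) ≤ 2 ^ K := by exact_mod_cast Nat.lt_two_pow_self.le
    have h9 : (1 / 2 : ℝ) ^ (4 * K) = 1 / (2 ^ K * 8 ^ K) := by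
      rw [pow_mul, ← mul_pow, ← one_div_pow]; norm_num
    rw [h9, mul_one_div, div_le_div_iff₀ (by positivity) (by positivity), one_mul]
    exact mul_le_mul_of_nonneg_right this (by positivity)
  have h0 : (0 : ℝ) ≤ (numer f K : ℝ) / 10 ^ K := by positivity
  have h10 : (numer f K : ℝ) / 10 ^ K * ((K : ℝ) * (1 / 2) ^ (4 * K)) ≤ 10 / 9 * (1 / 8 ^ K) :=
    mul_le_mul (hy.trans hmu) h8 (by positivity) (by norm_num)
  have h11 : (K : ℝ) * (1 / 10 ^ K) = K / 10 ^ K := by rw [mul_one_div]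
  have h12 : (4 : ℝ) / 8 ^ K = 4 * (1 / 8 ^ K) := by ring
  have h13 : (8 : ℝ) / 8 ^ K = 8 * (1 / 8 ^ K) := by ring
  have h14 : (0 : ℝ) < 1 / 8 ^ K := by positivity
  rw [h12] at h6
  rw [h13, abs_le]
  constructor <;> nlinarith

/-! ### Computing the binary digits of the approximation with small numbers -/

section

variable (K A : ℕ)

/-- The bit `s` of the rounded partial fraction `2 ^ len K * coef K A j / (j + 20)`, computed
modulo `j + 20`. -/
def termBit (j s : ℕ) : ℕ :=
  2 * (2 ^ (len K - (s + 1)) % (j + 20) * coef K A j % (j + 20)) / (j + 20)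

/-- The sum of the bits `s` of the rounded partial fractions. -/
def column (s : ℕ) : ℕ :=
  ∑ j ∈ Finset.range (cand K), if (j + 20).Prime then termBit K A j s else 0

/-- The carry into the column `s` when the rounded partial fractions and `cand K` are added. -/
def carry (s : ℕ) : ℕ := Nat.rec (cand K) (fun s a => (a + column K A s) / 2) s

/-- The binary digit `s` of `total K A`. -/
def digit (s : ℕ) : ℕ := (carry K A s + column K A s) % 2

theorem two_mul_mod_div_lt_two {p : ℕ} (hp : 0 < p) (y : ℕ) : 2 * (y % p) / p < 2 := by
  have := Nat.mod_lt y hp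
  rw [Nat.div_lt_iff_lt_mul hp]; omega

theorem two_mul_mod_div {p : ℕ} (hp : 0 < p) (y : ℕ) : 2 * y / p % 2 = 2 * (y % p) / p := by
  have h : 2 * y = 2 * (y % p) + p * (2 * (y / p)) := by
    have := Nat.mod_add_div y p
    nlinarith
  rw [h, Nat.add_mul_div_left _ _ hp, Nat.add_mul_mod_self_left,
    Nat.mod_eq_of_lt (two_mul_mod_div_lt_two hp y)]

theorem termBit_lt_two (j s : ℕ) : termBit K A j s < 2 :=
  two_mul_mod_div_lt_two (by omega) _

theorem column_le (s : ℕ) : column K A s ≤ cand K := by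
  calc column K A s ≤ ∑ j ∈ Finset.range (cand K), 1 := by
        refine Finset.sum_le_sum fun j _ => ?_
        have := termBit_lt_two K A j s
        split_ifs <;> omega
    _ = cand K := by simp

theorem carry_le (s : ℕ) : carry K A s ≤ cand K := by
  induction s with
  | zero => exact le_rfl
  | succ s ih =>
    have : carry K A (s + 1) = (carry K A s + column K A s) / 2 := rfl
    have := column_le K A s
    omega

variable {K A}

theorem termBit_eq {j s : ℕ} (hs : s < len K) :
    termBit K A j s = 2 ^ len K * coef K A j / (j + 20) / 2 ^ s % 2 := by
  have h1 : 2 ^ len K * coef K A j / (j + 20) / 2 ^ s =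
      2 * (2 ^ (len K - (s + 1)) * coef K A j) / (j + 20) := by
    have h2 : 2 ^ len K * coef K A j = 2 * (2 ^ (len K - (s + 1)) * coef K A j) * 2 ^ s := by
      conv_lhs => rw [show len K = len K - (s + 1) + 1 + s by omega]
      ring
    rw [Nat.div_div_eq_div_mul, mul_comm (j + 20), ← Nat.div_div_eq_div_mul, h2,
      Nat.mul_div_cancel _ (by positivity)]
  rw [h1, two_mul_mod_div (by omega), termBit, Nat.mod_mul_mod]

/-- Column addition: dividing by `2 ^ s` leaves the carry and the higher bits of the summands. -/
theorem total_div {s : ℕ} (hs : s ≤ len K) :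
    total K A / 2 ^ s = carry K A s + ∑ j ∈ Finset.range (cand K),
      if (j + 20).Prime then 2 ^ len K * coef K A j / (j + 20) / 2 ^ s else 0 := by
  induction s with
  | zero => simp [total, carry]
  | succ s ih =>
    have h1 : ∑ j ∈ Finset.range (cand K),
        (if (j + 20).Prime then 2 ^ len K * coef K A j / (j + 20) / 2 ^ s else 0) =
        column K A s + 2 * ∑ j ∈ Finset.range (cand K),
        (if (j + 20).Prime then 2 ^ len K * coef K A j / (j + 20) / 2 ^ (s + 1) else 0) := by
      rw [column, Finset.mul_sum, ← Finset.sum_add_distrib]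
      refine Finset.sum_congr rfl fun j _ => ?_
      split_ifs
      · rw [termBit_eq hs, pow_succ, ← Nat.div_div_eq_div_mul, Nat.mod_add_div]
      · rfl
    have h2 : carry K A (s + 1) = (carry K A s + column K A s) / 2 := rfl
    rw [pow_succ, ← Nat.div_div_eq_div_mul, ih (by omega), h1, h2, ← add_assoc,
      Nat.add_mul_div_left _ _ (by norm_num), pow_succ]

theorem digit_eq {s : ℕ} (hs : s < len K) : digit K A s = total K A / 2 ^ s % 2 := by
  have h1 : ∑ j ∈ Finset.range (cand K),
      (if (j + 20).Prime then 2 ^ len K * coef K A j / (j + 20) / 2 ^ s else 0) =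
      column K A s + 2 * ∑ j ∈ Finset.range (cand K),
      (if (j + 20).Prime then 2 ^ len K * coef K A j / (j + 20) / 2 ^ s / 2 else 0) := by
    rw [column, Finset.mul_sum, ← Finset.sum_add_distrib]
    refine Finset.sum_congr rfl fun j _ => ?_
    split_ifs
    · rw [termBit_eq hs, Nat.mod_add_div]
    · rfl
  rw [total_div hs.le, h1, ← add_assoc, Nat.add_mul_mod_self_left, digit]

end

namespace LS

variable {M : Machine Bool Bool} {f : ℕ → ℕ} {q : Prop} {a i : ℕ → (ℕ → ℕ) → ℕ}

theorem cand : LS M f q fun K _ => cand K := by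
  have h : LS M f q fun K _ => K + 32 := LS.param.add (.const 32)
  convert (h.mul h).mul (h.mul h) using 3 with K σ
  unfold RealSpace.cand
  ring

theorem rank (ha : LS M f q a) : LS M f q fun K σ => rank (a K σ) :=
  LS.sum (F := fun _ i _ => if (i + 20).Prime then 1 else 0) ha
    (LS.prime ((LS.var 0).add (.const 20)))

theorem len : LS M f q fun K _ => len K := LS.cand.add ((LS.const 3).mul .param)

/-- The residue of a product of some of the candidates for moduli. -/
theorem prodCandMod {p : ℕ → ℕ → (ℕ → ℕ) → Prop} [∀ K j σ, Decidable (p K j σ)]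
    (hp : LS M f q fun K σ => if p K (σ 0) fun i => σ (i + 1) then 1 else 0)
    {b : ℕ → ℕ} (hb : LS M f q fun _ σ => b (σ 0)) (ha : LS M f q a) :
    LS M f q fun K σ => (∏ j ∈ Finset.range (RealSpace.cand K),
      if (j + 20).Prime ∧ p K j σ then b j else 1) % (a K σ + 20) :=
  prodMod (F := fun K j σ => if (j + 20).Prime ∧ p K j σ then b j else 1) LS.cand
    (LS.ite ((LS.prime ((LS.var 0).add (.const 20))).and hp) hb (.const 1))
    (ha.add (.const 20)) fun K σ => by omega

theorem grpProd_mod (hi : LS M f q i) (ha : LS M f q a) :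
    LS M f q fun K σ => grpProd K (i K σ) % (a K σ + 20) :=
  prodCandMod (p := fun K j σ => RealSpace.rank j % K = i K σ)
    (((LS.rank (LS.var 0)).mod .param).eq hi.lift) ((LS.var 0).add (.const 20)) ha

theorem grpRes_mod (hi : LS M f q i) (ha : LS M f q a) :
    LS M f q fun K σ => grpRes K (i K σ) % (a K σ + 20) :=
  prodCandMod (p := fun K j σ => RealSpace.rank j % K = i K σ)
    (((LS.rank (LS.var 0)).mod .param).eq hi.lift) (((LS.var 0).add (.const 20)).mod (.const 10)) ha

theorem cofactor_mod (ha : LS M f q a) :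
    LS M f q fun K σ => cofactor K (a K σ) % (a K σ + 20) :=
  prodCandMod (p := fun K j σ => j ≠ a K σ)
    (((LS.var 0).eq ha.lift).not) ((LS.var 0).add (.const 20)) ha

/-- The coefficient of the unknown in the linear congruence solved by `coef`. -/
theorem lhs_mod (ha : LS M f q a) :
    LS M f q fun K σ => 2 * 10 ^ K * cofactor K (a K σ) % (a K σ + 20) := by
  convert (((LS.const 2).mul (powMod (.const 10) .param (ha.add (.const 20))
    fun K σ => by omega)).mul (cofactor_mod ha)).mod (ha.add (.const 20)) using 3 with K σ
  simp [Nat.mul_mod]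

theorem numer_mod (hcap : ∀ a, LS M f q a → LS M f q fun K σ => cap f K (a K σ))
    (ha : LS M f q a) : LS M f q fun K σ => numer f K % (a K σ + 20) := by
  have hm := ha.add (.const 20)
  have hc : LS M f q fun K σ => cap f K (σ 0 + 1) := hcap _ (LS.var 0).succ
  convert (LS.sum (F := fun K k σ => if cap f K (k + 1) < K then
    10 ^ (K - cap f K (k + 1)) % (a K σ + 20) else 0) .param
    (LS.ite (hc.lt .param) (powMod (.const 10) (LS.param.sub hc) hm.lift fun K σ => by omega)
    .zero)).mod hm using 3 with K σ
  rw [numer, Finset.sum_nat_mod]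
  congr 1
  refine Finset.sum_congr rfl fun k _ => ?_
  split_ifs
  · rfl
  · exact Nat.zero_mod _

/-- The residue of a difference, computed from the residues of its terms. -/
theorem mod_add_sub_mod_modEq {P R p : ℕ} (h : R ≤ P) (hp : 0 < p) :
    P % p + (p - R % p) ≡ P - R [MOD p] := by
  refine Nat.ModEq.add_right_cancel' R ?_
  rw [Nat.sub_add_cancel h]
  have h1 := Nat.mod_lt R hp
  have h2 : P % p + (p - R % p) + R = P % p + p * (R / p + 1) := by
    have := Nat.mod_add_div R p
    rw [mul_add]
    omega
  rw [h2]
  simp [Nat.ModEq]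

theorem target_mod (hcap : ∀ a, LS M f q a → LS M f q fun K σ => cap f K (a K σ))
    (ha : LS M f q a) : LS M f q fun K σ => target K (numer f K) % (a K σ + 20) := by
  have hm := ha.add (.const 20)
  convert ((numer_mod hcap ha).mul (prodMod
    (F := fun K i σ => grpProd K i % (a K σ + 20) + (a K σ + 20 - grpRes K i % (a K σ + 20)))
    .param ((grpProd_mod (.var 0) ha.lift).add (hm.lift.sub (grpRes_mod (.var 0) ha.lift)))
    hm fun K σ => by omega)).mod hm using 3 with K σ
  have h : ∏ i ∈ Finset.range K, (grpProd K i - grpRes K i) ≡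
      ∏ i ∈ Finset.range K, (grpProd K i % (a K σ + 20) +
        (a K σ + 20 - grpRes K i % (a K σ + 20))) [MOD a K σ + 20] :=
    Nat.ModEq.prod fun i _ => (mod_add_sub_mod_modEq (grpRes_le K i) (by omega)).symm
  rw [target, Nat.mul_mod]
  congr 2

theorem coef (hcap : ∀ a, LS M f q a → LS M f q fun K σ => cap f K (a K σ))
    (ha : LS M f q a) : LS M f q fun K σ => coef K (numer f K) (a K σ) := by
  have hm := ha.add (.const 20)
  convert LS.sum (F := fun K c σ => if c * (2 * 10 ^ K * cofactor K (a K σ) % (a K σ + 20)) %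
    (a K σ + 20) = target K (numer f K) % (a K σ + 20) then c else 0) hm
    (LS.ite ((((LS.var 0).mul (lhs_mod ha.lift)).mod hm.lift).eq (target_mod hcap ha.lift))
      (.var 0) .zero) using 3 with K σ
  rw [RealSpace.coef, solve]
  simp only [Nat.mul_mod_mod]

theorem termBit (hcap : ∀ a, LS M f q a → LS M f q fun K σ => cap f K (a K σ))
    (ha : LS M f q a) (hi : LS M f q i) :
    LS M f q fun K σ => termBit K (numer f K) (a K σ) (i K σ) := by
  have hm := ha.add (.const 20)
  exact ((LS.const 2).mul (((powMod (.const 2) (LS.len.sub hi.succ) hm fun K σ => by omega).mul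
    (LS.coef hcap ha)).mod hm)).div hm

theorem column (hcap : ∀ a, LS M f q a → LS M f q fun K σ => cap f K (a K σ))
    (ha : LS M f q a) : LS M f q fun K σ => column K (numer f K) (a K σ) :=
  LS.sum (F := fun K j σ => if (j + 20).Prime then RealSpace.termBit K (numer f K) j (a K σ) else 0)
    LS.cand (LS.ite (LS.prime ((LS.var 0).add (.const 20))) (LS.termBit hcap (.var 0) ha.lift)
    .zero)

theorem carry (hcap : ∀ a, LS M f q a → LS M f q fun K σ => cap f K (a K σ))
    (ha : LS M f q a) : LS M f q fun K σ => carry K (numer f K) (a K σ) :=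
  LS.recursion (g := fun K s x _ => (x + RealSpace.column K (numer f K) s) / 2) LS.cand
    (((LS.var 0).add (LS.column hcap (.var 1))).div (.const 2)) ha
    (LS.cand (M := M) (f := f) (q := q)).polyBdd
    fun K _ n _ => carry_le K (numer f K) n

theorem digit (hcap : ∀ a, LS M f q a → LS M f q fun K σ => cap f K (a K σ))
    (ha : LS M f q a) : LS M f q fun K σ => digit K (numer f K) (a K σ) :=
  ((LS.carry hcap ha).add (LS.column hcap ha)).mod (.const 2)

end LS

/-! ### The program that prints the digits -/

section

variable {M : Machine Bool Bool} {f : ℕ → ℕ} {q : Prop}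

/-- The states of the program between its parts: the parameter `K` is in the register `0` and a
number `i` in the register `1`, and the simulated machine is in its initial configuration. -/
def RState.main (M : Machine Bool Bool) (K i p : ℕ) (o : List Sym) : RState M where
  regs := push K (push i fun _ => 0)
  inp := p
  out := o
  word := []
  cfg := M.init

theorem RState.main_regs_le {K i p D : ℕ} {o : List Sym} (hK : K ≤ D) (hi : i ≤ D) (r : ℕ) :
    (RState.main M K i p o).regs r ≤ D := by
  rcases r with _ | _ | r
  exacts [hK, hi, Nat.zero_le _]

theorem simInv_main {K i p Lw Ls : ℕ} {o : List Sym} (hLs : 0 < Ls) :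
    SimInv Lw Ls (RState.main M K i p o) :=
  ⟨Nat.zero_le _, le_rfl, fun _ => hLs⟩

theorem RState.main_set_one (K i j p : ℕ) (o : List Sym) :
    (RState.main M K i p o).set 1 j = RState.main M K j p o := by
  refine RState.ext (funext fun r => ?_) rfl rfl rfl rfl
  rw [RState.set_regs]
  rcases r with _ | _ | r <;> simp [RState.main, push]

theorem RState.main_set_zero (K K' i p : ℕ) (o : List Sym) :
    (RState.main M K i p o).set 0 K' = RState.main M K' i p o := by
  refine RState.ext (funext fun r => ?_) rfl rfl rfl rfl
  rw [RState.set_regs]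
  rcases r with _ | _ | r <;> simp [RState.main, push]

/-- The symbol for the binary digit `i` of the number that is printed. -/
def digitSym (f : ℕ → ℕ) (K i : ℕ) : Sym := Sym.digit (decide (digit K (numer f K) i = 1))

/-- Print the digit that the program `P` computes. -/
def printDigit (P : RProg) : RProg :=
  .seq P (.seq (.ite (.reg 2) (.act (.emit (.digit true))) (.act (.emit (.digit false))))
    (clear 2))

theorem run_printDigit {P : RProg} {c : ℕ}
    (hP : Evals M f q (fun K σ => digit K (numer f K) (σ 0)) c (fun _ => 1) 2 P)
    {v : List Unit} {K Lw Ls i p B : ℕ} {o : List Sym} (hq : q → Adequate M f K Lw Ls)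
    (hLs : 0 < Ls) (hK : K ≤ B) (hi : i ≤ B) :
    RRun v ((B + 2) ^ c) Lw Ls (printDigit P) (RState.main M K i p o)
      (RState.main M K i p (o ++ [digitSym f K i])) := by
  have h1 := hP v K Lw Ls (RState.main M K i p o) B (fun h => ⟨hq h, rfl, rfl⟩) rfl
    (fun r hr => by obtain ⟨r, rfl⟩ := Nat.exists_eq_add_of_le' hr; rfl)
    (RState.main_regs_le hK hi) (simInv_main hLs)
  have hd : digit K (numer f K) i < 2 := Nat.mod_lt _ (by norm_num)
  change RRun v _ Lw Ls P _ ((RState.main M K i p o).set 2 (digit K (numer f K) i)) at h1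
  have hI : RInv ((B + 2) ^ c) Lw Ls
      ((RState.main M K i p (o ++ [digitSym f K i])).set 2 (digit K (numer f K) i)) :=
    ⟨h1.inv_right.regs_le, Nat.zero_le _, le_rfl, fun _ => hLs⟩
  have h2 : RRun v ((B + 2) ^ c) Lw Ls
      (.ite (.reg 2) (.act (.emit (.digit true))) (.act (.emit (.digit false))))
      ((RState.main M K i p o).set 2 (digit K (numer f K) i))
      ((RState.main M K i p (o ++ [digitSym f K i])).set 2 (digit K (numer f K) i)) := by
    by_cases hb : digit K (numer f K) i = 1
    · refine .iteT ?_ (.act ?_ h1.inv_right hI)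
      · simp only [rtst, RState.set_regs_self]; omega
      · simp only [rstp, digitSym, hb]; rfl
    · refine .iteF ?_ (.act ?_ h1.inv_right hI)
      · simp only [rtst, RState.set_regs_self]; omega
      · simp only [rstp, digitSym, hb]; rfl
  have h3 := run_clear (v := v) hI 2
  rw [RState.set_set, RState.set_eq_self (RState.main M K i p (o ++ [digitSym f K i]))
    (r := 2) (n := 0) rfl] at h3
  exact .seq h1 (.seq h2 h3)

/-- Copy the length of the input to the register `1`. -/
def readInput : RProg := .loop .input (.seq (.act (.inc 1)) (.act .inRight))

theorem run_readInput {n D Lw Ls : ℕ} (hLs : 0 < Ls) (hD : n ≤ D) :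
    RRun (List.replicate n ()) D Lw Ls readInput (RState.init M)
      (RState.main M 0 n (n + 1) []) := by
  have h0 : RState.init M = RState.main M 0 0 1 [] :=
    RState.ext (funext fun r => by rcases r with _ | _ | r <;> rfl) rfl rfl rfl rfl
  rw [h0]
  refine Run.loop_iterate (fun i => RState.main M 0 i (i + 1) []) n (fun i hi => ?_)
    (fun i hi => ?_) ?_ ⟨RState.main_regs_le (Nat.zero_le _) hD, simInv_main hLs⟩
  · simp [rtst, RState.main, Machine.inputSymbol, hi]
  · have h1 := run_inc (v := List.replicate n ()) (D := D) (Lw := Lw) (Ls := Ls)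
      (s := RState.main M 0 i (i + 1) [])
      ⟨RState.main_regs_le (Nat.zero_le _) (by omega), simInv_main hLs⟩ 1
      (by change i + 1 ≤ D; omega)
    rw [RState.main_set_one] at h1
    refine .seq h1 (.act ?_ h1.inv_right ⟨RState.main_regs_le (Nat.zero_le _) (by omega),
      simInv_main hLs⟩)
    simp only [rstp, RState.main, Machine.moveInput, List.length_replicate]
    rw [min_eq_left (by omega)]
    rfl
  · simp [rtst, RState.main, Machine.inputSymbol]

/-- A single program that prints approximations of all precisions. -/
theorem exists_printing_program
    (hcap : ∀ a, LS M f q a → LS M f q fun K σ => cap f K (a K σ)) :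
    ∃ (P : RProg) (C : ℕ), ∀ n Lw Ls, (q → Adequate M f (n / 3 + 2) Lw Ls) → 0 < Ls →
      ∃ s, RRun (List.replicate n ()) ((n + 4) ^ C) Lw Ls P (RState.init M) s ∧
        s.out = [digitSym f (n / 3 + 2) (len (n / 3 + 2) - 1), Sym.point] ++
          (List.range (len (n / 3 + 2) - 1)).map fun i =>
            digitSym f (n / 3 + 2) (len (n / 3 + 2) - 1 - (i + 1)) := by
  obtain ⟨w₁, c₁, -, h₁⟩ : LS M f False fun _ σ => σ 0 / 3 + 2 :=
    ((LS.var 0).div (.const 3)).add (.const 2)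
  obtain ⟨w₂, c₂, -, h₂⟩ : LS M f False fun K _ => len K - 1 := LS.len.pred
  obtain ⟨w₃, c₃, -, h₃⟩ : LS M f q fun K σ => digit K (numer f K) (σ 0) :=
    LS.digit hcap (.var 0)
  obtain ⟨P₁, hP₁⟩ := h₁ (fun _ => 1) 2 (by norm_num) fun i _ => by norm_num
  obtain ⟨P₂, hP₂⟩ := h₂ (fun _ => 0) 1 (by norm_num) fun i _ => by norm_num
  obtain ⟨P₃, hP₃⟩ := h₃ (fun _ => 1) 2 (by norm_num) fun i _ => by norm_num
  refine ⟨.seq readInput (.seq P₁ (.seq (addTo 2 0) (.seq (clear 1) (.seq P₂ (.seq (printDigit P₃)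
    (.seq (.act (.emit .point))
      (.loop (.reg 1) (.seq (.act (.dec 1)) (printDigit P₃))))))))),
    c₁ + c₂ + 1 + (c₂ + 2) * c₃, fun n Lw Ls hq hLs => ?_⟩
  -- The registers are at most `(n + 2) ^ c₁` while `K` is computed, `(n + 4) ^ c₂` while the number
  -- of digits is computed, and then `((n + 4) ^ (c₂ + 1) + 2) ^ c₃`.
  set C := c₁ + c₂ + 1 + (c₂ + 2) * c₃ with hC
  set K := n / 3 + 2 with hK
  have hDC : ∀ c, c ≤ C → (n + 4) ^ c ≤ (n + 4) ^ C := fun c hc =>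
    Nat.pow_le_pow_right (by omega) hc
  have hD : n + 4 ≤ (n + 4) ^ C := Nat.le_self_pow (by omega) _
  have r₀ := run_readInput (M := M) (Lw := Lw) (D := (n + 4) ^ C) hLs (n := n) (by omega)
  have r₁ := (hP₁ (List.replicate n ()) 0 Lw Ls (RState.main M 0 n (n + 1) []) n False.elim rfl
    (fun r hr => by obtain ⟨r, rfl⟩ := Nat.exists_eq_add_of_le' hr; rfl)
    (RState.main_regs_le (Nat.zero_le _) le_rfl) (simInv_main hLs)).mono_bound
    (show (n + 2) ^ c₁ ≤ (n + 4) ^ C from (Nat.pow_le_pow_left (by omega) _).trans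
      (hDC _ (by omega)))
  change RRun _ _ Lw Ls P₁ _ ((RState.main M 0 n (n + 1) []).set 2 K) at r₁
  have r₂ := run_addTo (v := List.replicate n ()) r₁.inv_right (r := 2) (q := 0) (by norm_num)
    (by change 0 + K ≤ _; omega)
  have e₂ : (((RState.main M 0 n (n + 1) []).set 2 K).set 0
      (((RState.main M 0 n (n + 1) []).set 2 K).regs 0 +
        ((RState.main M 0 n (n + 1) []).set 2 K).regs 2)).set 2 0 =
      RState.main M K n (n + 1) [] := by
    rw [RState.set_comm _ _ _ (by norm_num), RState.set_set,
      RState.set_eq_self (RState.main M 0 n (n + 1) []) (r := 2) (n := 0) rfl,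
      RState.main_set_zero]
    congr 1
    exact Nat.zero_add K
  rw [e₂] at r₂
  have r₃ := run_clear (v := List.replicate n ()) r₂.inv_right 1
  rw [RState.main_set_one] at r₃
  have r₄ := hP₂ (List.replicate n ()) K Lw Ls (RState.main M K 0 (n + 1) []) (n + 2) False.elim rfl
    (fun r hr => by
      obtain ⟨r, rfl⟩ := Nat.exists_eq_add_of_le' hr
      cases r <;> rfl)
    (RState.main_regs_le (by omega) (Nat.zero_le _)) (simInv_main hLs)
  rw [RState.main_set_one] at r₄
  set m := len K - 1 with hm
  have hmB : m ≤ (n + 4) ^ (c₂ + 1) :=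
    (r₄.inv_right.regs_le 1).trans (Nat.pow_le_pow_right (by omega) (by omega))
  replace r₄ := r₄.mono_bound (hDC c₂ (by omega))
  have hKB : K ≤ (n + 4) ^ (c₂ + 1) := (show K ≤ n + 4 by omega).trans
    (Nat.le_self_pow (by omega) _)
  have hdig : ∀ i ≤ m, ∀ o, RRun (List.replicate n ()) ((n + 4) ^ C) Lw Ls (printDigit P₃)
      (RState.main M K i (n + 1) o) (RState.main M K i (n + 1) (o ++ [digitSym f K i])) :=
    fun i hi o => (run_printDigit hP₃ hq hLs hKB (hi.trans hmB)).mono_bound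
      (pow_add_two_pow_le (by omega) (by rw [hC, show c₂ + 1 + 1 = c₂ + 2 from rfl]; omega))
  have r₅ := hdig m le_rfl []
  rw [List.nil_append] at r₅
  have hI : ∀ i ≤ m, ∀ o, RInv ((n + 4) ^ C) Lw Ls (RState.main M K i (n + 1) o) := fun i hi o =>
    ⟨RState.main_regs_le (by omega) (hi.trans (hmB.trans (hDC _ (by omega)))), simInv_main hLs⟩
  have r₇ := Run.loop_iterate (stp := rstp (List.replicate n ()))
    (tst := rtst (List.replicate n ())) (Inv := RInv ((n + 4) ^ C) Lw Ls) (t := .reg 1)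
    (P := .seq (.act (.dec 1)) (printDigit P₃))
    (fun j => RState.main M K (m - j) (n + 1) ([digitSym f K m, Sym.point] ++
      (List.range j).map fun i => digitSym f K (m - (i + 1)))) m (fun j hj => ?_) (fun j hj => ?_)
      ?_ (hI _ (by omega) _)
  · exact ⟨_, .seq r₀ (.seq r₁ (.seq r₂ (.seq r₃ (.seq r₄ (.seq r₅ (.seq
      (.act rfl (hI _ le_rfl _) (hI _ le_rfl _)) r₇)))))), rfl⟩
  · change m - j ≠ 0; omega
  · have d := run_dec (v := List.replicate n ()) (hI (m - j) (by omega)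
      ([digitSym f K m, Sym.point] ++ (List.range j).map fun i => digitSym f K (m - (i + 1)))) 1
      (by change m - j ≠ 0; omega)
    rw [RState.main_set_one] at d
    change RRun _ _ _ _ _ _ (RState.main M K (m - j - 1) _ _) at d
    rw [show m - j - 1 = m - (j + 1) by omega] at d
    refine .seq d ?_
    rw [List.range_succ, List.map_append, ← List.append_assoc]
    exact hdig _ (by omega) _
  · simp [rtst, RState.main, push]

end

/-! #### The value of the printed digits -/

/-- The leading `j` of the `m` lowest binary digits of a number. -/
theorem bitsVal_map_range (V m j : ℕ) (hj : j ≤ m) :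
    bitsVal ((List.range j).map fun i => decide (V / 2 ^ (m - (i + 1)) % 2 = 1)) =
      V / 2 ^ (m - j) % 2 ^ j := by
  induction j with
  | zero => simp [bitsVal, Nat.mod_one]
  | succ j ih =>
    rw [List.range_succ, List.map_append, List.map_singleton, bitsVal_append_singleton,
      ih (by omega), show m - j = m - (j + 1) + 1 by omega, pow_succ, ← Nat.div_div_eq_div_mul]
    generalize V / 2 ^ (m - (j + 1)) = y
    rw [pow_succ', Nat.mod_mul, add_comm]
    congr 1
    rcases Nat.mod_two_eq_zero_or_one y with h | h <;> simp [h]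

/-- The printed string represents the approximation of `mu f`. -/
theorem represents_digits (f : ℕ → ℕ) {K : ℕ} (hK : 0 < K) :
    Represents ([digitSym f K (len K - 1), Sym.point] ++
      (List.range (len K - 1)).map fun i => digitSym f K (len K - 1 - (i + 1)))
      (((total K (numer f K) % 2 ^ len K : ℕ) : ℝ) / 2 ^ (len K - 1)) := by
  have hlen : len K = len K - 1 + 1 := by rw [len]; omega
  refine ⟨false, [decide (total K (numer f K) / 2 ^ (len K - 1) % 2 = 1)],
    (List.range (len K - 1)).map fun i =>
      decide (total K (numer f K) / 2 ^ (len K - 1 - (i + 1)) % 2 = 1), by simp, ?_, ?_⟩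
  · have h1 : digitSym f K (len K - 1) =
        Sym.digit (decide (total K (numer f K) / 2 ^ (len K - 1) % 2 = 1)) := by
      rw [digitSym, digit_eq (by omega)]
    have h2 : ((List.range (len K - 1)).map fun i => digitSym f K (len K - 1 - (i + 1))) =
        ((List.range (len K - 1)).map fun i =>
          decide (total K (numer f K) / 2 ^ (len K - 1 - (i + 1)) % 2 = 1)).map Sym.digit := by
      rw [List.map_map]
      refine List.map_congr_left fun i hi => ?_
      rw [List.mem_range] at hi
      rw [digitSym, digit_eq (by omega)]
      rfl
    rw [h1, h2]
    rfl
  · rw [bitsVal_map_range _ _ _ le_rfl, Nat.sub_self, pow_zero, Nat.div_one, List.length_map,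
      List.length_range]
    have h3 : bitsVal [decide (total K (numer f K) / 2 ^ (len K - 1) % 2 = 1)] =
        total K (numer f K) / 2 ^ (len K - 1) % 2 := by
      rcases Nat.mod_two_eq_zero_or_one (total K (numer f K) / 2 ^ (len K - 1)) with h | h <;>
        simp [h, bitsVal]
    rw [h3]
    generalize total K (numer f K) = V
    generalize len K - 1 = m at hlen
    rw [hlen, pow_succ, Nat.mod_mul]
    generalize V / 2 ^ m % 2 = x
    generalize V % 2 ^ m = y
    push_cast
    field_simp
    ring

/-! ### Space bounds -/

/-- The heads of the work tapes visit contiguous cells, so that the number of visited cells bounds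
their positions. -/
theorem pos_lt_of_space_le {I O : Type} {M : Machine I O} {w : List I} {S : ℕ}
    (hS : M.space w ≤ S) {c : M.Cfg} (hc : StateTransition.Reaches (M.next w) M.init c)
    (i : Fin M.tapes) : c.pos i < S := by
  have key : ∀ p ≤ c.pos i, ∃ c' : M.Cfg,
      StateTransition.Reaches (M.next w) M.init c' ∧ c'.pos i = p := by
    induction hc with
    | refl => exact fun p hp => ⟨M.init, .refl, (Nat.le_zero.1 hp).symm⟩
    | @tail b c hb hbc ih =>
      intro p hp
      by_cases h : p ≤ b.pos i
      · exact ih p h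
      · refine ⟨c, hb.tail hbc, ?_⟩
        obtain ⟨r, -, hr⟩ := Option.map_eq_some_iff.1 hbc
        subst hr
        revert hp
        simp only [Machine.moveWork]
        split <;> omega
  have h1 : ((c.pos i + 1 : ℕ) : ℕ∞) ≤ M.space w := by
    rw [Machine.space, ← Finset.card_range (c.pos i + 1), ← Set.encard_coe_eq_coe_finsetCard,
      ← (Prod.mk_right_injective i).encard_image]
    refine Set.encard_le_encard ?_
    rintro - ⟨p, hp, rfl⟩
    rw [Finset.mem_coe, Finset.mem_range, Nat.lt_succ_iff] at hp
    exact key p hp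
  exact_mod_cast h1.trans hS

theorem numeralLength_mono {k K : ℕ} (h : k ≤ K) : numeralLength k ≤ numeralLength K := by
  have h1 := Nat.size_le_size h
  unfold numeralLength
  split_ifs with h2 h3 h3
  · exact le_rfl
  · exact Nat.size_pos.2 (by omega)
  · omega
  · exact h1

theorem numeralLength_le_log {n : ℕ} (hn : 12 ≤ n) : numeralLength (n / 3 + 2) ≤ Nat.log 2 n := by
  rw [numeralLength, if_neg (by omega), Nat.size_le]
  have := Nat.lt_pow_succ_log_self (b := 2) (by norm_num) n
  rw [pow_succ] at this
  omega

theorem adequate_of_space_le {M : Machine Bool Bool} {f s : ℕ → ℕ} (hs : Monotone s)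
    (hM : ∀ k, M.Outputs (numeral k) (numeral (f k)) ∧
      M.space (numeral k) ≤ (s (numeral k).length : ℕ∞)) {K L : ℕ} (hL : numeralLength K ≤ L) :
    Adequate M f K L (s L) := by
  have hlen : ∀ k ≤ K, (numeral k).length ≤ L := fun k hk => by
    rw [length_numeral]; exact (numeralLength_mono hk).trans hL
  exact ⟨hlen, fun k _ => (hM k).1, fun k hk c hc i =>
    (pos_lt_of_space_le (hM k).2 hc i).trans_le (hs (hlen k hk))⟩

theorem size_pow_le (n C : ℕ) : ((n + 4) ^ C).size ≤ C * (Nat.log 2 n + 3) + 1 := by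
  rw [Nat.size_le]
  have h1 := Nat.lt_pow_succ_log_self (b := 2) (by norm_num) n
  have h2 : n + 4 ≤ 2 ^ (Nat.log 2 n + 3) := by
    have : 1 ≤ 2 ^ Nat.log 2 n := Nat.one_le_two_pow
    rw [pow_succ] at h1
    rw [pow_add]
    omega
  calc (n + 4) ^ C ≤ (2 ^ (Nat.log 2 n + 3)) ^ C := Nat.pow_le_pow_left h2 C
    _ = 2 ^ (C * (Nat.log 2 n + 3)) := by rw [← pow_mul, mul_comm]
    _ < _ := Nat.pow_lt_pow_right (by norm_num) (Nat.lt_succ_self _)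

open Asymptotics Filter

theorem one_isBigO_log : (fun _ : ℕ => (1 : ℝ)) =O[atTop] fun n : ℕ => Real.log n :=
  (Real.isLittleO_const_log_atTop.comp_tendsto tendsto_natCast_atTop_atTop).isBigO

theorem natLog_isBigO_log :
    (fun n : ℕ => (Nat.log 2 n : ℝ)) =O[atTop] fun n : ℕ => Real.log n := by
  refine IsBigO.of_bound 2 ((eventually_ge_atTop 1).mono fun n hn => ?_)
  have h1 : ((2 ^ Nat.log 2 n : ℕ) : ℝ) ≤ n := by
    exact_mod_cast Nat.pow_log_le_self 2 (by omega)
  have h2 := Real.log_le_log (by positivity) h1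
  rw [Nat.cast_pow, Real.log_pow, Nat.cast_ofNat] at h2
  rw [Real.norm_of_nonneg (by positivity), Real.norm_of_nonneg (Real.log_natCast_nonneg n)]
  have h3 : (0 : ℝ) ≤ Nat.log 2 n := by positivity
  nlinarith [Real.log_two_gt_d9]

variable {M : Machine Bool Bool} {f : ℕ → ℕ} {q : Prop}

/-- If `f`, capped at `K`, is computed by a register program in which all numbers are
polynomially bounded, then `mu f` is computed in logarithmic space, apart from the space for
the calls of the simulated machine. -/
theorem mu_mem_SPACE (hf : StrictMonoOn f (Set.Ici 1))
    (hcap : ∀ a, LS M f q a → LS M f q fun K σ => cap f K (a K σ)) {Lw Ls : ℕ → ℕ}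
    (hq : ∀ n, q → Adequate M f (n / 3 + 2) (Lw n) (Ls n)) {g : ℕ → ℝ}
    (hg : (fun n : ℕ => Real.log n) =O[atTop] g) (hLw : (fun n => (Lw n : ℝ)) =O[atTop] g)
    (hLs : (fun n => (Ls n : ℝ)) =O[atTop] g) : mu f ∈ SPACE g := by
  obtain ⟨P, C, hP⟩ := exists_printing_program hcap
  -- The program runs with `Ls n + 1`, since `exists_printing_program` needs a positive bound.
  refine ⟨fun n => P.width * (((n + 4) ^ C).size + 1) + (Lw n + 3) + M.tapes * (Ls n + 1 + 2),
    ⟨rMachine M P, fun n => ?_⟩, ?_⟩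
  -- `8 / 8 ^ K ≤ 1 / 2 ^ n` because `n + 3 ≤ 3 * (n / 3 + 2)`.
  · obtain ⟨s, hs, hout⟩ := hP n (Lw n) (Ls n + 1) (fun h => ⟨(hq n h).1, (hq n h).2,
      fun k hk c hc i => ((hq n h).3 k hk c hc i).trans (Nat.lt_succ_self _)⟩) (Nat.succ_pos _)
    have hspec := rMachine_spec hs
    refine ⟨⟨s.out, _, hspec.1, hout ▸ represents_digits f (by omega), ?_⟩, hspec.2⟩
    refine (abs_total_mod_sub_mu_le hf (by omega)).trans ?_
    rw [div_le_div_iff₀ (by positivity) (by positivity), one_mul,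
      show (8 : ℝ) = 2 ^ 3 by norm_num, ← pow_mul, ← pow_add]
    exact pow_le_pow_right₀ (by norm_num) (by omega)
  · have h1 := one_isBigO_log.trans hg
    have hsize : (fun n : ℕ => (((n + 4) ^ C).size : ℝ)) =O[atTop] g := by
      have h2 : (fun n : ℕ => (C : ℝ) * (Nat.log 2 n + 3 * 1) + 1) =O[atTop] g :=
        (((natLog_isBigO_log.trans hg).add (h1.const_mul_left 3)).const_mul_left C).add h1
      refine IsBigO.trans (IsBigO.of_norm_le fun n => ?_) h2
      rw [Real.norm_of_nonneg (by positivity), mul_one]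
      exact_mod_cast size_pow_le n C
    have := (((hsize.add h1).const_mul_left (P.width : ℝ)).add
      (hLw.add (h1.const_mul_left 3))).add
      ((hLs.add (h1.const_mul_left 3)).const_mul_left (M.tapes : ℝ))
    refine this.congr_left fun n => ?_
    push_cast
    ring

/-- A machine without work tapes, for programs that call no machine. -/
def trivialMachine : Machine Bool Bool where
  State := Unit
  finite_state := inferInstance
  Work := Unit
  finite_work := inferInstance
  tapes := 0
  start := ()
  blank := ()
  step := fun _ _ _ => none

/-- If `f`, capped at `K`, is computed by a register program in which all numbers are
polynomially bounded, then `mu f` is computable in logarithmic space. -/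
theorem mu_mem_SPACE_log (hf : StrictMonoOn f (Set.Ici 1))
    (hcap : ∀ a, LS trivialMachine f False a →
      LS trivialMachine f False fun K σ => min (f (a K σ)) K) :
    mu f ∈ SPACE fun n : ℕ => Real.log n := by
  have h0 : (fun n : ℕ => (((fun _ => 0) n : ℕ) : ℝ)) =O[atTop] fun n : ℕ => Real.log n := by
    simpa using isBigO_zero _ _
  exact mu_mem_SPACE (q := False) (Lw := fun _ => 0) (Ls := fun _ => 0) hf
    (fun a ha => LS.ite (ha.le .param) (hcap a ha) .param) (fun _ => False.elim)
    (isBigO_refl _ _) h0 h0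

theorem LS.min_pow {a : ℕ → (ℕ → ℕ) → ℕ} (ha : LS M f q a) (d : ℕ) :
    LS M f q fun K σ => min (a K σ ^ d) K := by
  induction d with
  | zero => simpa only [pow_zero] using (LS.const 1).min .param
  | succ d ih =>
    convert (ih.mul ha).min .param using 3 with K σ
    rcases Nat.eq_zero_or_pos (a K σ) with h | h
    · simp [h]
    · have h1 : K ≤ K * a K σ := Nat.le_mul_of_pos_right K h
      rcases le_total (a K σ ^ d) K with h2 | h2
      · rw [min_eq_left h2, pow_succ]
      · rw [min_eq_right h2, min_eq_right h1, pow_succ, min_eq_right]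
        exact h1.trans (Nat.mul_le_mul_right _ h2)

theorem LS.min_factorial {a : ℕ → (ℕ → ℕ) → ℕ} (ha : LS M f q a) :
    LS M f q fun K σ => min (a K σ).factorial K := by
  have key : ∀ K n, (Nat.rec (min 1 K) (fun i x => min (x * (i + 1)) K) n : ℕ) =
      min n.factorial K := by
    intro K n
    induction n with
    | zero => rfl
    | succ n ih =>
      simp only [ih]
      have h1 : K ≤ K * (n + 1) := Nat.le_mul_of_pos_right K (Nat.succ_pos n)
      rw [Nat.factorial_succ, mul_comm (n + 1)]
      rcases le_total n.factorial K with h2 | h2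
      · rw [min_eq_left h2]
      · rw [min_eq_right h2, min_eq_right h1, min_eq_right]
        exact h1.trans (Nat.mul_le_mul_right _ h2)
  have := LS.recursion (g := fun K i x _ => min (x * (i + 1)) K) ((LS.const 1).min .param)
    (((LS.var 0).mul (LS.var 1).succ).min .param) ha (LS.param (M := M) (f := f) (q := q)).polyBdd
    fun K _ n _ => by rw [key]; exact min_le_right _ _
  simpa only [key] using this

end RealSpace

open Asymptotics Filter in
theorem mainTheorem3 :
    (∀ f s : ℕ → ℕ, StrictMonoOn f (Set.Ici 1) → Monotone s → RealSpace.ComputableInSpace f s →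
      RealSpace.mu f ∈ RealSpace.SPACE fun n : ℕ =>
        max (max (Real.log (f n)) (Real.log n)) (s (Nat.log 2 n) : ℝ)) ∧
    (∀ d : ℕ, 0 < d →
      RealSpace.mu (fun k => k ^ d) ∈ RealSpace.SPACE fun n : ℕ => Real.log n) ∧
    RealSpace.mu Nat.factorial ∈ RealSpace.SPACE fun n : ℕ => (n : ℝ) * Real.log n := by
  refine ⟨fun f s hf hs ⟨M, hM⟩ => ?_, fun d hd => ?_, ?_⟩
  · have hlog : (fun n : ℕ => Real.log n) =O[atTop] fun n : ℕ =>
        max (max (Real.log (f n)) (Real.log n)) (s (Nat.log 2 n) : ℝ) :=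
      IsBigO.of_norm_le fun n => by
        rw [Real.norm_of_nonneg (Real.log_natCast_nonneg n)]
        exact (le_max_right _ _).trans (le_max_left _ _)
    have hLw : (fun n : ℕ => max (Nat.log 2 n) (RealSpace.numeralLength (n / 3 + 2))) =ᶠ[atTop]
        Nat.log 2 := (eventually_ge_atTop 12).mono fun n hn =>
      max_eq_left (RealSpace.numeralLength_le_log hn)
    refine RealSpace.mu_mem_SPACE (M := M) (q := True) hf (fun a ha => RealSpace.LS.cap_call ha)
      (fun n _ => RealSpace.adequate_of_space_le hs hM (le_max_right (Nat.log 2 n) _)) hlog ?_ ?_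
    · exact (RealSpace.natLog_isBigO_log.trans hlog).congr'
        (hLw.symm.mono fun n hn => congrArg Nat.cast hn) EventuallyEq.rfl
    · have h1 : (fun n : ℕ => (s (Nat.log 2 n) : ℝ)) =O[atTop] fun n : ℕ =>
          max (max (Real.log (f n)) (Real.log n)) (s (Nat.log 2 n) : ℝ) :=
        IsBigO.of_norm_le fun n => by
          rw [Real.norm_of_nonneg (Nat.cast_nonneg _)]
          exact le_max_right _ _
      exact h1.congr' (hLw.symm.mono fun n hn => congrArg (fun m => (s m : ℝ)) hn) EventuallyEq.rfl
  · exact RealSpace.mu_mem_SPACE_log ((Nat.pow_left_strictMono hd.ne').strictMonoOn _)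
      fun a ha => ha.min_pow d
  · obtain ⟨T, hT, hT'⟩ := RealSpace.mu_mem_SPACE_log (f := Nat.factorial)
      (fun a ha b _ hab => (Nat.factorial_lt ha).2 hab) fun a ha => ha.min_factorial
    refine ⟨T, hT, hT'.trans (IsBigO.of_bound 1 ((eventually_ge_atTop 1).mono fun n hn => ?_))⟩
    have h1 : (1 : ℝ) ≤ n := by exact_mod_cast hn
    rw [norm_mul, one_mul, Real.norm_of_nonneg (Nat.cast_nonneg n)]
    exact le_mul_of_one_le_left (norm_nonneg _) h1
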